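/- Let $\lambda, v, p, w>0$ and $\beta>2$. Let $\Phi$ be a homogeneous Poisson point process of intensity $\lambda$ in $\mathbb{R}^2$ (the nodes), and let a user move from the origin at time $t=0$ along a straight line with constant speed $v$. Let $L(t)$ be the distance at time $t\ge 0$ from the user to the closest point of $\Phi$, and let $\mathrm{SNR}(t)=p\,L(t)^{-\beta}/w$ (which is $+\infty$ if $L(t)=0$, and $0$ if $\Phi=\emptyset$). For $\gamma>0$ let $C^{(\gamma)}(t)=\mathbf 1(\mathrm{SNR}(t)\ge\gamma)$ be the SNR level crossing process and $r_\gamma=\left(\frac{p}{w\gamma}\right)^{1/\beta}$ the radius of coverage. The up-crossings are the times $t>0$ such that $C^{(\gamma)}(t)=1$ and $C^{(\gamma)}=0$ on $(t-\varepsilon,t)$ for some $\varepsilon>0$; let $T^{(\gamma)}_1<T^{(\gamma)}_2<\cdots$ be their increasing enumeration. (1) For every $\gamma>0$, almost surely there are infinitely many up-crossings and they are exhausted by the strictly increasing sequence $(T^{(\gamma)}_n)_{n\ge1}$. This sequence is a (delayed) renewal process: the inter-arrival times $T^{(\gamma)}_{n+1}-T^{(\gamma)}_n$, $n\ge1$,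 are almost surely positive, identically distributed, independent of each other and jointly independent of the first epoch $T^{(\gamma)}_1$, whose law may differ. Let $V^{(\gamma)}$ be a typical inter-arrival time, that is, a random variable with the common law of $T^{(\gamma)}_{n+1}-T^{(\gamma)}_n$, $n\ge1$. Then: (2) with $f(\gamma)=2\lambda v r_\gamma$, the random variable $f(\gamma)V^{(\gamma)}$ converges in distribution to $\mathrm{Exp}(1)$ as $\gamma\to\infty$; (3) with $g(\gamma)=2\lambda v r_\gamma e^{-\lambda\pi r_\gamma^2}$, the random variable $g(\gamma)V^{(\gamma)}$ converges in distribution to $\mathrm{Exp}(1)$ as $\gamma\to0^+$. -/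

import Mathlib

open MeasureTheory ProbabilityTheory Filter Topology
open scoped ENNReal NNReal

noncomputable section

namespace PoissonCellular

/-- The Euclidean plane. -/
abbrev Plane : Type := EuclideanSpace ℝ (Fin 2)

/-- `Φ` is a homogeneous Poisson point process of intensity `lam` in the plane: a random locally
finite set of points whose counts in Borel sets are random variables, with the Poisson law of
mean `lam * |A|` for every Borel set `A` of finite area, and independent on disjoint Borel sets. -/
structure IsPoissonPointProcess {Ω : Type*} [MeasurableSpace Ω] (Φ : Ω → Set Plane) (lam : ℝ)
    (P : Measure Ω) : Prop where
  locallyFinite : ∀ ω, ∀ R : ℝ, (Φ ω ∩ Metric.closedBall 0 R).Finite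
  measurable_count : ∀ A : Set Plane, MeasurableSet A → Measurable fun ω => (Φ ω ∩ A).encard
  law_count : ∀ A : Set Plane, MeasurableSet A → volume A ≠ ∞ →
    HasLaw (fun ω => (Φ ω ∩ A).encard)
      ((poissonMeasure (lam.toNNReal * (volume A).toNNReal)).map (fun n : ℕ => (n : ℕ∞))) P
  indep_count : ∀ A : ℕ → Set Plane, (∀ i, MeasurableSet (A i)) →
    Pairwise (fun i j => Disjoint (A i) (A j)) →
    iIndepFun (fun i ω => (Φ ω ∩ A i).encard) P

/-- Location at time `t` of a user who starts at the origin and moves with speed `v` along the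
direction `u`. -/
def userPosition (v : ℝ) (u : Plane) (t : ℝ) : Plane := (v * t) • u

/-- Distance `L(t)` from the user to the closest node of the configuration `S` (it is `∞` if there
is no node at all). -/
def nodeDistance (S : Set Plane) (v : ℝ) (u : Plane) (t : ℝ) : ℝ≥0∞ :=
  Metric.infEDist (userPosition v u t) S

/-- The signal-to-noise ratio `p L(t)^(-β) / w`, which is `∞` when `L(t) = 0` and `0` when
`L(t) = ∞`. -/
def snr (p w β : ℝ) (S : Set Plane) (v : ℝ) (u : Plane) (t : ℝ) : ℝ≥0∞ :=
  ENNReal.ofReal p * nodeDistance S v u t ^ (-β) / ENNReal.ofReal w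

open Classical in
/-- The SNR level crossing process `C(t) = 1(SNR(t) ≥ γ)`. -/
def levelCrossing (p w β γ : ℝ) (S : Set Plane) (v : ℝ) (u : Plane) (t : ℝ) : ℕ :=
  if ENNReal.ofReal γ ≤ snr p w β S v u t then 1 else 0

/-- The SNR up-crossing times: the times `t > 0` at which the level crossing process switches
from `0` to `1`. -/
def upCrossings (p w β γ : ℝ) (S : Set Plane) (v : ℝ) (u : Plane) : Set ℝ :=
  {t | 0 < t ∧ (∀ᶠ s in 𝓝[<] t, levelCrossing p w β γ S v u s = 0) ∧
    levelCrossing p w β γ S v u t = 1}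

/-- The successive elements of a set of times, in increasing order, starting with index `0`.
(This is meaningful for infinite, locally finite sets that are bounded below.) -/
def successive (U : Set ℝ) : ℕ → ℝ
  | 0 => sInf U
  | n + 1 => sInf {t | t ∈ U ∧ successive U n < t}

/-- The `(n + 1)`-st SNR up-crossing time. -/
def upCrossingTime (p w β γ : ℝ) (S : Set Plane) (v : ℝ) (u : Plane) (n : ℕ) : ℝ :=
  successive (upCrossings p w β γ S v u) n

/-- The `(n + 1)`-st inter-arrival time between successive SNR up-crossings. -/
def interArrival (p w β γ : ℝ) (S : Set Plane) (v : ℝ) (u : Plane) (n : ℕ) : ℝ :=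
  upCrossingTime p w β γ S v u (n + 1) - upCrossingTime p w β γ S v u n

/-- The radius of coverage `r_γ = (p / (w γ))^(1/β)`. -/
def coverageRadius (p w β γ : ℝ) : ℝ := (p / (w * γ)) ^ (1 / β)

/-- The random times `T 0 < T 1 < ⋯` form a (delayed) renewal process: the inter-arrival times
`T (n + 1) - T n` are positive and identically distributed, and they are independent of each other
and of the first epoch `T 0`, whose law may be different. -/
structure IsRenewalProcess {Ω : Type*} [MeasurableSpace Ω] (T : ℕ → Ω → ℝ) (P : Measure Ω) :
    Prop where
  aemeasurable : ∀ n, AEMeasurable (T n) P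
  nonneg : ∀ᵐ ω ∂P, 0 ≤ T 0 ω
  increasing : ∀ᵐ ω ∂P, ∀ n, T n ω < T (n + 1) ω
  indep : iIndepFun (fun (n : ℕ) ω => if n = 0 then T 0 ω else T n ω - T (n - 1) ω) P
  identDistrib : ∀ n, IdentDistrib (fun ω => T (n + 1) ω - T n ω) (fun ω => T 1 ω - T 0 ω) P P

instance isProbabilityMeasure_expMeasure_one : IsProbabilityMeasure (expMeasure 1) :=
  isProbabilityMeasure_expMeasure one_pos

end PoissonCellular

end

noncomputable section

namespace PoissonCellular

/-! Choose an orthonormal basis whose first vector is the direction of motion. A node at offset `y`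
from the line, `|y| ≤ r`, covers the user exactly during a closed time interval, whose length is the
chord of the disc at height `y` divided by `v`. The pairs (start of the interval, length) form a
Poisson process on `ℝ × ℝ` of intensity `f da ⊗ G`, with `f = 2λvr` and `G` the law of the chord
length for uniform `y` (`isPoissonLaw_randomPassages`). The level crossing process is thus the busy
indicator of an M/G/∞ queue, and an up-crossing is an arrival that finds the system empty
(`upCrossings_eq`).

Renewal. At an up-crossing every earlier interval is over, so what follows depends only on the new
mark and on later arrivals. The Mecke formula makes this exact without stopping times: the expected
number of atoms `z` whose strict past has one property and whose strict future, together with `z`,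
has another factorises (`lintegral_palm`). Exactly one atom is the `n`-th epoch, so the event
"epochs up to `n` lie in `K`, next gap exceeds `t`" has probability `P(K) · tail(t)`
(`measure_stoppedEpochs_mul`). The factor `tail` does not depend on `n`, which gives both
independence and a common law. Recurrence comes from the second Borel–Cantelli lemma on disjoint
blocks (`ae_infinite_upTimes`).

Limits. Splitting according to the last epoch in `(0, t]` gives the renewal equation `tail(t) + ∫₀ᵗ
h(a) tail(t - a) da = 1` with `h(a) = f · G(-∞, a) · P(no later arrival is still active at a)`.
Marks are at most `d = 2r/v`, so for `a > d` the rate `h` is the constant `g = f exp(-f ℓ)`, where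
`ℓ` is the mean chord time and `f ℓ = λπr²`. If `h ≤ B` on `(0, d]`, then `tail` solves the integral
equation of `exp(-g t)` up to an error `(g + B) d`, and Grönwall's inequality bounds the difference
by `(g + B) d exp(g t)` (`abs_tail_sub_exp_le`). At times of order `1/g` it remains to see that `(g
+ B) d → 0`.

For small `r` the trivial bound `B = f` suffices, since `f d = 4λr²`, and `g/f → 1` permits the
normalisation by `f`. For large `r`, short chords are rare (`chordLaw_Iio_le`) and the system is
unlikely to be vacant, so `B = 15/(f d²)` works (`epochRate_le_div`); then `B d = 15/(4λr²)` and `g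
d = 4λr² exp(-λπr²)` both vanish. -/

/-! ### Configurations of marked times -/

/-- A measure on `ℝ × ℝ` that is a sum of unit masses, finitely many in every vertical strip of
bounded width. The first coordinate of an atom is a time, the second one its mark. -/
def IsConfig (M : Measure (ℝ × ℝ)) : Prop :=
  ∃ (ι : Type) (x : ι → ℝ × ℝ), M = Measure.sum (fun i => Measure.dirac (x i)) ∧
    ∀ R : ℝ, {i | |(x i).1| ≤ R}.Finite

/-- Locally finite configurations of marked times. -/
structure Config where
  /-- The underlying measure, which gives mass one to each atom. -/
  val : Measure (ℝ × ℝ)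
  isConfig : IsConfig val

/-- The coarsest σ-algebra that makes every count `M.1 A` with `A` measurable a measurable function
of the configuration. -/
instance : MeasurableSpace Config := MeasurableSpace.comap Config.val inferInstance

namespace Config

theorem measurable_val : Measurable (fun M : Config => M.1) := comap_measurable _

theorem measurable_coe {A : Set (ℝ × ℝ)} (hA : MeasurableSet A) :
    Measurable (fun M : Config => M.1 A) :=
  (Measure.measurable_coe hA).comp measurable_val

theorem measurable_of_coe {α : Type*} [MeasurableSpace α] {f : α → Config}
    (hf : ∀ A, MeasurableSet A → Measurable (fun a => (f a).1 A)) : Measurable f :=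
  measurable_comap_iff.2 (Measure.measurable_of_measurable_coe _ hf)

/-- The vertical strip over `[j, j + 1)`. -/
def strip (j : ℤ) : Set (ℝ × ℝ) := Prod.fst ⁻¹' Set.Ico (j : ℝ) (j + 1)

theorem measurableSet_strip (j : ℤ) : MeasurableSet (strip j) := measurable_fst measurableSet_Ico

theorem iUnion_strip : ⋃ j, strip j = Set.univ := by
  simp only [strip, ← Set.preimage_iUnion]
  rw [iUnion_Ico_intCast, Set.preimage_univ]

theorem pairwise_disjoint_strip : Pairwise (Function.onFun Disjoint strip) := fun _ _ h =>
  (Set.pairwise_disjoint_Ico_intCast ℝ h).preimage _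

theorem _root_.PoissonCellular.IsConfig.apply_eq {ι : Type} {x : ι → ℝ × ℝ} {A : Set (ℝ × ℝ)}
    (hA : MeasurableSet A) :
    Measure.sum (fun i => Measure.dirac (x i)) A = ({i | x i ∈ A}.encard : ℝ≥0∞) := by
  rw [Measure.sum_apply _ hA, ← ENNReal.tsum_set_one, tsum_subtype {i | x i ∈ A} (fun _ => (1 : ℝ≥0∞))]
  refine tsum_congr fun i => ?_
  rw [Measure.dirac_apply' _ hA]
  rfl

theorem exists_natCast (M : Config) {A : Set (ℝ × ℝ)} (hA : MeasurableSet A) {R : ℝ}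
    (hR : ∀ z ∈ A, |z.1| ≤ R) : ∃ n : ℕ, M.1 A = n := by
  obtain ⟨ι, x, hM, hfin⟩ := M.2
  rw [hM, IsConfig.apply_eq hA]
  have : {i | x i ∈ A}.Finite := (hfin R).subset fun i hi => hR _ hi
  exact ⟨this.toFinset.card, by simp [this.encard_eq_coe_toFinset_card]⟩

theorem strip_bound (j : ℤ) : ∀ z ∈ strip j, |z.1| ≤ |(j : ℝ)| + 1 := by
  rintro z ⟨h1, h2⟩
  rw [abs_le]
  constructor <;> cases abs_cases (j : ℝ) <;> linarith

/-- The kernel that sends a configuration to itself, seen as a measure. -/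
def kernel : Kernel Config (ℝ × ℝ) := ⟨fun M => M.1, measurable_val⟩

theorem kernel_apply (M : Config) : kernel M = M.1 := rfl

/-- Counts in a strip are finite but not bounded uniformly in the configuration. Cutting by the
strip `j` and by the value `n` of the count in it gives pieces of mass at most `n`, countably many
in all. S-finiteness is what permits measurable sections and the product with a law of
configurations. -/
instance : IsSFiniteKernel kernel := by
  classical
  have hms : ∀ (j : ℤ) (n : ℕ), MeasurableSet {M : Config | M.1 (strip j) = n} := fun j n =>
    measurable_coe (measurableSet_strip j) (measurableSet_singleton _)
  let κ : ℤ × ℕ → Kernel Config (ℝ × ℝ) := fun p =>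
    Kernel.piecewise (hms p.1 p.2) (kernel.restrict (measurableSet_strip p.1)) 0
  have hfin : ∀ p, IsFiniteKernel (κ p) := fun p => by
    refine ⟨⟨p.2, by simp, fun M => ?_⟩⟩
    simp only [κ, Kernel.piecewise_apply']
    split_ifs with h
    · rw [Kernel.restrict_apply, Measure.restrict_apply_univ, kernel_apply]
      exact le_of_eq h
    · simp
  have hsum : kernel = Kernel.sum κ := by
    ext M A hA
    rw [Kernel.sum_apply' _ _ hA, ENNReal.tsum_prod', kernel_apply]
    have h1 : ∀ j : ℤ, ∑' n : ℕ, κ (j, n) M A = (M.1.restrict (strip j)) A := fun j => by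
      obtain ⟨n, hn⟩ := M.exists_natCast (measurableSet_strip j) (strip_bound j)
      rw [tsum_eq_single n]
      · simp only [κ, Kernel.piecewise_apply', Set.mem_ofPred_eq, hn, if_true,
          Kernel.restrict_apply, kernel_apply]
      · intro m hm
        simp only [κ, Kernel.piecewise_apply', Set.mem_ofPred_eq, hn]
        rw [if_neg]
        · simp
        · exact_mod_cast hm.symm
    simp_rw [h1]
    rw [← Measure.sum_apply _ hA, ← Measure.restrict_iUnion pairwise_disjoint_strip
      measurableSet_strip, iUnion_strip, Measure.restrict_univ]
  rw [hsum]
  infer_instance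

/-- Counts in measurably parametrized sets are jointly measurable in the parameter and the
configuration. -/
theorem measurable_measure_section {α : Type*} [MeasurableSpace α] {f : α → Config}
    (hf : Measurable f) {S : Set (α × (ℝ × ℝ))} (hS : MeasurableSet S) :
    Measurable fun a => (f a).1 {z | (a, z) ∈ S} := by
  have := Kernel.measurable_kernel_prodMk_left (κ := kernel.comap f hf) hS
  exact this

/-- The configuration with an additional atom. -/
def add (M : Config) (z : ℝ × ℝ) : Config := ⟨M.1 + Measure.dirac z, by
  obtain ⟨ι, x, hM, hfin⟩ := M.2
  refine ⟨Option ι, fun o => o.elim z x, ?_, fun R => ?_⟩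
  · ext A hA
    rw [Measure.add_apply, hM, IsConfig.apply_eq hA, IsConfig.apply_eq hA,
      Measure.dirac_apply' _ hA]
    have h1 : (some '' {i | x i ∈ A}).encard = {i | x i ∈ A}.encard :=
      (Option.some_injective ι).encard_image _
    by_cases hz : z ∈ A
    · have : {o : Option ι | o.elim z x ∈ A} = insert none (some '' {i | x i ∈ A}) := by
        ext (_ | i) <;> simp [hz]
      rw [this, Set.encard_insert_of_notMem (by simp), h1]
      simp [hz]
    · have : {o : Option ι | o.elim z x ∈ A} = some '' {i | x i ∈ A} := by
        ext (_ | i) <;> simp [hz]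
      rw [this, h1]
      simp [hz]
  · refine ((hfin R).image some |>.union (Set.finite_singleton none)).subset ?_
    rintro (_ | i) hi
    · right; rfl
    · left; exact ⟨i, hi, rfl⟩⟩

theorem add_val (M : Config) (z : ℝ × ℝ) : (M.add z).1 = M.1 + Measure.dirac z := rfl

open Classical in
/-- The restriction of a configuration to a set. -/
def res (A : Set (ℝ × ℝ)) (M : Config) : Config := if hA : MeasurableSet A then ⟨M.1.restrict A, by
  obtain ⟨ι, x, hM, hfin⟩ := M.2
  refine ⟨{i // x i ∈ A}, fun i => x i, ?_, fun R => ?_⟩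
  · ext B hB
    rw [Measure.restrict_apply hB, hM, Measure.sum_apply _ (hB.inter hA), Measure.sum_apply _ hB]
    refine Eq.trans ?_ (tsum_subtype {i | x i ∈ A} (fun i => Measure.dirac (x i) B)).symm
    refine tsum_congr fun i => ?_
    rw [Measure.dirac_apply' _ (hB.inter hA)]
    by_cases h : x i ∈ A
    · rw [Set.indicator_of_mem (s := {i | x i ∈ A}) h, Measure.dirac_apply' _ hB]
      by_cases h' : x i ∈ B <;> simp [h, h']
    · rw [Set.indicator_of_notMem (s := {i | x i ∈ A}) h]
      simp [h]
  · exact (hfin R).preimage Subtype.val_injective.injOn⟩ else M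

theorem res_val {A : Set (ℝ × ℝ)} (hA : MeasurableSet A) (M : Config) :
    (res A M).1 = M.1.restrict A := by rw [res, dif_pos hA]

theorem res_apply {A : Set (ℝ × ℝ)} (hA : MeasurableSet A) (M : Config) {B : Set (ℝ × ℝ)}
    (hB : MeasurableSet B) : (res A M).1 B = M.1 (B ∩ A) := by
  rw [res_val hA, Measure.restrict_apply hB]

/-- The configuration seen from time `s`. -/
def shift (s : ℝ) (M : Config) : Config := ⟨M.1.map (fun z => (z.1 - s, z.2)), by
  obtain ⟨ι, x, hM, hfin⟩ := M.2
  have hm : Measurable (fun z : ℝ × ℝ => (z.1 - s, z.2)) := by fun_prop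
  refine ⟨ι, fun i => ((x i).1 - s, (x i).2), ?_, fun R => (hfin (R + |s|)).subset fun i hi => ?_⟩
  · ext B hB
    rw [Measure.map_apply hm hB, hM, Measure.sum_apply _ (hm hB), Measure.sum_apply _ hB]
    refine tsum_congr fun i => ?_
    rw [Measure.dirac_apply' _ (hm hB), Measure.dirac_apply' _ hB]
    rfl
  · have h1 : |(x i).1 - s| ≤ R := hi
    have := abs_sub_abs_le_abs_sub (x i).1 s
    change |(x i).1| ≤ R + |s|
    linarith⟩

theorem shift_apply (s : ℝ) (M : Config) {B : Set (ℝ × ℝ)} (hB : MeasurableSet B) :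
    (shift s M).1 B = M.1 {z | (z.1 - s, z.2) ∈ B} :=
  Measure.map_apply (by fun_prop) hB

theorem measurable_shift (s : ℝ) : Measurable (shift s) := by
  refine measurable_of_coe fun A hA => ?_
  simp_rw [shift_apply s _ hA]
  exact measurable_coe ((by fun_prop : Measurable fun z : ℝ × ℝ => (z.1 - s, z.2)) hA)

theorem measurable_add_atom : Measurable fun p : Config × (ℝ × ℝ) => p.1.add p.2 := by
  refine measurable_of_coe fun A hA => ?_
  simp_rw [add_val, Measure.add_apply, Measure.dirac_apply' _ hA]
  exact ((measurable_coe hA).comp measurable_fst).add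
    ((measurable_const.indicator hA).comp measurable_snd)

/-- Restriction to measurably parametrized sets is jointly measurable. -/
theorem measurable_res_section {α : Type*} [MeasurableSpace α] {f : α → Config}
    (hf : Measurable f) {S : Set (α × (ℝ × ℝ))} (hS : MeasurableSet S) :
    Measurable fun a => res {z | (a, z) ∈ S} (f a) := by
  refine measurable_of_coe fun A hA => ?_
  have h : ∀ a, MeasurableSet {z | (a, z) ∈ S} := fun a => measurable_prodMk_left hS
  simp_rw [fun a => res_apply (h a) (f a) hA]
  exact measurable_measure_section (S := Prod.snd ⁻¹' A ∩ S) hf ((measurable_snd hA).inter hS)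

end Config

/-! ### Atoms of a finite family of sets -/

section Atoms

variable {E ι : Type*}

/-- The points that lie in exactly those members of a family whose index is in `σ`. -/
def atom (B : ι → Set E) (σ : Finset ι) : Set E := {z | ∀ i, z ∈ B i ↔ i ∈ σ}

theorem measurableSet_atom [Finite ι] [MeasurableSpace E] {B : ι → Set E} (hB : ∀ i, MeasurableSet (B i))
    (σ : Finset ι) : MeasurableSet (atom B σ) := by
  rw [atom, Set.ofPred_forall]
  refine MeasurableSet.iInter fun i => ?_
  by_cases h : i ∈ σ
  · simpa [h] using hB i
  · simp only [h, iff_false]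
    exact (hB i).compl

theorem disjoint_atom (B : ι → Set E) {σ τ : Finset ι} (h : σ ≠ τ) :
    Disjoint (atom B σ) (atom B τ) := by
  rw [Set.disjoint_left]
  exact fun z hz hz' => h (Finset.ext fun i => (hz i).symm.trans (hz' i))

theorem atom_subset {B : ι → Set E} {σ : Finset ι} {i : ι} (hi : i ∈ σ) : atom B σ ⊆ B i :=
  fun _ hz => (hz i).2 hi

variable (ι) in
/-- Nonempty finite index sets, which label the atoms inside the union of a family. -/
abbrev AtomIndex := {σ : Finset ι // σ.Nonempty}

variable [Fintype ι]

open Classical in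
/-- The counts of the members of a family in terms of the counts of its atoms. -/
def atomSum (c : AtomIndex ι → ℝ≥0∞) (i : ι) : ℝ≥0∞ := ∑ σ, if i ∈ σ.1 then c σ else 0

theorem measurable_atomSum : Measurable (atomSum (ι := ι)) := by
  classical
  refine measurable_pi_lambda _ fun i => Finset.measurable_sum _ fun σ _ => ?_
  split_ifs
  · exact measurable_pi_apply _
  · exact measurable_const

-- A point of `B i` lies in precisely one atom, the one labelled by all `j` with the point in `B j`.
-- This label contains `i`, which is why the empty label can be left out.
open Classical in
theorem eq_iUnion_atom (B : ι → Set E) (i : ι) :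
    B i = ⋃ σ ∈ Finset.univ.filter (fun σ : AtomIndex ι => i ∈ σ.1), atom B σ.1 := by
  ext z
  simp only [Finset.mem_filter, Finset.mem_univ, true_and, Set.mem_iUnion, exists_prop]
  constructor
  · intro hz
    have hi : i ∈ Finset.univ.filter (fun i => z ∈ B i) := by simpa using hz
    exact ⟨⟨_, i, hi⟩, hi, fun j => by simp⟩
  · rintro ⟨σ, hi, hz⟩
    exact atom_subset hi hz

theorem measure_eq_atomSum [MeasurableSpace E] (M : Measure E) {B : ι → Set E}
    (hB : ∀ i, MeasurableSet (B i)) (i : ι) :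
    M (B i) = atomSum (fun σ => M (atom B σ.1)) i := by
  classical
  conv_lhs => rw [eq_iUnion_atom B i]
  rw [measure_biUnion_finset _ fun σ _ => measurableSet_atom hB _, atomSum, Finset.sum_filter]
  intro σ _ τ _ h
  exact disjoint_atom B fun h' => h (Subtype.ext h')

theorem setLIntegral_eq_sum_atom [MeasurableSpace E] (M : Measure E) {B : ι → Set E}
    (hB : ∀ i, MeasurableSet (B i)) (i : ι) (f : E → ℝ≥0∞) :
    ∫⁻ z in B i, f z ∂M = atomSum (fun σ => ∫⁻ z in atom B σ.1, f z ∂M) i := by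
  classical
  conv_lhs => rw [eq_iUnion_atom B i]
  rw [lintegral_biUnion_finset _ fun σ _ => measurableSet_atom hB _, atomSum, Finset.sum_filter]
  intro σ _ τ _ h
  exact disjoint_atom B fun h' => h (Subtype.ext h')

end Atoms

/-! ### Poisson configurations -/

/-- The law of the number of points of a Poisson process in a set of mean `r`. -/
def poissonCount (r : ℝ≥0∞) : Measure ℝ≥0∞ :=
  (poissonMeasure r.toNNReal).map (fun n : ℕ => (n : ℝ≥0∞))

instance (r : ℝ≥0∞) : IsProbabilityMeasure (poissonCount r) :=
  Measure.isProbabilityMeasure_map Measurable.of_discrete.aemeasurable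

/-- `Q` is the law of a Poisson process with intensity measure `μ`. -/
structure IsPoissonLaw (Q : Measure Config) (μ : Measure (ℝ × ℝ)) : Prop where
  prob : IsProbabilityMeasure Q
  finite_strip : ∀ j, μ (Config.strip j) ≠ ∞
  law : ∀ A, MeasurableSet A → μ A ≠ ∞ → Q.map (fun M => M.1 A) = poissonCount (μ A)
  indep : ∀ A : ℕ → Set (ℝ × ℝ), (∀ i, MeasurableSet (A i)) →
    Pairwise (fun i j => Disjoint (A i) (A j)) → iIndepFun (fun i (M : Config) => M.1 (A i)) Q

/-- The Borel sets of finite mean measure. -/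
abbrev FiniteSet (μ : Measure (ℝ × ℝ)) := {A : Set (ℝ × ℝ) // MeasurableSet A ∧ μ A ≠ ∞}

/-- The counts of a configuration in all sets of finite mean measure. -/
def counts (μ : Measure (ℝ × ℝ)) (M : Config) (A : FiniteSet μ) : ℝ≥0∞ := M.1 A.1

theorem measurable_counts (μ : Measure (ℝ × ℝ)) : Measurable (counts μ) :=
  measurable_pi_lambda _ fun A => Config.measurable_coe A.2.1

/-- Sets of finite mean are enough: cutting by the strips writes any count as a countable sum of
counts in such sets. -/
theorem measurable_of_counts {μ : Measure (ℝ × ℝ)} (hμ : ∀ j, μ (Config.strip j) ≠ ∞)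
    {α : Type*} [MeasurableSpace α] {f : α → Config} (hf : Measurable (fun a => counts μ (f a))) :
    Measurable f := by
  refine Config.measurable_of_coe fun A hA => ?_
  have h : ∀ M : Config, M.1 A = ∑' j, M.1 (A ∩ Config.strip j) := fun M => by
    rw [← measure_iUnion, ← Set.inter_iUnion, Config.iUnion_strip, Set.inter_univ]
    · exact fun i j h => (Config.pairwise_disjoint_strip h).mono Set.inter_subset_right
        Set.inter_subset_right
    · exact fun j => hA.inter (Config.measurableSet_strip j)
  simp_rw [h]
  refine Measurable.tsum fun j => ?_
  exact (measurable_pi_apply (⟨A ∩ Config.strip j, hA.inter (Config.measurableSet_strip j),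
    measure_ne_top_of_subset Set.inter_subset_right (hμ j)⟩ : FiniteSet μ)).comp hf

theorem comap_counts {μ : Measure (ℝ × ℝ)} (hμ : ∀ j, μ (Config.strip j) ≠ ∞) :
    instMeasurableSpaceConfig = MeasurableSpace.comap (counts μ) MeasurableSpace.pi := by
  refine le_antisymm ?_ (measurable_counts μ).comap_le
  have := @measurable_of_counts μ hμ Config (MeasurableSpace.comap (counts μ) MeasurableSpace.pi)
    id (comap_measurable (counts μ))
  simpa using this.comap_le

/-- The law of a configuration is determined by its finite-dimensional distributions. -/
theorem ext_of_counts {μ : Measure (ℝ × ℝ)} (hμ : ∀ j, μ (Config.strip j) ≠ ∞)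
    {Q Q' : Measure Config} [IsFiniteMeasure Q] [IsFiniteMeasure Q']
    (h : ∀ I : Finset (FiniteSet μ), Q.map (fun M (A : I) => M.1 A.1.1) =
      Q'.map (fun M (A : I) => M.1 A.1.1)) : Q = Q' := by
  have h1 : Q.map (counts μ) = Q'.map (counts μ) := by
    refine IsProjectiveLimit.unique (P := fun I => Q.map (fun M (A : I) => M.1 A.1.1)) ?_ ?_ <;>
    intro I
    · rw [Measure.map_map (Finset.measurable_restrict _) (measurable_counts μ)]
      rfl
    · rw [Measure.map_map (Finset.measurable_restrict _) (measurable_counts μ)]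
      exact (h I).symm
  ext s hs
  rw [comap_counts hμ] at hs
  obtain ⟨t, ht, rfl⟩ := hs
  rw [← Measure.map_apply (measurable_counts μ) ht, h1, Measure.map_apply (measurable_counts μ) ht]

namespace IsPoissonLaw

variable {Q : Measure Config} {μ : Measure (ℝ × ℝ)}

/-- The structure speaks of sequences only; a countable index type is injected into `ℕ`, and the
integers that are not hit receive the empty set. -/
theorem iIndepFun_of_disjoint (hQ : IsPoissonLaw Q μ) {ι : Type*} [Countable ι]
    {B : ι → Set (ℝ × ℝ)} (hB : ∀ i, MeasurableSet (B i))
    (hd : Pairwise (fun i j => Disjoint (B i) (B j))) :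
    iIndepFun (fun i (M : Config) => M.1 (B i)) Q := by
  classical
  obtain ⟨e, he⟩ := exists_injective_nat ι
  let A : ℕ → Set (ℝ × ℝ) := fun n => ⋃ i, ⋃ _ : e i = n, B i
  have hA : ∀ i, A (e i) = B i := fun i => by
    ext z
    simp only [A, Set.mem_iUnion, exists_prop]
    exact ⟨fun ⟨j, hj, hz⟩ => he hj ▸ hz, fun hz => ⟨i, rfl, hz⟩⟩
  have := (hQ.indep A (fun n => MeasurableSet.iUnion fun i => MeasurableSet.iUnion fun _ => hB i)
    (fun n m h => by
      simp only [A, Set.disjoint_iUnion_left, Set.disjoint_iUnion_right]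
      intro i hi j hj
      exact hd fun hij => h (by rw [← hi, ← hj, hij]))).precomp he
  simpa only [hA] using this

theorem map_disjoint (hQ : IsPoissonLaw Q μ) {ι : Type*} [Fintype ι]
    {B : ι → Set (ℝ × ℝ)} (hB : ∀ i, MeasurableSet (B i)) (hf : ∀ i, μ (B i) ≠ ∞)
    (hd : Pairwise (fun i j => Disjoint (B i) (B j))) :
    Q.map (fun M i => M.1 (B i)) = Measure.pi (fun i => poissonCount (μ (B i))) := by
  have := hQ.prob
  have h := (iIndepFun_iff_map_fun_eq_pi_map
    (fun i => (Config.measurable_coe (hB i)).aemeasurable)).1 (hQ.iIndepFun_of_disjoint hB hd)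
  rw [h]
  congr 1
  ext1 i
  exact hQ.law _ (hB i) (hf i)

/-- Overlapping sets have dependent counts, but their atoms are disjoint. The joint law of any
finite family of counts is therefore an image, under `atomSum`, of a product of Poisson laws. -/
theorem map_atom (hQ : IsPoissonLaw Q μ) {ι : Type*} [Fintype ι]
    {B : ι → Set (ℝ × ℝ)} (hB : ∀ i, MeasurableSet (B i)) (hf : ∀ i, μ (B i) ≠ ∞) :
    Q.map (fun M (σ : AtomIndex ι) => M.1 (atom B σ.1)) =
      Measure.pi (fun σ : AtomIndex ι => poissonCount (μ (atom B σ.1))) :=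
  hQ.map_disjoint (fun σ => measurableSet_atom hB σ.1)
    (fun σ => by
      obtain ⟨i, hi⟩ := σ.2
      exact measure_ne_top_of_subset (atom_subset hi) (hf i))
    (fun σ τ h => disjoint_atom B fun h' => h (Subtype.ext h'))

/-- A Poisson law is determined by its intensity measure. -/
theorem unique {Q' : Measure Config} (hQ : IsPoissonLaw Q μ) (hQ' : IsPoissonLaw Q' μ) :
    Q = Q' := by
  have := hQ.prob
  have := hQ'.prob
  refine ext_of_counts hQ.finite_strip fun I => ?_
  have h : ∀ R : Measure Config, IsPoissonLaw R μ → R.map (fun M (A : I) => M.1 A.1.1) =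
      (Measure.pi (fun σ : AtomIndex I =>
        poissonCount (μ (atom (fun A : I => A.1.1) σ.1)))).map atomSum := by
    intro R hR
    rw [← hR.map_atom (fun A => A.1.2.1) (fun A => A.1.2.2),
      Measure.map_map measurable_atomSum (measurable_pi_lambda _ fun σ => Config.measurable_coe
        (measurableSet_atom (fun A : I => A.1.2.1) _))]
    congr 1
    ext M A
    exact measure_eq_atomSum M.1 (fun A : I => A.1.2.1) A
  rw [h Q hQ, h Q' hQ']

/-- The restrictions of a Poisson process to complementary sets are independent. -/
theorem indepFun_res (hQ : IsPoissonLaw Q μ) {S T : Set (ℝ × ℝ)} (hS : MeasurableSet S)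
    (hT : MeasurableSet T) (hST : Disjoint S T) :
    IndepFun (Config.res S) (Config.res T) Q := by
  have := hQ.prob
  have key : IndepFun (fun M (A : FiniteSet μ) => M.1 (A.1 ∩ S))
      (fun (M : Config) (A : FiniteSet μ) => M.1 (A.1 ∩ T)) Q := by
    refine IndepFun.process_indepFun_process
      (fun A => Config.measurable_coe (A.2.1.inter hS))
      (fun A => Config.measurable_coe (A.2.1.inter hT)) fun I J => ?_
    have hI : ∀ A : I, MeasurableSet (A.1.1 ∩ S) := fun A => A.1.2.1.inter hS
    have hJ : ∀ A : J, MeasurableSet (A.1.1 ∩ T) := fun A => A.1.2.1.inter hT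
    -- The atoms of the traces on `S` and those of the traces on `T` are put into one disjoint
    -- family. Independence of the two blocks of this family passes to the counts, which are
    -- functions of the blocks.
    let B : AtomIndex I ⊕ AtomIndex J → Set (ℝ × ℝ) :=
      Sum.elim (fun σ => atom (fun A : I => A.1.1 ∩ S) σ.1) (fun σ => atom (fun A : J => A.1.1 ∩ T) σ.1)
    have hB : ∀ i, MeasurableSet (B i) := by
      rintro (σ | σ)
      · exact measurableSet_atom hI _
      · exact measurableSet_atom hJ _
    have hsub1 : ∀ σ, B (Sum.inl σ) ⊆ S := fun σ => by
      obtain ⟨i, hi⟩ := σ.2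
      exact (atom_subset hi).trans Set.inter_subset_right
    have hsub2 : ∀ σ, B (Sum.inr σ) ⊆ T := fun σ => by
      obtain ⟨i, hi⟩ := σ.2
      exact (atom_subset hi).trans Set.inter_subset_right
    have hd : Pairwise (fun i j => Disjoint (B i) (B j)) := by
      rintro (σ | σ) (τ | τ) h
      · exact disjoint_atom _ fun h' => h (congrArg Sum.inl (Subtype.ext h'))
      · exact hST.mono (hsub1 σ) (hsub2 τ)
      · exact (hST.mono (hsub1 τ) (hsub2 σ)).symm
      · exact disjoint_atom _ fun h' => h (congrArg Sum.inr (Subtype.ext h'))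
    have hi := (hQ.iIndepFun_of_disjoint hB hd).indepFun_finset
      (Finset.univ.map ⟨Sum.inl, Sum.inl_injective⟩) (Finset.univ.map ⟨Sum.inr, Sum.inr_injective⟩)
      (by rw [Finset.disjoint_left]; simp) (fun i => Config.measurable_coe (hB i))
    have h2 := hi.comp
      (φ := fun c => atomSum (fun σ : AtomIndex I => c ⟨Sum.inl σ, by simp⟩))
      (ψ := fun c => atomSum (fun σ : AtomIndex J => c ⟨Sum.inr σ, by simp⟩))
      (measurable_atomSum.comp (measurable_pi_lambda _ fun σ => measurable_pi_apply _))
      (measurable_atomSum.comp (measurable_pi_lambda _ fun σ => measurable_pi_apply _))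
    convert h2 using 1
    · ext M A
      exact measure_eq_atomSum M.1 hI A
    · ext M A
      exact measure_eq_atomSum M.1 hJ A
  have hc : ∀ {S : Set (ℝ × ℝ)}, MeasurableSet S →
      (fun (M : Config) (A : FiniteSet μ) => M.1 (A.1 ∩ S)) = counts μ ∘ Config.res S := by
    intro S hS
    ext M A
    exact (Config.res_apply hS M A.2.1).symm
  rw [hc hS, hc hT] at key
  rw [IndepFun_iff_Indep] at key ⊢
  rwa [← MeasurableSpace.comap_comp, ← MeasurableSpace.comap_comp,
    ← comap_counts hQ.finite_strip] at key

end IsPoissonLaw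

/-! ### The Mecke formula -/

theorem lintegral_poissonMeasure (r : ℝ≥0) (ψ : ℕ → ℝ≥0∞) :
    ∫⁻ n, ψ n ∂(poissonMeasure r) =
      ∑' n : ℕ, ENNReal.ofReal (Real.exp (-r) * r ^ n / n.factorial) * ψ n := by
  rw [poissonMeasure, lintegral_sum_measure]
  refine tsum_congr fun n => ?_
  rw [lintegral_smul_measure, lintegral_dirac' _ Measurable.of_discrete, smul_eq_mul]

/-- From `n · rⁿ/n! = r · rⁿ⁻¹/(n-1)!` and a shift of the summation index. This is the Mecke formula
for a single count. -/
theorem lintegral_mul_poissonCount {r : ℝ≥0∞} (hr : r ≠ ∞) {ψ : ℝ≥0∞ → ℝ≥0∞}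
    (hψ : Measurable ψ) :
    ∫⁻ y, y * ψ y ∂(poissonCount r) = r * ∫⁻ y, ψ (y + 1) ∂(poissonCount r) := by
  lift r to ℝ≥0 using hr
  rw [poissonCount, lintegral_map (by fun_prop) Measurable.of_discrete,
    lintegral_map (by fun_prop) Measurable.of_discrete, lintegral_poissonMeasure,
    lintegral_poissonMeasure, tsum_eq_zero_add' ENNReal.summable, ← ENNReal.tsum_mul_left]
  simp only [ENNReal.toNNReal_coe, CharP.cast_eq_zero, zero_mul, mul_zero, zero_add]
  refine tsum_congr fun n => ?_
  have h1 : ((n + 1 : ℕ) : ℝ≥0∞) = ENNReal.ofReal (n + 1) := by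
    rw [← ENNReal.ofReal_natCast]; push_cast; rfl
  have h2 : (r : ℝ≥0∞) = ENNReal.ofReal r := (ENNReal.ofReal_coe_nnreal).symm
  rw [← mul_assoc, ← mul_assoc]
  congr 1
  · rw [h1, h2, ← ENNReal.ofReal_mul (by positivity), ← ENNReal.ofReal_mul (by positivity)]
    congr 1
    rw [Nat.factorial_succ]
    push_cast
    field_simp
    ring
  · push_cast; rfl

/-- Integrate the `i`-th coordinate first and use the one-dimensional identity there, with the
others frozen. -/
theorem lintegral_mul_pi_poissonCount {ι : Type*} [Fintype ι] [DecidableEq ι] {m : ι → ℝ≥0∞}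
    (hm : ∀ i, m i ≠ ∞) {ψ : (ι → ℝ≥0∞) → ℝ≥0∞} (hψ : Measurable ψ) (i : ι) :
    ∫⁻ c, c i * ψ c ∂(Measure.pi fun i => poissonCount (m i)) =
      m i * ∫⁻ c, ψ (Function.update c i (c i + 1)) ∂(Measure.pi fun i => poissonCount (m i)) := by
  have hψ' : Measurable fun c : ι → ℝ≥0∞ => ψ (Function.update c i (c i + 1)) := by
    refine hψ.comp (measurable_pi_lambda _ fun j => ?_)
    by_cases h : j = i
    · subst h
      simpa using (measurable_pi_apply j).add_const 1
    · simpa [Function.update_of_ne h] using measurable_pi_apply j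
  rw [lintegral_eq_lmarginal_univ (0 : ι → ℝ≥0∞), lintegral_eq_lmarginal_univ (0 : ι → ℝ≥0∞),
    lmarginal_erase' _ (by fun_prop) (Finset.mem_univ i),
    lmarginal_erase' _ hψ' (Finset.mem_univ i)]
  have : (fun x : ι → ℝ≥0∞ => ∫⁻ y, Function.update x i y i * ψ (Function.update x i y)
        ∂(poissonCount (m i))) =
      fun x => m i * ∫⁻ y, ψ (Function.update (Function.update x i y) i
        (Function.update x i y i + 1)) ∂(poissonCount (m i)) := by
    ext x
    simp only [Function.update_self, Function.update_idem]
    exact lintegral_mul_poissonCount (hm i) (ψ := fun y => ψ (Function.update x i y))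
      (hψ.comp (measurable_update x))
  rw [this, lmarginal, lmarginal, lintegral_const_mul]
  have h2 : Measurable fun x : ι → ℝ≥0∞ => ∫⁻ y, ψ (Function.update (Function.update x i y) i
      (Function.update x i y i + 1)) ∂(poissonCount (m i)) :=
    Measurable.lintegral_prod_right' (f := fun p : (ι → ℝ≥0∞) × ℝ≥0∞ =>
      ψ (Function.update (Function.update p.1 i p.2) i (Function.update p.1 i p.2 i + 1)))
      (hψ'.comp (measurable_update' (a := i)))
  exact h2.comp (measurable_updateFinset)

namespace IsPoissonLaw

variable {Q : Measure Config} {μ : Measure (ℝ × ℝ)}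

theorem lintegral_count (hQ : IsPoissonLaw Q μ) {A : Set (ℝ × ℝ)} (hA : MeasurableSet A)
    (hf : μ A ≠ ∞) : ∫⁻ M, M.1 A ∂Q = μ A := by
  have h : ∫⁻ y, y ∂(Q.map (fun M => M.1 A)) = ∫⁻ M, M.1 A ∂Q :=
    lintegral_map measurable_id (Config.measurable_coe hA)
  rw [← h, hQ.law A hA hf]
  have := lintegral_mul_poissonCount hf (ψ := fun _ => 1) measurable_const
  simpa using this

/-- Size-biasing by the count in `A` amounts to adding an independent point spread over `A` with
mass `μ`. On finitely many counts this is the product Poisson identity, because a point added in the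
atom `σ` raises the count of `σ` by one and leaves the other atoms alone. -/
theorem withDensity_count (hQ : IsPoissonLaw Q μ) {A : Set (ℝ × ℝ)} (hA : MeasurableSet A)
    (hf : μ A ≠ ∞) : Q.withDensity (fun M => M.1 A) =
      ((μ.restrict A).prod Q).map (fun p => p.2.add p.1) := by
  classical
  have := hQ.prob
  have hadd : Measurable (fun p : (ℝ × ℝ) × Config => p.2.add p.1) :=
    Config.measurable_add_atom.comp measurable_swap
  have : IsFiniteMeasure (Q.withDensity (fun M => M.1 A)) :=
    isFiniteMeasure_withDensity (by rw [hQ.lintegral_count hA hf]; exact hf)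
  have : IsFiniteMeasure (μ.restrict A) := ⟨by simpa using hf.lt_top⟩
  refine ext_of_counts hQ.finite_strip fun I => ?_
  -- The set `A` joins the test sets under the index `none`, so that the density is also a sum of
  -- atom counts.
  let B : Option I → Set (ℝ × ℝ) := fun o => o.elim A (fun A => A.1.1)
  have hB : ∀ o, MeasurableSet (B o) := by
    rintro (_ | A)
    · exact hA
    · exact A.1.2.1
  have hBf : ∀ o, μ (B o) ≠ ∞ := by
    rintro (_ | A)
    · exact hf
    · exact A.1.2.2
  let c : Config → AtomIndex (Option I) → ℝ≥0∞ := fun M σ => M.1 (atom B σ.1)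
  have hc : Measurable c :=
    measurable_pi_lambda _ fun σ => Config.measurable_coe (measurableSet_atom hB _)
  have hev : Measurable (fun (M : Config) (A : I) => M.1 A.1.1) :=
    measurable_pi_lambda _ fun A => Config.measurable_coe A.1.2.1
  have hevc : ∀ M : Config, (fun A : I => M.1 A.1.1) = fun A => atomSum (c M) (some A) :=
    fun M => funext fun A => measure_eq_atomSum M.1 hB (some A)
  ext K hK
  let φ : (AtomIndex (Option I) → ℝ≥0∞) → ℝ≥0∞ :=
    fun c => K.indicator 1 (fun A => atomSum c (some A))
  have hφ : Measurable φ := (measurable_one.indicator hK).comp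
    (measurable_pi_lambda _ fun A => (measurable_pi_apply _).comp measurable_atomSum)
  have hm : ∀ σ : AtomIndex (Option I), μ (atom B σ.1) ≠ ∞ := fun σ => by
    obtain ⟨i, hi⟩ := σ.2
    exact measure_ne_top_of_subset (atom_subset hi) (hBf i)
  have hφK : ∀ M : Config, φ (c M) = K.indicator 1 (fun A : I => M.1 A.1.1) := fun M => by
    simp only [φ, hevc M]
  have hup : ∀ (M : Config) (σ : AtomIndex (Option I)), ∀ z ∈ atom B σ.1,
      c (M.add z) = Function.update (c M) σ (c M σ + 1) := by
    intro M σ z hz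
    ext τ
    simp only [c, Config.add_val, Measure.add_apply,
      Measure.dirac_apply' _ (measurableSet_atom hB _)]
    by_cases h : τ = σ
    · subst h
      simp [hz]
    · rw [Function.update_of_ne h, Set.indicator_of_notMem, add_zero]
      exact Set.disjoint_left.1 (disjoint_atom B fun h' => h (Subtype.ext h'.symm)) hz
  have hL : (Q.withDensity (fun M => M.1 A)).map (fun M (A : I) => M.1 A.1.1) K =
      ∑ σ : AtomIndex (Option I), if none ∈ σ.1 then μ (atom B σ.1) *
        ∫⁻ M, φ (Function.update (c M) σ (c M σ + 1)) ∂Q else 0 := by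
    have hup' : ∀ σ : AtomIndex (Option I), Measurable
        fun x : AtomIndex (Option I) → ℝ≥0∞ => Function.update x σ (x σ + 1) := fun σ => by
      refine measurable_pi_lambda _ fun j => ?_
      by_cases h : j = σ
      · subst h
        simpa using (measurable_pi_apply j).add_const 1
      · simpa [Function.update_of_ne h] using measurable_pi_apply j
    rw [Measure.map_apply hev hK, withDensity_apply _ (hev hK), ← lintegral_indicator (hev hK)]
    have h1 : ∀ M : Config, ((fun (M : Config) (A : I) => M.1 A.1.1) ⁻¹' K).indicator
        (fun M : Config => M.1 A) M = ∑ σ, if none ∈ σ.1 then c M σ * φ (c M) else 0 := by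
      intro M
      have h2 : M.1 A = atomSum (c M) none := measure_eq_atomSum M.1 hB none
      have h3 : ((fun (M : Config) (A : I) => M.1 A.1.1) ⁻¹' K).indicator
        (fun M : Config => M.1 A) M = M.1 A * φ (c M) := by
        rw [hφK]
        by_cases h : (fun A : I => M.1 A.1.1) ∈ K
        · rw [Set.indicator_of_mem (by exact h), Set.indicator_of_mem h]
          simp
        · rw [Set.indicator_of_notMem (by exact h), Set.indicator_of_notMem h]
          simp
      rw [h3, h2, atomSum, Finset.sum_mul]
      exact Finset.sum_congr rfl fun σ _ => by split_ifs <;> simp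
    simp_rw [h1]
    rw [lintegral_finsetSum]
    · refine Finset.sum_congr rfl fun σ _ => ?_
      split_ifs with h
      · have h4 := lintegral_mul_pi_poissonCount hm hφ σ
        rw [← hQ.map_atom hB hBf, lintegral_map (by fun_prop) hc,
          lintegral_map (f := fun x => φ (Function.update x σ (x σ + 1))) (hφ.comp (hup' σ)) hc] at h4
        exact h4
      · simp
    · intro σ _
      split_ifs
      · exact ((measurable_pi_apply σ).comp hc).mul (hφ.comp hc)
      · exact measurable_const
  have hR : ((((μ.restrict A).prod Q).map (fun p => p.2.add p.1)).map
      (fun M (A : I) => M.1 A.1.1)) K = ∑ σ : AtomIndex (Option I), if none ∈ σ.1 then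
        μ (atom B σ.1) * ∫⁻ M, φ (Function.update (c M) σ (c M σ + 1)) ∂Q else 0 := by
    rw [Measure.map_apply hev hK, Measure.map_apply hadd (hev hK),
      Measure.prod_apply (hadd (hev hK))]
    have h1 : ∀ z, Q (Prod.mk z ⁻¹' ((fun p : (ℝ × ℝ) × Config => p.2.add p.1) ⁻¹'
        ((fun (M : Config) (A : I) => M.1 A.1.1) ⁻¹' K))) = ∫⁻ M, φ (c (M.add z)) ∂Q := by
      intro z
      rw [← lintegral_indicator_one (measurable_prodMk_left (hadd (hev hK)))]
      refine lintegral_congr fun M => ?_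
      rw [hφK]
      rfl
    simp_rw [h1]
    have h2 := setLIntegral_eq_sum_atom μ hB none (fun z => ∫⁻ M, φ (c (M.add z)) ∂Q)
    change ∫⁻ z in A, _ ∂μ = _ at h2
    rw [h2, atomSum]
    refine Finset.sum_congr rfl fun σ _ => ?_
    split_ifs with h
    · rw [setLIntegral_congr_fun (measurableSet_atom hB _)
        (fun z hz => lintegral_congr fun M => by rw [hup M σ z hz]), setLIntegral_const, mul_comm]
    · rfl
  rw [hL, hR]

/-- The joint law of a configuration and one of its atoms. On rectangles with a side of finite mean
it is the size-biasing identity; rectangles form a π-system, and the strips give a countable cover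
of finite mass. -/
theorem compProd_kernel (hQ : IsPoissonLaw Q μ) [SFinite μ] :
    Q ⊗ₘ Config.kernel = (μ.prod Q).map (fun p => (p.2.add p.1, p.1)) := by
  have := hQ.prob
  have hadd : Measurable (fun p : (ℝ × ℝ) × Config => p.2.add p.1) :=
    Config.measurable_add_atom.comp measurable_swap
  have hmap : Measurable (fun p : (ℝ × ℝ) × Config => (p.2.add p.1, p.1)) :=
    hadd.prodMk measurable_fst
  have key : ∀ (C : Set Config) (A : Set (ℝ × ℝ)), MeasurableSet C → MeasurableSet A → μ A ≠ ∞ →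
      (Q ⊗ₘ Config.kernel) (C ×ˢ A) = (μ.prod Q).map (fun p => (p.2.add p.1, p.1)) (C ×ˢ A) := by
    intro C A hC hA hf
    rw [Measure.compProd_apply_prod hC hA, Measure.map_apply hmap (hC.prod hA)]
    have h1 := congrArg (fun R : Measure Config => R C) (hQ.withDensity_count hA hf)
    simp only [withDensity_apply _ hC, Measure.map_apply hadd hC] at h1
    refine h1.trans ?_
    rw [← Measure.restrict_univ (μ := Q), Measure.prod_restrict, Measure.restrict_univ,
      Measure.restrict_apply (hadd hC)]
    congr 1
    ext p
    simp
  refine Measure.ext_of_generateFrom_of_cover generateFrom_prod.symm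
    (T := Set.range fun j => Set.univ ×ˢ Config.strip j) (Set.countable_range _) isPiSystem_prod
    ?_ ?_ ?_ ?_
  · rw [Set.sUnion_range, ← Set.prod_iUnion, Config.iUnion_strip, Set.univ_prod_univ]
  · rintro _ ⟨j, rfl⟩
    rw [Measure.compProd_apply_prod .univ (Config.measurableSet_strip j), Measure.restrict_univ]
    simp only [Config.kernel_apply]
    rw [hQ.lintegral_count (Config.measurableSet_strip j) (hQ.finite_strip j)]
    exact hQ.finite_strip j
  · rintro _ ⟨j, rfl⟩ _ ⟨C, hC, A, hA, rfl⟩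
    rw [Set.prod_inter_prod]
    exact key _ _ (MeasurableSet.inter hC .univ)
      (MeasurableSet.inter hA (Config.measurableSet_strip j))
      (measure_ne_top_of_subset Set.inter_subset_right (hQ.finite_strip j))
  · rintro _ ⟨j, rfl⟩
    exact key _ _ .univ (Config.measurableSet_strip j) (hQ.finite_strip j)

/-- **Mecke's formula**. -/
theorem mecke (hQ : IsPoissonLaw Q μ) [SFinite μ] {g : Config × (ℝ × ℝ) → ℝ≥0∞}
    (hg : Measurable g) :
    ∫⁻ M, ∫⁻ z, g (M, z) ∂M.1 ∂Q = ∫⁻ z, ∫⁻ M, g (M.add z, z) ∂Q ∂μ := by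
  have := hQ.prob
  have hmap : Measurable (fun p : (ℝ × ℝ) × Config => (p.2.add p.1, p.1)) :=
    (Config.measurable_add_atom.comp measurable_swap).prodMk measurable_fst
  have h1 : ∫⁻ p, g p ∂(Q ⊗ₘ Config.kernel) = ∫⁻ M, ∫⁻ z, g (M, z) ∂M.1 ∂Q :=
    Measure.lintegral_compProd hg
  rw [← h1, hQ.compProd_kernel, lintegral_map hg hmap]
  exact lintegral_prod _ (hg.comp hmap).aemeasurable

theorem mecke_set (hQ : IsPoissonLaw Q μ) [SFinite μ] {D : Set (Config × (ℝ × ℝ))}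
    (hD : MeasurableSet D) :
    ∫⁻ M, M.1 {z | (M, z) ∈ D} ∂Q = ∫⁻ z, Q {M | (M.add z, z) ∈ D} ∂μ := by
  have h1 := hQ.mecke (g := D.indicator 1) (measurable_one.indicator hD)
  have h2 : ∀ M : Config, ∫⁻ z, D.indicator 1 (M, z) ∂M.1 = M.1 {z | (M, z) ∈ D} := fun M =>
    lintegral_indicator_one (s := {z | (M, z) ∈ D}) (measurable_prodMk_left hD)
  have h3 : ∀ z, ∫⁻ M, D.indicator 1 (M.add z, z) ∂Q = Q {M | (M.add z, z) ∈ D} := fun z =>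
    lintegral_indicator_one (s := {M : Config | (M.add z, z) ∈ D})
      (((Config.measurable_add_atom.comp (measurable_id.prodMk measurable_const)).prodMk
        measurable_const) hD)
  simpa only [h2, h3] using h1

end IsPoissonLaw

/-! ### Successive elements of a locally finite set of times -/

section Successive

variable {U : Set ℝ}

theorem isLeast_sInf_of_finite (hf : ∀ R, (U ∩ Set.Iic R).Finite) {S : Set ℝ} (hS : S ⊆ U)
    (hne : S.Nonempty) : IsLeast S (sInf S) := by
  obtain ⟨x, hx⟩ := hne
  obtain ⟨m, ⟨hmS, hmx⟩, hm⟩ := ((hf x).subset (Set.inter_subset_inter_left _ hS)).exists_minimal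
    (⟨x, hx, le_refl x⟩ : (S ∩ Set.Iic x).Nonempty)
  have h : IsLeast S m := by
    refine ⟨hmS, fun y hy => ?_⟩
    rcases le_total y x with h | h
    · rcases le_total m y with h' | h'
      · exact h'
      · exact hm ⟨hy, h⟩ h'
    · exact le_trans hmx h
  rw [h.csInf_eq]
  exact h

variable (hf : ∀ R, (U ∩ Set.Iic R).Finite) (hU : U.Infinite)
include hf hU

theorem exists_gt_of_infinite (R : ℝ) : {t | t ∈ U ∧ R < t}.Nonempty := by
  by_contra h
  refine hU ((hf R).subset fun t ht => ⟨ht, ?_⟩)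
  by_contra h'
  exact h ⟨t, ht, not_le.1 h'⟩

theorem isLeast_successive_zero : IsLeast U (successive U 0) :=
  isLeast_sInf_of_finite hf le_rfl hU.nonempty

theorem isLeast_successive_succ (n : ℕ) :
    IsLeast {t | t ∈ U ∧ successive U n < t} (successive U (n + 1)) :=
  isLeast_sInf_of_finite hf (fun _ h => h.1) (exists_gt_of_infinite hf hU _)

theorem successive_mem : ∀ n, successive U n ∈ U
  | 0 => (isLeast_successive_zero hf hU).1
  | n + 1 => (isLeast_successive_succ hf hU n).1.1

theorem strictMono_successive : StrictMono (successive U) :=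
  strictMono_nat_of_lt_succ fun n => (isLeast_successive_succ hf hU n).1.2

theorem range_successive : Set.range (successive U) = U := by
  refine Set.Subset.antisymm (Set.range_subset_iff.2 (successive_mem hf hU)) fun x hx => ?_
  by_contra h
  have hlt : ∀ n, successive U n < x := by
    intro n
    induction n with
    | zero =>
      exact lt_of_le_of_ne ((isLeast_successive_zero hf hU).2 hx) fun h' => h ⟨0, h'⟩
    | succ n ih =>
      exact lt_of_le_of_ne ((isLeast_successive_succ hf hU n).2 ⟨hx, ih⟩) fun h' => h ⟨n + 1, h'⟩
  refine Set.infinite_range_of_injective (strictMono_successive hf hU).injective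
    ((hf x).subset ?_)
  rintro _ ⟨n, rfl⟩
  exact ⟨successive_mem hf hU n, (hlt n).le⟩

theorem encard_inter_Iio_successive (n : ℕ) : (U ∩ Set.Iio (successive U n)).encard = n := by
  have : U ∩ Set.Iio (successive U n) = successive U '' Set.Iio n := by
    ext t
    constructor
    · rintro ⟨ht, htn⟩
      rw [← range_successive hf hU] at ht
      obtain ⟨m, rfl⟩ := ht
      exact ⟨m, (strictMono_successive hf hU).lt_iff_lt.1 htn, rfl⟩
    · rintro ⟨m, hm, rfl⟩
      exact ⟨successive_mem hf hU m, strictMono_successive hf hU hm⟩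
  rw [this, (strictMono_successive hf hU).injective.encard_image]
  rw [← Set.coe_fintypeCard]
  simp

/-- The rank of an element is the number of its predecessors. Being the `n`-th epoch thus becomes a
condition on what lies strictly before it. -/
theorem eq_successive_of_encard {t : ℝ} (ht : t ∈ U) {n : ℕ}
    (h : (U ∩ Set.Iio t).encard = n) : t = successive U n := by
  rw [← range_successive hf hU] at ht
  obtain ⟨m, rfl⟩ := ht
  rw [encard_inter_Iio_successive hf hU] at h
  rw [Nat.cast_inj.1 h]

/-- Translates a statement about an epoch into one about counts, for which measurability is
available. -/
theorem le_encard_inter_Iic_iff (n : ℕ) (t : ℝ) :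
    ((n + 1 : ℕ) : ℕ∞) ≤ (U ∩ Set.Iic t).encard ↔ successive U n ≤ t := by
  constructor
  · intro h
    by_contra! h'
    have := h.trans (Set.encard_le_encard (t := U ∩ Set.Iio (successive U n))
      fun s hs => ⟨hs.1, lt_of_le_of_lt hs.2 h'⟩)
    rw [encard_inter_Iio_successive hf hU, Nat.cast_le] at this
    omega
  · intro h
    rw [← encard_inter_Iio_successive hf hU (n + 1)]
    refine Set.encard_le_encard fun s hs => ⟨hs.1, ?_⟩
    by_contra h''
    have h' : t < s := not_le.1 h''
    exact absurd ((isLeast_successive_succ hf hU n).2 ⟨hs.1, lt_of_le_of_lt h h'⟩)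
      (not_le.2 hs.2)

end Successive

/-! ### Atoms of a configuration -/

namespace Config

/-- The atoms of a configuration. -/
def atoms (M : Config) : Set (ℝ × ℝ) := {z | M.1 {z} ≠ 0}

theorem exists_rep (M : Config) : ∃ (ι : Type) (x : ι → ℝ × ℝ), (∀ A, MeasurableSet A →
    M.1 A = ({i | x i ∈ A}.encard : ℝ≥0∞)) ∧ M.atoms = Set.range x ∧
      ∀ R : ℝ, {i | |(x i).1| ≤ R}.Finite := by
  obtain ⟨ι, x, hM, hfin⟩ := M.2
  have h : ∀ A, MeasurableSet A → M.1 A = ({i | x i ∈ A}.encard : ℝ≥0∞) := fun A hA => by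
    rw [hM, IsConfig.apply_eq hA]
  refine ⟨ι, x, h, ?_, hfin⟩
  ext z
  rw [atoms, Set.mem_ofPred_eq, h _ (measurableSet_singleton z)]
  simp [Set.ext_iff]

theorem measure_eq_zero_iff (M : Config) {A : Set (ℝ × ℝ)} (hA : MeasurableSet A) :
    M.1 A = 0 ↔ ∀ z ∈ M.atoms, z ∉ A := by
  obtain ⟨ι, x, h, hx, -⟩ := M.exists_rep
  rw [h A hA, hx]
  simp [Set.ext_iff]

theorem finite_atoms (M : Config) (R : ℝ) : (M.atoms ∩ {z | |z.1| ≤ R}).Finite := by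
  obtain ⟨ι, x, h, hx, hfin⟩ := M.exists_rep
  refine ((hfin R).image x).subset ?_
  rintro z ⟨hz, hR⟩
  rw [hx] at hz
  obtain ⟨i, rfl⟩ := hz
  exact ⟨i, hR, rfl⟩

theorem atoms_add (M : Config) (z : ℝ × ℝ) : (M.add z).atoms = insert z M.atoms := by
  ext w
  simp only [atoms, add_val, Measure.add_apply, Set.mem_insert_iff, Set.mem_ofPred_eq,
    Measure.dirac_apply' _ (measurableSet_singleton w)]
  by_cases h : w = z
  · subst h; simp
  · have h' : z ≠ w := fun h' => h h'.symm
    simp [h, h']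

theorem atoms_res {A : Set (ℝ × ℝ)} (hA : MeasurableSet A) (M : Config) :
    (res A M).atoms = M.atoms ∩ A := by
  ext w
  simp only [atoms, Set.mem_inter_iff, Set.mem_ofPred_eq, res_apply hA M (measurableSet_singleton w)]
  by_cases h : w ∈ A
  · simp [h]
  · simp [h]

theorem eq_of_measure_eq {M N : Config} (h : ∀ A, MeasurableSet A → M.1 A = N.1 A) : M = N := by
  cases M
  cases N
  congr
  ext A hA
  exact h A hA

/-- A configuration is simple if no two atoms have the same time. -/
def Simple (M : Config) : Prop := ∀ a, M.1 {z | z.1 = a} ≤ 1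

theorem measurableSet_time (a : ℝ) : MeasurableSet {z : ℝ × ℝ | z.1 = a} :=
  measurable_fst (measurableSet_singleton a)

/-- Distinct indices of a simple configuration have distinct times, so there are no multiplicities
and counting atoms is counting times. -/
theorem Simple.measure_eq {M : Config} (hM : M.Simple) {A : Set (ℝ × ℝ)} (hA : MeasurableSet A) :
    M.1 A = ((Prod.fst '' (M.atoms ∩ A)).encard : ℝ≥0∞) := by
  obtain ⟨ι, x, h, hx, -⟩ := M.exists_rep
  have hinj : Function.Injective (fun i => (x i).1) := by
    intro i j hij
    have h1 := hM (x i).1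
    rw [h _ (measurableSet_time _), ← ENat.toENNReal_one, ENat.toENNReal_le,
      Set.encard_le_one_iff] at h1
    exact h1 i j rfl hij.symm
  rw [h A hA, hx]
  congr 1
  have : Prod.fst '' (Set.range x ∩ A) = (fun i => (x i).1) '' {i | x i ∈ A} := by
    ext a
    simp only [Set.mem_image, Set.mem_inter_iff, Set.mem_range, Set.mem_ofPred_eq]
    constructor
    · rintro ⟨_, ⟨⟨i, rfl⟩, hi⟩, rfl⟩
      exact ⟨i, hi, rfl⟩
    · rintro ⟨i, hi, rfl⟩
      exact ⟨x i, ⟨⟨i, rfl⟩, hi⟩, rfl⟩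
  rw [this, hinj.encard_image]

theorem simple_res {M : Config} (hM : M.Simple) {A : Set (ℝ × ℝ)} (hA : MeasurableSet A) :
    (res A M).Simple := fun a => by
  rw [res_apply hA M (measurableSet_time a)]
  exact (measure_mono Set.inter_subset_left).trans (hM a)

/-! ### Up-crossings of a configuration -/

/-- An atom `z` occupies the times from `z.1` to `z.1 + z.2`. A time `a` is vacant if no atom that
started before `a` still occupies it. -/
def Vacant (M : Config) (a : ℝ) : Prop := M.1 {z | z.1 < a ∧ a ≤ z.1 + z.2} = 0

/-- The number of atoms in a set of times that start at a vacant time. -/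
def upCount (M : Config) (S : Set ℝ) : ℝ≥0∞ := M.1 {z | z.1 ∈ S ∧ M.Vacant z.1}

/-- The positive vacant times at which an atom starts. -/
def upTimes (M : Config) : Set ℝ := {a | 0 < a ∧ (∃ z ∈ M.atoms, z.1 = a) ∧ M.Vacant a}

theorem vacant_iff {M : Config} {a : ℝ} :
    M.Vacant a ↔ ∀ z ∈ M.atoms, z.1 < a → z.1 + z.2 < a := by
  have : MeasurableSet {z : ℝ × ℝ | z.1 < a ∧ a ≤ z.1 + z.2} :=
    (measurableSet_lt measurable_fst measurable_const).inter
      (measurableSet_le measurable_const (measurable_fst.add measurable_snd))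
  rw [Vacant, M.measure_eq_zero_iff this]
  simp

theorem measurableSet_vacant : MeasurableSet {p : ℝ × Config | p.2.Vacant p.1} := by
  refine measurable_measure_section (f := fun p : ℝ × Config => p.2) measurable_snd
    (S := {q : (ℝ × Config) × (ℝ × ℝ) | q.2.1 < q.1.1 ∧ q.1.1 ≤ q.2.1 + q.2.2}) ?_ (measurableSet_singleton 0)
  exact (measurableSet_lt measurable_snd.fst measurable_fst.fst).inter
    (measurableSet_le measurable_fst.fst (measurable_snd.fst.add measurable_snd.snd))

theorem measurableSet_vacant_atom (M : Config) : MeasurableSet {z : ℝ × ℝ | M.Vacant z.1} :=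
  measurableSet_vacant.preimage (f := fun z : ℝ × ℝ => (z.1, M)) (by fun_prop)

theorem measurableSet_upSet (M : Config) {S : Set ℝ} (hS : MeasurableSet S) :
    MeasurableSet {z : ℝ × ℝ | z.1 ∈ S ∧ M.Vacant z.1} :=
  (measurable_fst hS).inter M.measurableSet_vacant_atom

theorem measurable_upCount {α : Type*} [MeasurableSpace α] {f : α → Config} (hf : Measurable f)
    {S : Set (α × ℝ)} (hS : MeasurableSet S) :
    Measurable fun a => (f a).upCount {s | (a, s) ∈ S} := by
  refine measurable_measure_section hf
    (S := {q : α × (ℝ × ℝ) | (q.1, q.2.1) ∈ S ∧ (f q.1).Vacant q.2.1}) ?_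
  exact (hS.preimage (f := fun q : α × (ℝ × ℝ) => (q.1, q.2.1)) (by fun_prop)).inter
    (measurableSet_vacant.preimage (f := fun q : α × (ℝ × ℝ) => (q.2.1, f q.1))
      ((by fun_prop : Measurable fun q : α × (ℝ × ℝ) => q.2.1).prodMk (hf.comp measurable_fst)))

theorem measurable_upCount_Ioc {α : Type*} [MeasurableSpace α] {f : α → Config}
    (hf : Measurable f) {s t : α → ℝ} (hs : Measurable s) (ht : Measurable t) :
    Measurable fun a => (f a).upCount (Set.Ioc (s a) (t a)) :=
  measurable_upCount hf (S := {p | s p.1 < p.2 ∧ p.2 ≤ t p.1})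
    ((measurableSet_lt (hs.comp measurable_fst) measurable_snd).inter
      (measurableSet_le measurable_snd (ht.comp measurable_fst)))

theorem upCount_eq_zero_iff {M : Config} {S : Set ℝ} (hS : MeasurableSet S) :
    M.upCount S = 0 ↔ ∀ z ∈ M.atoms, z.1 ∈ S → ¬ M.Vacant z.1 := by
  rw [upCount, M.measure_eq_zero_iff (M.measurableSet_upSet hS)]
  simp only [Set.mem_ofPred_eq, not_and]

theorem Simple.upCount_eq {M : Config} (hM : M.Simple) {S : Set ℝ} (hS : MeasurableSet S)
    (hpos : S ⊆ Set.Ioi 0) : M.upCount S = ((M.upTimes ∩ S).encard : ℝ≥0∞) := by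
  rw [upCount, hM.measure_eq (M.measurableSet_upSet hS)]
  congr 2
  ext a
  constructor
  · rintro ⟨z, ⟨hz, hS, hv⟩, rfl⟩
    exact ⟨⟨hpos hS, ⟨z, hz, rfl⟩, hv⟩, hS⟩
  · rintro ⟨⟨-, ⟨z, hz, rfl⟩, hv⟩, hS⟩
    exact ⟨z, ⟨hz, hS, hv⟩, rfl⟩

theorem finite_upTimes (M : Config) (R : ℝ) : (M.upTimes ∩ Set.Iic R).Finite := by
  refine ((M.finite_atoms R).image Prod.fst).subset ?_
  rintro a ⟨⟨h0, ⟨z, hz, rfl⟩, -⟩, hR⟩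
  exact ⟨z, ⟨hz, by rw [Set.mem_ofPred_eq, abs_of_pos h0]; exact hR⟩, rfl⟩

/-! ### Past and future of a configuration, and translation in time -/

/-- The atoms before time `a`. -/
def past (a : ℝ) (M : Config) : Config := res {z | z.1 < a} M

/-- The atoms after time `a`. -/
def future (a : ℝ) (M : Config) : Config := res {z | a < z.1} M

theorem measurableSet_before (a : ℝ) : MeasurableSet {z : ℝ × ℝ | z.1 < a} :=
  measurableSet_lt measurable_fst measurable_const

theorem measurableSet_after (a : ℝ) : MeasurableSet {z : ℝ × ℝ | a < z.1} :=
  measurableSet_lt measurable_const measurable_fst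

theorem measurable_past : Measurable fun p : ℝ × Config => past p.1 p.2 :=
  measurable_res_section (S := {q : (ℝ × Config) × (ℝ × ℝ) | q.2.1 < q.1.1}) measurable_snd
    (measurableSet_lt (by fun_prop) (by fun_prop))

theorem measurable_future : Measurable fun p : ℝ × Config => future p.1 p.2 :=
  measurable_res_section (S := {q : (ℝ × Config) × (ℝ × ℝ) | q.1.1 < q.2.1}) measurable_snd
    (measurableSet_lt (by fun_prop) (by fun_prop))

theorem atoms_past (a : ℝ) (M : Config) : (past a M).atoms = M.atoms ∩ {z | z.1 < a} :=
  atoms_res (measurableSet_before a) M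

theorem atoms_future (a : ℝ) (M : Config) : (future a M).atoms = M.atoms ∩ {z | a < z.1} :=
  atoms_res (measurableSet_after a) M

theorem res_add_of_notMem {A : Set (ℝ × ℝ)} (hA : MeasurableSet A) (M : Config) {z : ℝ × ℝ}
    (hz : z ∉ A) : res A (M.add z) = res A M := by
  refine eq_of_measure_eq fun B hB => ?_
  rw [res_apply hA _ hB, res_apply hA _ hB, add_val, Measure.add_apply,
    Measure.dirac_apply' _ (hB.inter hA)]
  simp [hz]

theorem past_add (M : Config) (z : ℝ × ℝ) : past z.1 (M.add z) = past z.1 M :=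
  res_add_of_notMem (measurableSet_before _) M (by simp)

theorem future_add (M : Config) (z : ℝ × ℝ) : future z.1 (M.add z) = future z.1 M :=
  res_add_of_notMem (measurableSet_after _) M (by simp)

theorem vacant_past_iff {M : Config} {a b : ℝ} (h : a ≤ b) :
    (past b M).Vacant a ↔ M.Vacant a := by
  rw [vacant_iff, vacant_iff, atoms_past]
  exact ⟨fun H z hz hza => H z ⟨hz, hza.trans_le h⟩ hza, fun H z hz hza => H z hz.1 hza⟩

theorem upTimes_past (M : Config) (b : ℝ) : (past b M).upTimes = M.upTimes ∩ Set.Iio b := by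
  ext a
  simp only [upTimes, atoms_past, Set.mem_inter_iff, Set.mem_ofPred_eq, Set.mem_Iio]
  constructor
  · rintro ⟨h0, ⟨z, ⟨hz, hzb⟩, rfl⟩, hv⟩
    exact ⟨⟨h0, ⟨z, hz, rfl⟩, (vacant_past_iff hzb.le).1 hv⟩, hzb⟩
  · rintro ⟨⟨h0, ⟨z, hz, rfl⟩, hv⟩, hzb⟩
    exact ⟨h0, ⟨z, ⟨hz, hzb⟩, rfl⟩, (vacant_past_iff hzb.le).2 hv⟩

/-- After an atom that starts at a vacant time, the earlier atoms do not matter. -/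
theorem upCount_future_add {M : Config} {z : ℝ × ℝ} (hz : z ∈ M.atoms) (hv : M.Vacant z.1)
    (hs : M.Simple) (t : ℝ) : ((future z.1 M).add z).upCount (Set.Ioc z.1 t) = 0 ↔
      M.upCount (Set.Ioc z.1 t) = 0 := by
  have hatoms : ((future z.1 M).add z).atoms = M.atoms ∩ {w | z.1 ≤ w.1} := by
    rw [atoms_add, atoms_future]
    ext w
    simp only [Set.mem_insert_iff, Set.mem_inter_iff, Set.mem_ofPred_eq]
    constructor
    · rintro (rfl | h)
      · exact ⟨hz, le_rfl⟩
      · exact ⟨h.1, h.2.le⟩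
    · rintro ⟨hw, h⟩
      -- An atom at the same time as `z` is `z` itself, by simplicity.
      rcases h.eq_or_lt with h | h
      · left
        obtain ⟨ι, x, hx, hr, -⟩ := M.exists_rep
        have h1 := hs z.1
        rw [hx _ (measurableSet_time _), ← ENat.toENNReal_one, ENat.toENNReal_le,
          Set.encard_le_one_iff] at h1
        rw [hr] at hz hw
        obtain ⟨i, rfl⟩ := hz
        obtain ⟨j, rfl⟩ := hw
        rw [h1 i j rfl h.symm]
      · exact Or.inr ⟨hw, h⟩
  have hvac : ∀ a, z.1 < a → (((future z.1 M).add z).Vacant a ↔ M.Vacant a) := by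
    intro a ha
    rw [vacant_iff, vacant_iff, hatoms]
    refine ⟨fun H w hw hwa => ?_, fun H w hw hwa => H w hw.1 hwa⟩
    -- An atom before `z` has ended before `z.1`, by vacancy, and cannot occupy a later time.
    rcases lt_or_ge w.1 z.1 with h | h
    · exact ((vacant_iff.1 hv) w hw h).trans ha
    · exact H w ⟨hw, h⟩ hwa
  rw [upCount_eq_zero_iff measurableSet_Ioc, upCount_eq_zero_iff measurableSet_Ioc, hatoms]
  exact ⟨fun H w hw hwS => (hvac _ hwS.1).not.1 (H w ⟨hw, hwS.1.le⟩ hwS),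
    fun H w hw hwS => (hvac _ hwS.1).not.2 (H w hw.1 hwS)⟩

theorem vacant_shift {M : Config} {s a : ℝ} : (shift s M).Vacant a ↔ M.Vacant (a + s) := by
  have : MeasurableSet {z : ℝ × ℝ | z.1 < a ∧ a ≤ z.1 + z.2} :=
    (measurableSet_lt measurable_fst measurable_const).inter
      (measurableSet_le measurable_const (measurable_fst.add measurable_snd))
  rw [Vacant, Vacant, shift_apply s M this]
  simp only [Set.mem_ofPred_eq]
  have h1 : ∀ z : ℝ × ℝ, z.1 - s < a ↔ z.1 < a + s := fun z => sub_lt_iff_lt_add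
  have h2 : ∀ z : ℝ × ℝ, a ≤ z.1 - s + z.2 ↔ a + s ≤ z.1 + z.2 := fun z => by
    constructor <;> intro <;> linarith
  simp only [h1, h2]

theorem upCount_shift {M : Config} {s a b : ℝ} :
    (shift s M).upCount (Set.Ioc a b) = M.upCount (Set.Ioc (a + s) (b + s)) := by
  rw [upCount, shift_apply s M (measurableSet_upSet _ measurableSet_Ioc), upCount]
  congr 1
  ext z
  simp only [Set.mem_ofPred_eq, vacant_shift, sub_add_cancel,
    Set.mem_Ioc, lt_sub_iff_add_lt, sub_le_iff_le_add]

theorem shift_future_add (M : Config) (a l : ℝ) :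
    shift a ((future a M).add (a, l)) = (future 0 (shift a M)).add (0, l) := by
  refine eq_of_measure_eq fun B hB => ?_
  have hm : MeasurableSet {z : ℝ × ℝ | (z.1 - a, z.2) ∈ B} :=
    (by fun_prop : Measurable fun z : ℝ × ℝ => (z.1 - a, z.2)) hB
  rw [shift_apply _ _ hB, add_val, add_val, Measure.add_apply, Measure.add_apply, future, future,
    res_apply (measurableSet_after a) _ hm, res_apply (measurableSet_after 0) _ hB,
    shift_apply _ _ (hB.inter (measurableSet_after 0)), Measure.dirac_apply' _ hm,
    Measure.dirac_apply' _ hB]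
  congr 1
  · congr 1
    ext z
    simp [sub_pos]
  · have : ((a, l) : ℝ × ℝ) ∈ {z : ℝ × ℝ | (z.1 - a, z.2) ∈ B} ↔ ((0, l) : ℝ × ℝ) ∈ B := by simp
    by_cases h : ((0, l) : ℝ × ℝ) ∈ B
    · rw [Set.indicator_of_mem h, Set.indicator_of_mem (this.2 h)]; rfl
    · rw [Set.indicator_of_notMem h, Set.indicator_of_notMem (fun h' => h (this.1 h'))]

end Config

/-! ### Stationary marked Poisson processes -/

/-- Arrivals at rate `f` with independent marks of law `G`. -/
def intensity (f : ℝ) (G : Measure ℝ) : Measure (ℝ × ℝ) :=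
  ENNReal.ofReal f • (volume : Measure ℝ).prod G

section Intensity

variable {f : ℝ} {G : Measure ℝ}

instance [SFinite G] : SFinite (intensity f G) := by unfold intensity; infer_instance

theorem lintegral_intensity [SFinite G] {g : ℝ × ℝ → ℝ≥0∞} (hg : Measurable g) :
    ∫⁻ z, g z ∂(intensity f G) = ENNReal.ofReal f * ∫⁻ a, ∫⁻ l, g (a, l) ∂G := by
  rw [intensity, lintegral_smul_measure, lintegral_prod _ hg.aemeasurable, smul_eq_mul]

theorem intensity_preimage_fst [IsProbabilityMeasure G] (S : Set ℝ) :
    intensity f G (Prod.fst ⁻¹' S) = ENNReal.ofReal f * volume S := by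
  rw [intensity, Measure.smul_apply, ← Set.prod_univ, Measure.prod_prod, measure_univ, mul_one,
    smul_eq_mul]

theorem intensity_shift [SFinite G] (s : ℝ) {B : Set (ℝ × ℝ)} (hB : MeasurableSet B) :
    intensity f G {z | (z.1 - s, z.2) ∈ B} = intensity f G B := by
  have h : MeasurePreserving (fun z : ℝ × ℝ => (z.1 - s, z.2)) (volume.prod G) (volume.prod G) :=
    (measurePreserving_sub_right volume s).prod (MeasurePreserving.id G)
  rw [intensity, Measure.smul_apply, Measure.smul_apply]
  congr 1
  exact h.measure_preimage hB.nullMeasurableSet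

end Intensity

/-! ### Palm calculus and almost sure properties -/

open Config

/-- The probability that no atom starts at a vacant time in `(0, t]`, when an atom with a mark of
law `G` is put at time `0` and the atoms before time `0` are deleted. -/
def tail (Q : Measure Config) (G : Measure ℝ) (t : ℝ) : ℝ≥0∞ :=
  ∫⁻ l, Q {M | ((future 0 M).add (0, l)).upCount (Set.Ioc 0 t) = 0} ∂G

theorem poissonCount_singleton_zero (r : ℝ≥0∞) :
    poissonCount r {0} = ENNReal.ofReal (Real.exp (-r.toReal)) := by
  rw [poissonCount, Measure.map_apply Measurable.of_discrete (measurableSet_singleton _)]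
  have : (fun n : ℕ => (n : ℝ≥0∞)) ⁻¹' {0} = {0} := by ext n; simp
  rw [this, poissonMeasure_singleton]
  simp [ENNReal.toReal]

theorem measurable_tail_mark_pair (Q : Measure Config) [SFinite Q] {τ : ℝ → ℝ} (hτ : Measurable τ) :
    Measurable fun z : ℝ × ℝ =>
      Q {M | ((future 0 M).add (0, z.2)).upCount (Set.Ioc 0 (τ z.1)) = 0} := by
  have h : MeasurableSet {p : (ℝ × ℝ) × Config |
      ((future 0 p.2).add (0, p.1.2)).upCount (Set.Ioc 0 (τ p.1.1)) = 0} :=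
    measurable_upCount_Ioc (measurable_add_atom.comp ((measurable_future.comp
      (measurable_const.prodMk measurable_snd)).prodMk (measurable_const.prodMk
      measurable_fst.snd))) measurable_const (hτ.comp measurable_fst.fst)
      (measurableSet_singleton 0)
  exact measurable_measure_prodMk_left h

theorem measurable_tail_mark (Q : Measure Config) [SFinite Q] (t : ℝ) : Measurable fun l : ℝ =>
    Q {M | ((future 0 M).add (0, l)).upCount (Set.Ioc 0 t) = 0} := by
  have h : MeasurableSet {p : ℝ × Config |
      ((future 0 p.2).add (0, p.1)).upCount (Set.Ioc 0 t) = 0} :=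
    measurable_upCount_Ioc (measurable_add_atom.comp ((measurable_future.comp
      (measurable_const.prodMk measurable_snd)).prodMk (measurable_const.prodMk
      measurable_fst))) measurable_const measurable_const (measurableSet_singleton 0)
  exact measurable_measure_prodMk_left h

namespace IsPoissonLaw

variable {Q : Measure Config} {μ : Measure (ℝ × ℝ)} {f : ℝ} {G : Measure ℝ}

theorem measure_void (hQ : IsPoissonLaw Q μ) {A : Set (ℝ × ℝ)} (hA : MeasurableSet A)
    (hf : μ A ≠ ∞) : Q {M | M.1 A = 0} = ENNReal.ofReal (Real.exp (-(μ A).toReal)) := by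
  rw [← poissonCount_singleton_zero, ← hQ.law A hA hf,
    Measure.map_apply (measurable_coe hA) (measurableSet_singleton _)]
  rfl

theorem ae_eq_zero (hQ : IsPoissonLaw Q μ) {A : Set (ℝ × ℝ)} (hA : MeasurableSet A)
    (h0 : μ A = 0) : ∀ᵐ M ∂Q, M.1 A = 0 := by
  have := hQ.lintegral_count hA (by simp [h0])
  rw [h0, lintegral_eq_zero_iff (measurable_coe hA)] at this
  exact this

variable [IsProbabilityMeasure G]

/-- Translation preserves the intensity and the defining properties of a Poisson law, and the
intensity determines the law. -/
theorem map_shift (hQ : IsPoissonLaw Q (intensity f G)) (s : ℝ) : Q.map (shift s) = Q := by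
  have := hQ.prob
  have hm : ∀ {A : Set (ℝ × ℝ)}, MeasurableSet A →
      MeasurableSet {z : ℝ × ℝ | (z.1 - s, z.2) ∈ A} :=
    fun hA => (by fun_prop : Measurable fun z : ℝ × ℝ => (z.1 - s, z.2)) hA
  refine IsPoissonLaw.unique (μ := intensity f G) ⟨?_, hQ.finite_strip, ?_, ?_⟩ hQ
  · exact Measure.isProbabilityMeasure_map (measurable_shift s).aemeasurable
  · intro A hA hAf
    rw [Measure.map_map (measurable_coe hA) (measurable_shift s), ← intensity_shift s hA,
      ← hQ.law _ (hm hA) (by rwa [intensity_shift s hA])]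
    congr 1
    ext M
    exact shift_apply s M hA
  · intro A hA hd
    have h := hQ.indep (fun i => {z | (z.1 - s, z.2) ∈ A i}) (fun i => hm (hA i))
      (fun i j hij => (hd hij).preimage (fun z : ℝ × ℝ => (z.1 - s, z.2)))
    rw [iIndepFun_iff_measure_inter_preimage_eq_mul] at h ⊢
    intro S B hB
    have hpre : ∀ i, MeasurableSet (B i) →
        (shift s) ⁻¹' ((fun M : Config => M.1 (A i)) ⁻¹' B i) =
          (fun M : Config => M.1 {z | (z.1 - s, z.2) ∈ A i}) ⁻¹' B i := fun i _ => by
      ext M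
      simp only [Set.mem_preimage, shift_apply s M (hA i)]
    have hmeas : ∀ i ∈ S, MeasurableSet ((fun M : Config => M.1 (A i)) ⁻¹' B i) :=
      fun i hi => measurable_coe (hA i) (hB i hi)
    rw [Measure.map_apply (measurable_shift s) (S.measurableSet_biInter hmeas),
      Set.preimage_iInter₂]
    rw [Set.iInter₂_congr fun i hi => hpre i (hB i hi), h S hB]
    refine Finset.prod_congr rfl fun i hi => ?_
    rw [Measure.map_apply (measurable_shift s) (hmeas i hi), hpre i (hB i hi)]

/-- Strict past and strict future of the fixed time `z.1` are independent; stationarity then moves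
the second factor to the origin, where only the mark `z.2` is left. -/
theorem measure_past_future (hQ : IsPoissonLaw Q (intensity f G)) {A : Set Config}
    (hA : MeasurableSet A) (z : ℝ × ℝ) (t : ℝ) :
    Q {M | past z.1 M ∈ A ∧ ((future z.1 M).add z).upCount (Set.Ioc z.1 (z.1 + t)) = 0} =
      Q {M | past z.1 M ∈ A} *
        Q {M | ((future 0 M).add (0, z.2)).upCount (Set.Ioc 0 t) = 0} := by
  have haddz : Measurable fun M : Config => M.add z :=
    measurable_add_atom.comp (measurable_id.prodMk measurable_const)
  have h6 : IndepFun (past z.1) (future z.1) Q :=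
    hQ.indepFun_res (measurableSet_before _) (measurableSet_after _) (by
      rw [Set.disjoint_left]
      exact fun w (h : w.1 < z.1) (h' : z.1 < w.1) => lt_asymm h h')
  have h7 : MeasurableSet {M : Config | (M.add z).upCount (Set.Ioc z.1 (z.1 + t)) = 0} :=
    measurable_upCount_Ioc haddz measurable_const measurable_const (measurableSet_singleton 0)
  refine (h6.measure_inter_preimage_eq_mul _ _ hA h7).trans ?_
  congr 1
  have hf0 : Measurable fun M : Config => (future 0 M).add (0, z.2) :=
    measurable_add_atom.comp ((measurable_future.comp
      (measurable_const.prodMk measurable_id)).prodMk measurable_const)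
  have h8 : MeasurableSet {M : Config | ((future 0 M).add (0, z.2)).upCount (Set.Ioc 0 t) = 0} :=
    measurable_upCount_Ioc hf0 measurable_const measurable_const (measurableSet_singleton 0)
  conv_rhs => rw [← hQ.map_shift z.1, Measure.map_apply (measurable_shift _) h8]
  congr 1
  ext M
  simp only [Set.mem_preimage, Set.mem_ofPred_eq]
  rw [← shift_future_add, upCount_shift, zero_add, add_comm t]

/-- Palm calculus for functionals that split into a past and a future. -/
theorem lintegral_palm (hQ : IsPoissonLaw Q (intensity f G)) {H : Set (ℝ × Config)}
    (hH : MeasurableSet H) {τ : ℝ → ℝ} (hτ : Measurable τ) :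
    ∫⁻ M, M.1 {z | (z.1, past z.1 M) ∈ H ∧
        ((future z.1 M).add z).upCount (Set.Ioc z.1 (z.1 + τ z.1)) = 0} ∂Q =
      ENNReal.ofReal f * ∫⁻ a, Q {M | (a, past a M) ∈ H} * tail Q G (τ a) := by
  have := hQ.prob
  have hfa : Measurable fun p : Config × (ℝ × ℝ) => (future p.2.1 p.1).add p.2 :=
    measurable_add_atom.comp ((measurable_future.comp
      (measurable_snd.fst.prodMk measurable_fst)).prodMk measurable_snd)
  have hpa : Measurable fun p : Config × (ℝ × ℝ) => (p.2.1, past p.2.1 p.1) :=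
    measurable_snd.fst.prodMk (measurable_past.comp (measurable_snd.fst.prodMk measurable_fst))
  have hU : MeasurableSet {p : Config × (ℝ × ℝ) |
      ((future p.2.1 p.1).add p.2).upCount (Set.Ioc p.2.1 (p.2.1 + τ p.2.1)) = 0} :=
    measurable_upCount_Ioc hfa measurable_snd.fst
      (measurable_snd.fst.add (hτ.comp measurable_snd.fst)) (measurableSet_singleton 0)
  have h1 := hQ.mecke_set ((hpa hH).inter hU)
  have h3 : ∀ z : ℝ × ℝ, Q {M : Config | (M.add z, z) ∈
        ((fun p : Config × (ℝ × ℝ) => (p.2.1, past p.2.1 p.1)) ⁻¹' H ∩ {p : Config × (ℝ × ℝ) |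
          ((future p.2.1 p.1).add p.2).upCount (Set.Ioc p.2.1 (p.2.1 + τ p.2.1)) = 0})} =
      Q {M | (z.1, past z.1 M) ∈ H} *
        Q {M | ((future 0 M).add (0, z.2)).upCount (Set.Ioc 0 (τ z.1)) = 0} := by
    intro z
    refine Eq.trans ?_ (hQ.measure_past_future (A := {M | (z.1, M) ∈ H})
      (measurable_prodMk_left hH) z (τ z.1))
    congr 1
    ext M
    -- The atom added by the Mecke formula sits exactly at `z.1`, outside both strict halves, so
    -- `past` and `future` do not see it.
    simp only [Set.mem_inter_iff, Set.mem_preimage, Set.mem_ofPred_eq, past_add, future_add]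
  have hm1 : Measurable fun a : ℝ => Q {M | (a, past a M) ∈ H} :=
    measurable_measure_prodMk_left (s := (fun p : ℝ × Config => (p.1, past p.1 p.2)) ⁻¹' H)
      ((measurable_fst.prodMk measurable_past) hH)
  have hm2 := measurable_tail_mark_pair Q hτ
  have hm3 : Measurable fun z : ℝ × ℝ => Q {M | (z.1, past z.1 M) ∈ H} *
      Q {M | ((future 0 M).add (0, z.2)).upCount (Set.Ioc 0 (τ z.1)) = 0} :=
    (hm1.comp measurable_fst).mul hm2
  rw [lintegral_congr h3, lintegral_intensity hm3] at h1
  refine h1.trans ?_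
  congr 1
  refine lintegral_congr fun a => ?_
  exact lintegral_const_mul (Q {M | (a, past a M) ∈ H}) (measurable_tail_mark Q (τ a))

/-- Mecke's formula for the atoms that share their time with another one: the added atom accounts
for one unit of the count, so the original process would need an atom at the prescribed time, and a
vertical line has mean zero. -/
theorem ae_simple (hQ : IsPoissonLaw Q (intensity f G)) : ∀ᵐ M ∂Q, M.Simple := by
  have := hQ.prob
  have hcount : Measurable fun p : Config × (ℝ × ℝ) => p.1.1 {w | w.1 = p.2.1} :=
    measurable_measure_section measurable_fst
      (S := {q : (Config × (ℝ × ℝ)) × (ℝ × ℝ) | q.2.1 = q.1.2.1})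
      (measurableSet_eq_fun measurable_snd.fst measurable_fst.snd.fst)
  let D : Set (Config × (ℝ × ℝ)) := {p | 1 < p.1.1 {w | w.1 = p.2.1}}
  have hD : MeasurableSet D := hcount measurableSet_Ioi
  have h1 := hQ.mecke_set hD
  have h3 : ∀ z : ℝ × ℝ, Q {M | (M.add z, z) ∈ D} = 0 := by
    intro z
    have h0 : intensity f G {w | w.1 = z.1} = 0 := by
      have := intensity_preimage_fst (f := f) (G := G) {z.1}
      rw [Real.volume_singleton, mul_zero] at this
      exact this
    refine measure_eq_zero_iff_ae_notMem.2 ?_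
    filter_upwards [hQ.ae_eq_zero (measurableSet_time z.1) h0] with M hM
    simp only [D, Set.mem_ofPred_eq, add_val, Measure.add_apply, hM, zero_add, not_lt]
    exact prob_le_one
  simp_rw [h3, lintegral_zero] at h1
  have h4 : Measurable fun M : Config => M.1 {z | (M, z) ∈ D} :=
    measurable_measure_section measurable_id hD
  rw [lintegral_eq_zero_iff h4] at h1
  filter_upwards [h1] with M hM a
  by_contra! ha
  have hne : M.1 {z | z.1 = a} ≠ 0 := (zero_lt_one.trans ha).ne'
  rw [Ne, M.measure_eq_zero_iff (measurableSet_time a)] at hne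
  push Not at hne
  obtain ⟨z, hz, rfl⟩ := hne
  refine (M.measure_eq_zero_iff (measurable_prodMk_left hD)).1 hM z hz ?_
  exact ha

theorem ae_mark_mem (hQ : IsPoissonLaw Q (intensity f G)) {d : ℝ} (hd : G (Set.Icc 0 d)ᶜ = 0) :
    ∀ᵐ M ∂Q, ∀ z ∈ M.atoms, z.2 ∈ Set.Icc 0 d := by
  have hms : MeasurableSet (Prod.snd ⁻¹' (Set.Icc 0 d)ᶜ : Set (ℝ × ℝ)) :=
    measurable_snd measurableSet_Icc.compl
  have h0 : intensity f G (Prod.snd ⁻¹' (Set.Icc 0 d)ᶜ) = 0 := by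
    rw [intensity, Measure.smul_apply, ← Set.univ_prod, Measure.prod_prod, hd]
    simp
  filter_upwards [hQ.ae_eq_zero hms h0] with M hM z hz
  by_contra h
  exact (M.measure_eq_zero_iff hms).1 hM z hz h

end IsPoissonLaw

open Config

/-! ### Recurrence -/

/-- An empty block longer than every mark, followed by a block with an atom, contains an
up-crossing. -/
theorem exists_upTime_of_block {M : Config} {d s t u : ℝ} (hmark : ∀ z ∈ M.atoms, z.2 ∈ Set.Icc 0 d)
    (hs : 0 ≤ s) (hst : s + d < t) (h0 : M.1 (Prod.fst ⁻¹' Set.Ico s t) = 0)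
    (h1 : M.1 (Prod.fst ⁻¹' Set.Ico t u) ≠ 0) : ∃ a ∈ M.upTimes, t ≤ a := by
  rw [Ne, M.measure_eq_zero_iff (measurable_fst measurableSet_Ico)] at h1
  push Not at h1
  obtain ⟨z₀, hz₀, hz₀'⟩ := h1
  rw [M.measure_eq_zero_iff (measurable_fst measurableSet_Ico)] at h0
  have hd : 0 ≤ d := (hmark z₀ hz₀).1.trans (hmark z₀ hz₀).2
  have hfin : (M.atoms ∩ Prod.fst ⁻¹' Set.Ico t u).Finite := by
    refine (M.finite_atoms u).subset fun z hz => ⟨hz.1, ?_⟩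
    have h2 := hz.2.1
    have h3 := hz.2.2
    rw [Set.mem_ofPred_eq, abs_of_nonneg (by linarith)]
    exact h3.le
  -- The witness is the earliest atom of the second block: every atom before it starts before `s`,
  -- and its mark, at most `d`, has run out by time `t`.
  obtain ⟨z, hz, hmin⟩ := hfin.exists_minimalFor Prod.fst _ ⟨z₀, hz₀, hz₀'⟩
  have ht : t ≤ z.1 := hz.2.1
  refine ⟨z.1, ⟨by linarith, ⟨z, hz.1, rfl⟩, vacant_iff.2 fun w hw hwz => ?_⟩, ht⟩
  have hwt : w.1 < t := by
    by_contra! h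
    exact absurd (hmin ⟨hw, h, hwz.trans hz.2.2⟩ hwz.le) (not_le.2 hwz)
  have hws : w.1 < s := by
    by_contra! h
    exact h0 w hw ⟨h, hwt⟩
  have := (hmark w hw).2
  linarith

namespace IsPoissonLaw

variable {Q : Measure Config} {f : ℝ} {G : Measure ℝ} [IsProbabilityMeasure G]

/-- Second Borel–Cantelli on disjoint blocks of length `d + 2`. The event asks that the first `d +
1` units be empty and the last unit be occupied, which forces an up-crossing; these events are
independent and have the same positive probability. -/
theorem ae_infinite_upTimes (hQ : IsPoissonLaw Q (intensity f G)) (hf : 0 < f) {d : ℝ}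
    (hd0 : 0 ≤ d) (hd : G (Set.Icc 0 d)ᶜ = 0) : ∀ᵐ M ∂Q, M.upTimes.Infinite := by
  have := hQ.prob
  let s : ℕ → ℝ := fun k => k * (d + 2)
  let I : ℕ × Bool → Set ℝ := fun p =>
    if p.2 then Set.Ico (s p.1 + d + 1) (s p.1 + d + 2) else Set.Ico (s p.1) (s p.1 + d + 1)
  have hIm : ∀ p, MeasurableSet (I p) := fun p => by
    simp only [I]
    split_ifs <;> exact measurableSet_Ico
  have hIs : ∀ p, I p ⊆ Set.Ico (s p.1) (s p.1 + d + 2) := fun p => by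
    simp only [I]
    split_ifs
    · exact Set.Ico_subset_Ico (by linarith) le_rfl
    · exact Set.Ico_subset_Ico le_rfl (by linarith)
  have hsd : ∀ {j k : ℕ}, j < k → s j + d + 2 ≤ s k := fun {j k} h => by
    have h1 : (j : ℝ) + 1 ≤ k := by exact_mod_cast h
    have h2 := mul_le_mul_of_nonneg_right h1 (by linarith : (0 : ℝ) ≤ d + 2)
    simp only [s]
    linarith
  have hlt : ∀ p q : ℕ × Bool, p.1 < q.1 → Disjoint (I p) (I q) := fun p q h => by
    refine Set.disjoint_left.2 fun x hp hq => ?_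
    have h1 := (hIs p hp).2
    have h2 := (hIs q hq).1
    have h3 := hsd h
    linarith
  have hft : ∀ j, Disjoint (I (j, false)) (I (j, true)) := fun j =>
    Set.disjoint_left.2 fun x hp hq => absurd hp.2 (not_lt.2 hq.1)
  have hId : Pairwise fun p q => Disjoint (I p) (I q) := by
    rintro ⟨j, b⟩ ⟨k, c⟩ h
    rcases lt_trichotomy j k with hjk | rfl | hjk
    · exact hlt _ _ hjk
    · cases b <;> cases c
      · exact absurd rfl h
      · exact hft j
      · exact (hft j).symm
      · exact absurd rfl h
    · exact (hlt _ _ hjk).symm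
  have hBm : ∀ p, MeasurableSet (Prod.fst ⁻¹' I p : Set (ℝ × ℝ)) := fun p => measurable_fst (hIm p)
  have hind := hQ.iIndepFun_of_disjoint (B := fun p => Prod.fst ⁻¹' I p) hBm
    fun p q h => (hId h).preimage _
  -- The label `false` stands for the empty part of a block, `true` for the occupied one.
  let T : ℕ × Bool → Set ℝ≥0∞ := fun p => if p.2 then {0}ᶜ else {0}
  have hT : ∀ p, MeasurableSet (T p) := fun p => by
    simp only [T]
    split_ifs
    · exact (measurableSet_singleton 0).compl
    · exact measurableSet_singleton 0
  let E : ℕ × Bool → Set Config := fun p => (fun M : Config => M.1 (Prod.fst ⁻¹' I p)) ⁻¹' T p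
  have hE : ∀ p, MeasurableSet (E p) := fun p => measurable_coe (hBm p) (hT p)
  have hmul : ∀ S : Finset (ℕ × Bool), Q (⋂ p ∈ S, E p) = ∏ p ∈ S, Q (E p) := fun S =>
    (iIndepFun_iff_measure_inter_preimage_eq_mul.1 hind) S fun p _ => hT p
  let A : ℕ → Set Config := fun k => ⋂ p ∈ ({k} : Finset ℕ) ×ˢ (Finset.univ : Finset Bool), E p
  have hA : ∀ k, MeasurableSet (A k) := fun k => Finset.measurableSet_biInter _ fun p _ => hE p
  have hQA : ∀ k, Q (A k) = ∏ b : Bool, Q (E (k, b)) := fun k => by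
    simp only [A]
    rw [hmul, Finset.prod_product, Finset.prod_singleton]
  have hiA : iIndepSet A Q := by
    rw [iIndepSet_iff_meas_biInter hA]
    intro S
    have h1 : ⋂ k ∈ S, A k = ⋂ p ∈ S ×ˢ (Finset.univ : Finset Bool), E p := by
      ext M
      simp only [A, Set.mem_iInter, Finset.mem_product, Finset.mem_singleton, Finset.mem_univ,
        and_true]
      exact ⟨fun h p hp => h p.1 hp p rfl, fun h k hk p hp => h p (hp ▸ hk)⟩
    rw [h1, hmul, Finset.prod_product]
    exact Finset.prod_congr rfl fun k _ => (hQA k).symm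
  have hvol : ∀ a b : ℝ, intensity f G (Prod.fst ⁻¹' Set.Ico a b) = ENNReal.ofReal (f * (b - a)) := by
    intro a b
    rw [intensity_preimage_fst, Real.volume_Ico, ENNReal.ofReal_mul hf.le]
  have hpos : ∀ k, Q (A k) = ENNReal.ofReal (1 - Real.exp (-f)) *
      ENNReal.ofReal (Real.exp (-(f * (d + 1)))) := by
    intro k
    rw [hQA, Fintype.prod_bool]
    congr 1
    · have h1 : E (k, true) = {M | M.1 (Prod.fst ⁻¹' I (k, true)) = 0}ᶜ := by
        ext M
        simp [E, T]
      have h2 : MeasurableSet {M : Config | M.1 (Prod.fst ⁻¹' I (k, true)) = 0} :=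
        measurable_coe (hBm _) (measurableSet_singleton 0)
      rw [h1, prob_compl_eq_one_sub h2]
      simp only [I, if_true]
      rw [hQ.measure_void (measurable_fst measurableSet_Ico) (by rw [hvol]; simp), hvol,
        ENNReal.ofReal_sub _ (Real.exp_pos _).le, ENNReal.ofReal_one,
        show f * (s k + d + 2 - (s k + d + 1)) = f by ring, ENNReal.toReal_ofReal hf.le]
    · have h1 : E (k, false) = {M | M.1 (Prod.fst ⁻¹' I (k, false)) = 0} := by
        ext M
        simp [E, T]
      rw [h1]
      simp only [I, Bool.false_eq_true, if_false]
      rw [hQ.measure_void (measurable_fst measurableSet_Ico) (by rw [hvol]; simp), hvol,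
        show f * (s k + d + 1 - s k) = f * (d + 1) by ring, ENNReal.toReal_ofReal (by positivity)]
  have hsum : ∑' k, Q (A k) = ∞ := by
    simp_rw [hpos]
    refine ENNReal.tsum_const_eq_top_of_ne_zero ?_
    refine mul_ne_zero ?_ ?_
    · rw [Ne, ENNReal.ofReal_eq_zero, not_le, sub_pos, Real.exp_lt_one_iff]
      linarith
    · rw [Ne, ENNReal.ofReal_eq_zero, not_le]
      exact Real.exp_pos _
  have hlim := measure_limsup_eq_one hA hiA hsum
  have hlim' : ∀ᵐ M ∂Q, M ∈ limsup A atTop := by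
    rw [← prob_compl_eq_zero_iff (MeasurableSet.measurableSet_limsup hA)] at hlim
    exact hlim
  filter_upwards [hlim', hQ.ae_mark_mem hd] with M hM hmark
  rw [limsup_eq_iInf_iSup_of_nat] at hM
  simp only [Set.iInf_eq_iInter, Set.iSup_eq_iUnion, Set.mem_iInter, Set.mem_iUnion,
    exists_prop] at hM
  refine Set.infinite_of_not_bddAbove fun ⟨R, hR⟩ => ?_
  obtain ⟨n, hn⟩ := exists_nat_gt R
  obtain ⟨k, hk, hMk⟩ := hM n
  simp only [A, Set.mem_iInter, Finset.mem_product, Finset.mem_singleton, Finset.mem_univ,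
    and_true] at hMk
  have h0 := hMk (k, false) rfl
  have h1 := hMk (k, true) rfl
  simp only [E, T, I, Set.mem_preimage, if_true, Bool.false_eq_true, if_false, Set.mem_compl_iff,
    Set.mem_singleton_iff] at h0 h1
  have hk0 : (n : ℝ) ≤ k := by exact_mod_cast hk
  have hsk : (k : ℝ) ≤ s k := by
    have : (0 : ℝ) ≤ k := Nat.cast_nonneg k
    simp only [s]
    nlinarith
  obtain ⟨a, ha, hta⟩ := exists_upTime_of_block hmark (s := s k)
    (by simp only [s]; positivity) (by linarith) h0 h1
  have := hR ha
  linarith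

end IsPoissonLaw

open Config

/-! ### The renewal property -/

namespace Config

theorem upCount_mono {M : Config} {S T : Set ℝ} (h : S ⊆ T) : M.upCount S ≤ M.upCount T :=
  measure_mono fun _ hz => ⟨h hz.1, hz.2⟩

theorem upCount_empty {M : Config} : M.upCount ∅ = 0 := by simp [upCount]

/-- The first time by which there are at least `n + 1` up-crossings. -/
def upEpoch (n : ℕ) (M : Config) : ℝ :=
  sInf {t | ((n + 1 : ℕ) : ℝ≥0∞) ≤ M.upCount (Set.Ioc 0 t)}

/-- The set under the infimum is closed upwards, so rational times are enough to test whether the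
infimum is below `t`. -/
theorem measurable_upEpoch (n : ℕ) : Measurable (upEpoch n) := by
  refine measurable_of_Iio fun t => ?_
  let S : Config → Set ℝ := fun M => {t | ((n + 1 : ℕ) : ℝ≥0∞) ≤ M.upCount (Set.Ioc 0 t)}
  have hup : ∀ M, ∀ s ∈ S M, ∀ r, s ≤ r → r ∈ S M := fun M s hs r hr =>
    le_trans hs (upCount_mono (Set.Ioc_subset_Ioc_right hr))
  have hpos : ∀ M, ∀ s ∈ S M, 0 < s := fun M s hs => by
    by_contra! h
    have h1 : ((n + 1 : ℕ) : ℝ≥0∞) ≤ M.upCount (Set.Ioc 0 s) := hs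
    rw [Set.Ioc_eq_empty (not_lt.2 h), upCount_empty] at h1
    simp at h1
  have hm : ∀ q : ℝ, MeasurableSet {M | q ∈ S M} := fun q =>
    measurableSet_le measurable_const
      (measurable_upCount_Ioc measurable_id measurable_const measurable_const)
  -- The second set of the union gathers the configurations that never reach `n + 1` up-crossings,
  -- for which the infimum of the empty set is `0`.
  have key : upEpoch n ⁻¹' Set.Iio t =
      (⋃ q : {q : ℚ // (q : ℝ) < t}, {M | ((q.1 : ℚ) : ℝ) ∈ S M}) ∪
        ({_M : Config | 0 < t} ∩ ⋂ q : ℚ, {M | (q : ℝ) ∈ S M}ᶜ) := by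
    ext M
    simp only [Set.mem_preimage, Set.mem_Iio, Set.mem_union, Set.mem_iUnion, Set.mem_ofPred_eq,
      Set.mem_inter_iff, Set.mem_iInter, Set.mem_compl_iff]
    change sInf (S M) < t ↔ _
    rcases (S M).eq_empty_or_nonempty with h | h
    · simp [h]
    · have hb : BddBelow (S M) := ⟨0, fun s hs => (hpos M s hs).le⟩
      rw [csInf_lt_iff hb h]
      constructor
      · rintro ⟨s, hs, hst⟩
        obtain ⟨q, hq1, hq2⟩ := exists_rat_btwn hst
        exact Or.inl ⟨⟨q, hq2⟩, hup M s hs _ hq1.le⟩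
      · rintro (⟨⟨q, hq⟩, hS⟩ | ⟨-, hno⟩)
        · exact ⟨q, hS, hq⟩
        · obtain ⟨s, hs⟩ := h
          obtain ⟨q, hq⟩ := exists_rat_gt s
          exact absurd (hup M s hs q hq.le) (hno q)
  rw [key]
  refine (MeasurableSet.iUnion fun q => hm _).union (MeasurableSet.inter ?_ ?_)
  · by_cases h : 0 < t <;> simp [h]
  · exact MeasurableSet.iInter fun q => (hm _).compl

theorem le_upCount_Ioc_iff {M : Config} (hs : M.Simple) (n : ℕ) (t : ℝ) :
    ((n : ℕ) : ℝ≥0∞) ≤ M.upCount (Set.Ioc 0 t) ↔ (n : ℕ∞) ≤ (M.upTimes ∩ Set.Iic t).encard := by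
  rw [hs.upCount_eq measurableSet_Ioc fun x hx => hx.1]
  have : M.upTimes ∩ Set.Ioc 0 t = M.upTimes ∩ Set.Iic t := by
    ext x
    exact ⟨fun h => ⟨h.1, h.2.2⟩, fun h => ⟨h.1, h.1.1, h.2⟩⟩
  rw [this, ← ENat.toENNReal_coe, ENat.toENNReal_le]

theorem upEpoch_eq {M : Config} (hs : M.Simple) (hU : M.upTimes.Infinite) (n : ℕ) :
    upEpoch n M = successive M.upTimes n := by
  rw [upEpoch]
  have : {t | ((n + 1 : ℕ) : ℝ≥0∞) ≤ M.upCount (Set.Ioc 0 t)} =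
      Set.Ici (successive M.upTimes n) := by
    ext t
    rw [Set.mem_ofPred_eq, le_upCount_Ioc_iff hs, le_encard_inter_Iic_iff M.finite_upTimes hU]
    rfl
  rw [this, csInf_Ici]

/-- The earlier epochs can be read off the strict past of the `n`-th one: truncation keeps the
counts before that time, and from then on the count is frozen at `n ≥ i + 1`. -/
theorem upEpoch_past_eq {M : Config} (hs : M.Simple) (hU : M.upTimes.Infinite) {i n : ℕ}
    (hi : i < n) : upEpoch i (past (successive M.upTimes n) M) = successive M.upTimes i := by
  rw [upEpoch]
  have hmono := strictMono_successive M.finite_upTimes hU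
  have : {t | ((i + 1 : ℕ) : ℝ≥0∞) ≤
      (past (successive M.upTimes n) M).upCount (Set.Ioc 0 t)} =
      Set.Ici (successive M.upTimes i) := by
    ext t
    have hsp : (past (successive M.upTimes n) M).Simple := simple_res hs (measurableSet_before _)
    rw [Set.mem_ofPred_eq, le_upCount_Ioc_iff hsp, upTimes_past, Set.mem_Ici]
    rcases lt_or_ge t (successive M.upTimes n) with h | h
    · have hI : Set.Iio (successive M.upTimes n) ∩ Set.Iic t = Set.Iic t :=
        Set.inter_eq_right.2 fun x hx => lt_of_le_of_lt hx h
      rw [Set.inter_assoc, hI,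
        le_encard_inter_Iic_iff M.finite_upTimes hU]
    · have hI : Set.Iio (successive M.upTimes n) ∩ Set.Iic t =
          Set.Iio (successive M.upTimes n) := Set.inter_eq_left.2 fun x hx => hx.le.trans h
      refine iff_of_true ?_ ((hmono hi).le.trans h)
      rw [Set.inter_assoc, hI,
        encard_inter_Iio_successive M.finite_upTimes hU]
      exact_mod_cast hi
  rw [this, csInf_Ici]

/-- The up-crossing epochs, frozen after the `n`-th one. -/
def stoppedEpochs (n : ℕ) (M : Config) (i : ℕ) : ℝ := upEpoch (min i n) M

theorem measurable_stoppedEpochs (n : ℕ) : Measurable (stoppedEpochs n) :=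
  measurable_pi_lambda _ fun _ => measurable_upEpoch _

/-- The time between two consecutive up-crossing epochs. -/
def upGap (n : ℕ) (M : Config) : ℝ := upEpoch (n + 1) M - upEpoch n M

theorem measurable_upGap (n : ℕ) : Measurable (upGap n) :=
  (measurable_upEpoch _).sub (measurable_upEpoch _)

/-- The event that a time is the `n`-th epoch and that the epochs up to it lie in `K`, in terms of
the configuration before that time. -/
def epochEvent (n : ℕ) (K : Set (ℕ → ℝ)) : Set (ℝ × Config) :=
  {p | 0 < p.1 ∧ p.2.Vacant p.1 ∧ p.2.upCount (Set.Ioi 0) = n ∧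
    (fun i => if i < n then upEpoch i p.2 else p.1) ∈ K}

theorem measurableSet_epochEvent (n : ℕ) {K : Set (ℕ → ℝ)} (hK : MeasurableSet K) :
    MeasurableSet (epochEvent n K) := by
  have h1 : MeasurableSet {p : ℝ × Config | 0 < p.1} := measurableSet_lt measurable_const measurable_fst
  have h2 : Measurable fun p : ℝ × Config => p.2.upCount (Set.Ioi 0) :=
    measurable_upCount (f := fun p : ℝ × Config => p.2) measurable_snd
      (S := {q : (ℝ × Config) × ℝ | 0 < q.2}) (measurableSet_lt measurable_const measurable_snd)
  have h3 : Measurable fun (p : ℝ × Config) (i : ℕ) => if i < n then upEpoch i p.2 else p.1 := by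
    refine measurable_pi_lambda _ fun i => ?_
    split_ifs
    · exact (measurable_upEpoch i).comp measurable_snd
    · exact measurable_fst
  exact h1.inter (measurableSet_vacant.inter ((h2 (measurableSet_singleton _)).inter (h3 hK)))

theorem measurableSet_palm {H : Set (ℝ × Config)} (hH : MeasurableSet H) {τ : ℝ → ℝ}
    (hτ : Measurable τ) (M : Config) : MeasurableSet {z : ℝ × ℝ | (z.1, past z.1 M) ∈ H ∧
      ((future z.1 M).add z).upCount (Set.Ioc z.1 (z.1 + τ z.1)) = 0} := by
  have h1 : Measurable fun z : ℝ × ℝ => (z.1, past z.1 M) :=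
    measurable_fst.prodMk (measurable_past.comp (measurable_fst.prodMk measurable_const))
  have h2 : Measurable fun z : ℝ × ℝ => (future z.1 M).add z :=
    measurable_add_atom.comp ((measurable_future.comp
      (measurable_fst.prodMk measurable_const)).prodMk measurable_id)
  exact (h1 hH).inter (measurable_upCount_Ioc h2 measurable_fst
    (measurable_fst.add (hτ.comp measurable_fst)) (measurableSet_singleton 0))

theorem upCount_Ioc_successive_eq_zero_iff {M : Config} (hs : M.Simple)
    (hU : M.upTimes.Infinite) (n : ℕ) (t : ℝ) :
    M.upCount (Set.Ioc (successive M.upTimes n) (successive M.upTimes n + t)) = 0 ↔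
      t < successive M.upTimes (n + 1) - successive M.upTimes n := by
  have hmem := successive_mem M.finite_upTimes hU
  have hle := isLeast_successive_succ M.finite_upTimes hU n
  rw [hs.upCount_eq measurableSet_Ioc (fun x hx => (hmem n).1.trans hx.1), ← ENat.toENNReal_zero,
    ENat.toENNReal_inj, Set.encard_eq_zero]
  constructor
  · intro h
    by_contra! h'
    have : successive M.upTimes (n + 1) ∈ (∅ : Set ℝ) :=
      h ▸ ⟨hmem _, hle.1.2, by linarith⟩
    exact this
  · intro h
    rw [Set.eq_empty_iff_forall_notMem]
    rintro x ⟨hxU, hx1, hx2⟩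
    have := hle.2 ⟨hxU, hx1⟩
    linarith

/-- One atom only can be the `n`-th epoch, so the count of atoms with the Palm property is `0` or
`1`. This rewrites an event about epochs as a count to which `lintegral_palm` applies. -/
theorem measure_epoch_eq {M : Config} (hs : M.Simple) (hU : M.upTimes.Infinite) (n : ℕ)
    {K : Set (ℕ → ℝ)} (hK : MeasurableSet K) (t : ℝ) :
    M.1 {z | (z.1, past z.1 M) ∈ epochEvent n K ∧
        ((future z.1 M).add z).upCount (Set.Ioc z.1 (z.1 + t)) = 0} =
      {M | stoppedEpochs n M ∈ K ∧ t < upGap n M}.indicator 1 M := by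
  have hmem := successive_mem M.finite_upTimes hU
  have hfrozen : stoppedEpochs n M = fun i => if i < n then
      upEpoch i (past (successive M.upTimes n) M) else successive M.upTimes n := by
    ext i
    rw [stoppedEpochs, upEpoch_eq hs hU]
    split_ifs with h
    · rw [upEpoch_past_eq hs hU h, min_eq_left h.le]
    · rw [min_eq_right (not_lt.1 h)]
  have hiff : ∀ z ∈ M.atoms, ((z.1, past z.1 M) ∈ epochEvent n K ∧
      ((future z.1 M).add z).upCount (Set.Ioc z.1 (z.1 + t)) = 0) ↔
        z.1 = successive M.upTimes n ∧ stoppedEpochs n M ∈ K ∧ t < upGap n M := by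
    intro z hz
    have hgap : upGap n M = successive M.upTimes (n + 1) - successive M.upTimes n := by
      rw [upGap, upEpoch_eq hs hU, upEpoch_eq hs hU]
    have hcount : (past z.1 M).upCount (Set.Ioi 0) = n ↔ (M.upTimes ∩ Set.Iio z.1).encard = n := by
      have hsp : (past z.1 M).Simple := simple_res hs (measurableSet_before _)
      rw [hsp.upCount_eq measurableSet_Ioi fun x hx => hx]
      have h1 : (past z.1 M).upTimes ∩ Set.Ioi 0 = M.upTimes ∩ Set.Iio z.1 := by
        rw [upTimes_past]
        exact Set.inter_eq_left.2 fun x hx => hx.1.1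
      rw [h1, ← ENat.toENNReal_coe, ENat.toENNReal_inj]
    constructor
    · rintro ⟨⟨h0, hv, hn, hKz⟩, hup⟩
      have hv' : M.Vacant z.1 := (vacant_past_iff le_rfl).1 hv
      have hzU : z.1 ∈ M.upTimes := ⟨h0, ⟨z, hz, rfl⟩, hv'⟩
      have hzn := eq_successive_of_encard M.finite_upTimes hU hzU (hcount.1 hn)
      refine ⟨hzn, ?_, ?_⟩
      · rw [hfrozen, ← hzn]
        exact hKz
      · rw [upCount_future_add hz hv' hs, hzn, upCount_Ioc_successive_eq_zero_iff hs hU] at hup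
        rwa [hgap]
    · rintro ⟨hzn, hKz, ht⟩
      have hzU : z.1 ∈ M.upTimes := hzn ▸ hmem n
      refine ⟨⟨hzU.1, (vacant_past_iff le_rfl).2 hzU.2.2, hcount.2 ?_, ?_⟩, ?_⟩
      · rw [hzn]
        exact encard_inter_Iio_successive M.finite_upTimes hU n
      · rw [hfrozen, ← hzn] at hKz
        exact hKz
      · rw [upCount_future_add hz hzU.2.2 hs, hzn, upCount_Ioc_successive_eq_zero_iff hs hU]
        rwa [hgap] at ht
  rw [hs.measure_eq (measurableSet_palm (measurableSet_epochEvent n hK) measurable_const M)]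
  by_cases hev : stoppedEpochs n M ∈ K ∧ t < upGap n M
  · rw [Set.indicator_of_mem (by exact hev)]
    have : Prod.fst '' (M.atoms ∩ {z | (z.1, past z.1 M) ∈ epochEvent n K ∧
        ((future z.1 M).add z).upCount (Set.Ioc z.1 (z.1 + t)) = 0}) =
        {successive M.upTimes n} := by
      ext a
      constructor
      · rintro ⟨z, ⟨hz, hzA⟩, rfl⟩
        exact ((hiff z hz).1 hzA).1
      · rintro rfl
        obtain ⟨z, hz, hzn⟩ := (hmem n).2.1
        exact ⟨z, ⟨hz, (hiff z hz).2 ⟨hzn, hev⟩⟩, hzn⟩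
    rw [this]
    simp
  · rw [Set.indicator_of_notMem (by exact hev)]
    have : Prod.fst '' (M.atoms ∩ {z | (z.1, past z.1 M) ∈ epochEvent n K ∧
        ((future z.1 M).add z).upCount (Set.Ioc z.1 (z.1 + t)) = 0}) = ∅ := by
      rw [Set.image_eq_empty, Set.eq_empty_iff_forall_notMem]
      rintro z ⟨hz, hzA⟩
      exact hev ((hiff z hz).1 hzA).2
    rw [this]
    simp

end Config

theorem tail_zero (Q : Measure Config) [IsProbabilityMeasure Q] (G : Measure ℝ)
    [IsProbabilityMeasure G] : tail Q G 0 = 1 := by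
  simp [tail, upCount_empty]

namespace IsPoissonLaw

variable {Q : Measure Config} {f : ℝ} {G : Measure ℝ} [IsProbabilityMeasure G]

/-- After each epoch the process starts afresh. -/
theorem measure_stoppedEpochs (hQ : IsPoissonLaw Q (intensity f G))
    (hinf : ∀ᵐ M ∂Q, M.upTimes.Infinite) (n : ℕ) {K : Set (ℕ → ℝ)} (hK : MeasurableSet K)
    (t : ℝ) : Q {M | stoppedEpochs n M ∈ K ∧ t < upGap n M} =
      (ENNReal.ofReal f * ∫⁻ a, Q {M | (a, past a M) ∈ epochEvent n K}) * tail Q G t := by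
  have := hQ.prob
  have hm1 : Measurable fun a : ℝ => Q {M | (a, past a M) ∈ epochEvent n K} :=
    measurable_measure_prodMk_left (s := (fun p : ℝ × Config => (p.1, past p.1 p.2)) ⁻¹' _)
      ((measurable_fst.prodMk measurable_past) (measurableSet_epochEvent n hK))
  have h := hQ.lintegral_palm (measurableSet_epochEvent n hK) (measurable_const (a := t))
  rw [lintegral_mul_const _ hm1, ← mul_assoc] at h
  rw [← h]
  have hev : MeasurableSet {M | stoppedEpochs n M ∈ K ∧ t < upGap n M} :=
    (measurable_stoppedEpochs n hK).inter (measurableSet_lt measurable_const (measurable_upGap n))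
  rw [← lintegral_indicator_one hev]
  refine lintegral_congr_ae ?_
  filter_upwards [hQ.ae_simple, hinf] with M hs hU
  exact (measure_epoch_eq hs hU n hK t).symm

theorem ae_upGap_pos (hQ : IsPoissonLaw Q (intensity f G))
    (hinf : ∀ᵐ M ∂Q, M.upTimes.Infinite) (n : ℕ) : ∀ᵐ M ∂Q, 0 < upGap n M := by
  filter_upwards [hQ.ae_simple, hinf] with M hs hU
  rw [upGap, upEpoch_eq hs hU, upEpoch_eq hs hU, sub_pos]
  exact strictMono_successive M.finite_upTimes hU n.lt_succ_self

/-- The prefactor in `measure_stoppedEpochs` does not involve `t`. Taking `t = 0`, where `tail` is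
`1` and the gap condition holds almost surely, identifies it as the probability of the past event.
-/
theorem measure_stoppedEpochs_mul (hQ : IsPoissonLaw Q (intensity f G))
    (hinf : ∀ᵐ M ∂Q, M.upTimes.Infinite) (n : ℕ) {K : Set (ℕ → ℝ)} (hK : MeasurableSet K)
    (t : ℝ) : Q {M | stoppedEpochs n M ∈ K ∧ t < upGap n M} =
      Q {M | stoppedEpochs n M ∈ K} * tail Q G t := by
  have := hQ.prob
  have h0 := hQ.measure_stoppedEpochs hinf n hK 0
  rw [tail_zero, mul_one] at h0
  rw [hQ.measure_stoppedEpochs hinf n hK t, ← h0]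
  congr 1
  refine measure_congr ?_
  filter_upwards [hQ.ae_upGap_pos hinf n] with M hM
  exact propext ⟨fun h => h.1, fun h => ⟨h, hM⟩⟩

theorem measure_lt_upGap (hQ : IsPoissonLaw Q (intensity f G))
    (hinf : ∀ᵐ M ∂Q, M.upTimes.Infinite) (n : ℕ) (t : ℝ) :
    Q {M | t < upGap n M} = tail Q G t := by
  have := hQ.prob
  simpa using hQ.measure_stoppedEpochs_mul hinf n MeasurableSet.univ t

theorem indepFun_stoppedEpochs_upGap (hQ : IsPoissonLaw Q (intensity f G))
    (hinf : ∀ᵐ M ∂Q, M.upTimes.Infinite) (n : ℕ) :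
    IndepFun (stoppedEpochs n) (upGap n) Q := by
  have := hQ.prob
  rw [indepFun_iff_measure_inter_preimage_eq_mul]
  intro K B hK hB
  have hmK := measurable_stoppedEpochs n hK
  have h : (Q.restrict (stoppedEpochs n ⁻¹' K)).map (upGap n) =
      Q (stoppedEpochs n ⁻¹' K) • Q.map (upGap n) := by
    have : IsFiniteMeasure (Q (stoppedEpochs n ⁻¹' K) • Q.map (upGap n)) :=
      Measure.smul_finite _ (measure_ne_top _ _)
    have huniv : ∀ t : ℝ, (Set.Iic t : Set ℝ) = (Set.Ioi t)ᶜ := fun t => by simp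
    have hIoi : ∀ t : ℝ, (Q.restrict (stoppedEpochs n ⁻¹' K)).map (upGap n) (Set.Ioi t) =
        (Q (stoppedEpochs n ⁻¹' K) • Q.map (upGap n)) (Set.Ioi t) := fun t => by
      rw [Measure.map_apply (measurable_upGap n) measurableSet_Ioi, Measure.smul_apply,
        Measure.map_apply (measurable_upGap n) measurableSet_Ioi,
        Measure.restrict_apply (measurable_upGap n measurableSet_Ioi), smul_eq_mul]
      have h1 := hQ.measure_stoppedEpochs_mul hinf n hK t
      rw [← hQ.measure_lt_upGap hinf n t] at h1
      rw [Set.inter_comm]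
      exact h1
    refine Measure.ext_of_Iic _ _ fun t => ?_
    rw [huniv, measure_compl measurableSet_Ioi (measure_ne_top _ _),
      measure_compl measurableSet_Ioi (measure_ne_top _ _), hIoi]
    congr 1
    rw [Measure.map_apply (measurable_upGap n) .univ, Measure.smul_apply,
      Measure.map_apply (measurable_upGap n) .univ]
    simp
  have h2 := congrArg (fun ν : Measure ℝ => ν B) h
  simp only [Measure.map_apply (measurable_upGap n) hB, Measure.smul_apply, smul_eq_mul,
    Measure.restrict_apply (measurable_upGap n hB)] at h2
  rw [Set.inter_comm]
  exact h2

end IsPoissonLaw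

/-- A sequence is independent if each term is independent of the vector of the previous ones. -/
theorem iIndepFun_of_indepFun_succ {Ω : Type*} [MeasurableSpace Ω] {P : Measure Ω}
    [IsProbabilityMeasure P] {X : ℕ → Ω → ℝ}
    (h : ∀ n, IndepFun (fun ω i => X (min i n) ω) (X (n + 1)) P) : iIndepFun X P := by
  classical
  have key : ∀ n (B : ℕ → Set ℝ), (∀ i, MeasurableSet (B i)) →
      P (⋂ i ∈ Finset.range (n + 1), X i ⁻¹' B i) =
        ∏ i ∈ Finset.range (n + 1), P (X i ⁻¹' B i) := by
    intro n B hB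
    induction n with
    | zero => simp
    | succ n ih =>
      rw [Finset.prod_range_succ, ← ih]
      have h1 : (⋂ i ∈ Finset.range (n + 1), X i ⁻¹' B i) =
          (fun ω i => X (min i n) ω) ⁻¹' (⋂ i ∈ Finset.range (n + 1), {x | x i ∈ B i}) := by
        ext ω
        simp only [Set.mem_iInter, Finset.mem_range, Set.mem_preimage, Set.mem_ofPred_eq]
        refine forall₂_congr fun i hi => ?_
        rw [min_eq_left (by omega)]
      have h2 : (⋂ i ∈ Finset.range (n + 1 + 1), X i ⁻¹' B i) =
          (⋂ i ∈ Finset.range (n + 1), X i ⁻¹' B i) ∩ X (n + 1) ⁻¹' B (n + 1) := by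
        rw [Finset.range_add_one (n := n + 1), Finset.set_biInter_insert, Set.inter_comm]
      rw [h2, h1, (h n).measure_inter_preimage_eq_mul _ _ _ (hB _)]
      exact Finset.measurableSet_biInter _ fun i _ => measurable_pi_apply i (hB i)
  rw [iIndepFun_iff_measure_inter_preimage_eq_mul]
  intro S B hB
  let B' : ℕ → Set ℝ := fun i => if i ∈ S then B i else Set.univ
  have hB' : ∀ i, MeasurableSet (B' i) := fun i => by
    simp only [B']
    split_ifs with hi
    · exact hB i hi
    · exact .univ
  obtain ⟨n, hn⟩ : ∃ n, S ⊆ Finset.range (n + 1) :=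
    ⟨S.sup id, fun i hi => Finset.mem_range.2 (Nat.lt_succ_of_le (Finset.le_sup (f := id) hi))⟩
  have h1 := key n B' hB'
  have h2 : ⋂ i ∈ Finset.range (n + 1), X i ⁻¹' B' i = ⋂ i ∈ S, X i ⁻¹' B i := by
    ext ω
    simp only [Set.mem_iInter, Set.mem_preimage, B']
    constructor
    · intro h i hi
      simpa [hi] using h i (hn hi)
    · intro h i _
      split_ifs with hi
      · exact h i hi
      · trivial
  have h3 : ∏ i ∈ Finset.range (n + 1), P (X i ⁻¹' B' i) = ∏ i ∈ S, P (X i ⁻¹' B i) := by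
    rw [← Finset.prod_subset hn]
    · exact Finset.prod_congr rfl fun i hi => by simp [B', hi]
    · intro i _ hi
      simp [B', hi]
  rw [← h2, h1, h3]

theorem IsPoissonLaw.iIndepFun_epoch {Q : Measure Config} {f : ℝ} {G : Measure ℝ}
    [IsProbabilityMeasure G] (hQ : IsPoissonLaw Q (intensity f G))
    (hinf : ∀ᵐ M ∂Q, M.upTimes.Infinite) :
    iIndepFun (fun (n : ℕ) M => if n = 0 then upEpoch 0 M else upEpoch n M - upEpoch (n - 1) M)
      Q := by
  have := hQ.prob
  refine iIndepFun_of_indepFun_succ fun n => ?_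
  -- The first epoch and the gaps up to index `n` are a function of the epochs frozen at `n`;
  -- truncated at `n`, they are therefore independent of the next gap.
  let φ : (ℕ → ℝ) → ℕ → ℝ := fun x i =>
    if min i n = 0 then x 0 else x (min i n) - x (min i n - 1)
  have hφ : Measurable φ := measurable_pi_lambda _ fun i => by
    simp only [φ]
    split_ifs
    · exact measurable_pi_apply 0
    · exact (measurable_pi_apply _).sub (measurable_pi_apply _)
  have h := (hQ.indepFun_stoppedEpochs_upGap hinf n).comp hφ measurable_id
  convert h using 1
  swap
  · ext M
    simp [upGap]
  ext M i
  simp only [φ, Function.comp_apply, stoppedEpochs]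
  by_cases h0 : min i n = 0
  · simp [h0]
  · rw [if_neg h0, if_neg h0, min_eq_left (min_le_right i n),
      min_eq_left ((Nat.sub_le _ _).trans (min_le_right i n))]

/-! ### The renewal equation of the gap law -/

namespace Config

/-- The atoms after time `0`, together with an atom of mark `l` at time `0`. -/
def started (l : ℝ) (M : Config) : Config := (future 0 M).add (0, l)

theorem atoms_started (l : ℝ) (M : Config) :
    (started l M).atoms = insert (0, l) (M.atoms ∩ {z | 0 < z.1}) := by
  rw [started, atoms_add, atoms_future]

theorem vacant_started_iff {l a : ℝ} {M : Config} (ha : 0 < a) : (started l M).Vacant a ↔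
    l < a ∧ ∀ z ∈ M.atoms, 0 < z.1 → z.1 < a → z.1 + z.2 < a := by
  rw [vacant_iff, atoms_started]
  constructor
  · intro h
    refine ⟨by simpa using h (0, l) (Set.mem_insert _ _) ha, fun z hz h0 hza => ?_⟩
    exact h z (Set.mem_insert_of_mem _ ⟨hz, h0⟩) hza
  · rintro ⟨hl, h⟩ z (rfl | hz) hza
    · simpa using hl
    · exact h z hz.1 hz.2 hza

theorem vacant_started_past_iff {l a : ℝ} {M : Config} (ha : 0 < a) :
    (started l (past a M)).Vacant a ↔ (started l M).Vacant a := by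
  rw [vacant_started_iff ha, vacant_started_iff ha, atoms_past]
  exact and_congr_right fun _ => ⟨fun h z hz h0 hza => h z ⟨hz, hza⟩ h0 hza,
    fun h z hz h0 hza => h z hz.1 h0 hza⟩

theorem simple_started {l : ℝ} {M : Config} (hs : M.Simple) : (started l M).Simple := by
  intro a
  rw [started, add_val, Measure.add_apply, future, res_apply (measurableSet_after 0) _
    (measurableSet_time a), Measure.dirac_apply' _ (measurableSet_time a)]
  by_cases ha : a = 0
  · have : {z : ℝ × ℝ | z.1 = a} ∩ {z | 0 < z.1} = ∅ := by
      ext z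
      simp only [Set.mem_inter_iff, Set.mem_ofPred_eq, Set.mem_empty_iff_false, iff_false, not_and]
      intro h
      simp [h, ha]
    rw [this, measure_empty, zero_add]
    exact Set.indicator_le_self' (by simp) _
  · rw [Set.indicator_of_notMem (by simpa using Ne.symm ha), add_zero]
    exact (measure_mono Set.inter_subset_left).trans (hs a)

theorem future_started {l a : ℝ} {M : Config} (ha : 0 < a) :
    future a (started l M) = future a M := by
  have h1 : future a (started l M) = future a (future 0 M) :=
    res_add_of_notMem (measurableSet_after a) _ (by simpa using ha.le)
  rw [h1]
  refine eq_of_measure_eq fun B hB => ?_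
  simp only [future]
  rw [res_apply (measurableSet_after a) _ hB, res_apply (measurableSet_after a) _ hB,
    res_apply (measurableSet_after 0) _ (hB.inter (measurableSet_after a))]
  congr 1
  ext z
  simp only [Set.mem_inter_iff, Set.mem_ofPred_eq, and_iff_left_iff_imp]
  exact fun h => ha.trans h.2

/-- The last epoch up to time `t` is the only one that is not followed by another one. -/
theorem measure_lastEpoch {M : Config} (hs : M.Simple) (l t : ℝ) :
    M.1 {z | (z.1, past z.1 M) ∈ {p : ℝ × Config | 0 < p.1 ∧ p.1 ≤ t ∧ (started l p.2).Vacant p.1} ∧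
        ((future z.1 M).add z).upCount (Set.Ioc z.1 (z.1 + (t - z.1))) = 0} =
      {M | (started l M).upCount (Set.Ioc 0 t) = 0}ᶜ.indicator 1 M := by
  have hs' : (started l M).Simple := simple_started hs
  set U := (started l M).upTimes with hU
  have hiff : ∀ z ∈ M.atoms, ((z.1, past z.1 M) ∈
      {p : ℝ × Config | 0 < p.1 ∧ p.1 ≤ t ∧ (started l p.2).Vacant p.1} ∧
        ((future z.1 M).add z).upCount (Set.Ioc z.1 (z.1 + (t - z.1))) = 0) ↔
      z.1 ∈ U ∧ z.1 ≤ t ∧ U ∩ Set.Ioc z.1 t = ∅ := by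
    intro z hz
    have haux : ∀ (h0 : 0 < z.1), (started l M).Vacant z.1 →
        (((future z.1 M).add z).upCount (Set.Ioc z.1 t) = 0 ↔ U ∩ Set.Ioc z.1 t = ∅) := by
      intro h0 hv
      have hz' : z ∈ (started l M).atoms := by
        rw [atoms_started]
        exact Set.mem_insert_of_mem _ ⟨hz, h0⟩
      rw [← future_started h0 (l := l), upCount_future_add hz' hv hs',
        hs'.upCount_eq measurableSet_Ioc fun x hx => h0.trans hx.1, ← ENat.toENNReal_zero,
        ENat.toENNReal_inj, Set.encard_eq_zero]
    rw [add_sub_cancel]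
    constructor
    · rintro ⟨⟨h0, ht, hv⟩, hup⟩
      have hv' := (vacant_started_past_iff h0).1 hv
      refine ⟨⟨h0, ⟨z, ?_, rfl⟩, hv'⟩, ht, (haux h0 hv').1 hup⟩
      rw [atoms_started]
      exact Set.mem_insert_of_mem _ ⟨hz, h0⟩
    · rintro ⟨⟨h0, -, hv⟩, ht, hup⟩
      exact ⟨⟨h0, ht, (vacant_started_past_iff h0).2 hv⟩, (haux h0 hv).2 hup⟩
  have hmeas : MeasurableSet
      {p : ℝ × Config | 0 < p.1 ∧ p.1 ≤ t ∧ (started l p.2).Vacant p.1} := by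
    have h1 : Measurable fun p : ℝ × Config => (p.1, started l p.2) :=
      measurable_fst.prodMk (measurable_add_atom.comp ((measurable_future.comp
        (measurable_const.prodMk measurable_snd)).prodMk measurable_const))
    exact (measurableSet_lt measurable_const measurable_fst).inter
      ((measurableSet_le measurable_fst measurable_const).inter (h1 measurableSet_vacant))
  have hτ : Measurable fun a : ℝ => t - a := by fun_prop
  rw [hs.measure_eq (measurableSet_palm hmeas hτ M)]
  have himg : Prod.fst '' (M.atoms ∩ {z | (z.1, past z.1 M) ∈
      {p : ℝ × Config | 0 < p.1 ∧ p.1 ≤ t ∧ (started l p.2).Vacant p.1} ∧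
        ((future z.1 M).add z).upCount (Set.Ioc z.1 (z.1 + (t - z.1))) = 0}) =
      {a | a ∈ U ∧ a ≤ t ∧ U ∩ Set.Ioc a t = ∅} := by
    ext a
    constructor
    · rintro ⟨z, ⟨hz, hzA⟩, rfl⟩
      exact (hiff z hz).1 hzA
    · rintro ⟨haU, h⟩
      obtain ⟨h0, ⟨z, hz, rfl⟩, -⟩ := id haU
      rw [atoms_started] at hz
      rcases hz with rfl | hz
      · exact absurd h0 (lt_irrefl 0)
      · exact ⟨z, ⟨hz.1, (hiff z hz.1).2 ⟨haU, h⟩⟩, rfl⟩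
  rw [himg]
  have hcount : (started l M).upCount (Set.Ioc 0 t) = 0 ↔ U ∩ Set.Iic t = ∅ := by
    rw [hs'.upCount_eq measurableSet_Ioc fun x hx => hx.1, ← ENat.toENNReal_zero,
        ENat.toENNReal_inj, Set.encard_eq_zero]
    have : U ∩ Set.Ioc 0 t = U ∩ Set.Iic t := by
      ext x
      exact ⟨fun h => ⟨h.1, h.2.2⟩, fun h => ⟨h.1, h.1.1, h.2⟩⟩
    rw [← hU, this]
  by_cases h : U ∩ Set.Iic t = ∅
  · rw [Set.indicator_of_notMem (by simpa using hcount.2 h)]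
    have : {a | a ∈ U ∧ a ≤ t ∧ U ∩ Set.Ioc a t = ∅} = ∅ := by
      rw [Set.eq_empty_iff_forall_notMem]
      intro a ha
      have : a ∈ (∅ : Set ℝ) := h ▸ ⟨ha.1, ha.2.1⟩
      exact this
    rw [this]
    simp
  · rw [Set.indicator_of_mem (by simpa using hcount.not.2 h)]
    obtain ⟨b, hb, hbmax⟩ := Set.exists_max_image _ id ((started l M).finite_upTimes t)
      (Set.nonempty_iff_ne_empty.2 h)
    have : {a | a ∈ U ∧ a ≤ t ∧ U ∩ Set.Ioc a t = ∅} = {b} := by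
      ext a
      constructor
      · rintro ⟨haU, hat, hae⟩
        by_contra hne
        have hab : a < b := lt_of_le_of_ne (hbmax a ⟨haU, hat⟩) hne
        have : b ∈ (∅ : Set ℝ) := hae ▸ ⟨hb.1, hab, hb.2⟩
        exact this
      · rintro rfl
        refine ⟨hb.1, hb.2, ?_⟩
        rw [Set.eq_empty_iff_forall_notMem]
        intro c hc
        exact absurd (hbmax c ⟨hc.1, hc.2.2⟩) (not_le.2 hc.2.1)
    rw [this]
    simp

end Config

open Config

/-- The probability that no atom started after time `0` is still active at time `a`. -/
def vacancy (Q : Measure Config) (a : ℝ) : ℝ≥0∞ :=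
  Q {M | M.1 {z | 0 < z.1 ∧ z.1 < a ∧ a ≤ z.1 + z.2} = 0}

theorem measurableSet_window (a b : ℝ) :
    MeasurableSet {z : ℝ × ℝ | b < z.1 ∧ z.1 < a ∧ a ≤ z.1 + z.2} :=
  (measurableSet_lt measurable_const measurable_fst).inter
    ((measurableSet_lt measurable_fst measurable_const).inter
      (measurableSet_le measurable_const (measurable_fst.add measurable_snd)))

theorem measurable_vacancy (Q : Measure Config) [SFinite Q] : Measurable (vacancy Q) := by
  have h : Measurable fun p : ℝ × Config =>
      p.2.1 {z | 0 < z.1 ∧ z.1 < p.1 ∧ p.1 ≤ z.1 + z.2} :=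
    measurable_measure_section measurable_snd
      (S := {q : (ℝ × Config) × (ℝ × ℝ) | 0 < q.2.1 ∧ q.2.1 < q.1.1 ∧ q.1.1 ≤ q.2.1 + q.2.2})
      ((measurableSet_lt measurable_const measurable_snd.fst).inter
        ((measurableSet_lt measurable_snd.fst measurable_fst.fst).inter
          (measurableSet_le measurable_fst.fst (measurable_snd.fst.add measurable_snd.snd))))
  exact measurable_measure_prodMk_left (h (measurableSet_singleton 0))

theorem antitone_tail (Q : Measure Config) (G : Measure ℝ) : Antitone (tail Q G) := by
  intro s t hst
  refine lintegral_mono fun l => measure_mono fun M hM => ?_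
  refine measure_mono_null ?_ hM
  exact fun z hz => ⟨⟨hz.1.1, hz.1.2.trans hst⟩, hz.2⟩

theorem tail_le_one (Q : Measure Config) [IsProbabilityMeasure Q] (G : Measure ℝ)
    [IsProbabilityMeasure G] (t : ℝ) : tail Q G t ≤ 1 := by
  refine (lintegral_mono fun l => prob_le_one).trans ?_
  simp

namespace IsPoissonLaw

variable {Q : Measure Config} {f : ℝ} {G : Measure ℝ} [IsProbabilityMeasure G]

/-- Either there is no epoch in `(0, t]`, or there is a unique last one. The Palm formula gives the
density of the latter at `a`: the initial mark is over, no later arrival is still active, and no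
epoch follows during `t - a`. -/
theorem started_equation (hQ : IsPoissonLaw Q (intensity f G)) (l t : ℝ) :
    Q {M | (started l M).upCount (Set.Ioc 0 t) = 0} +
      ENNReal.ofReal f * ∫⁻ a in Set.Ioc 0 t,
        (Set.Iio a).indicator 1 l * (vacancy Q a * tail Q G (t - a)) = 1 := by
  have := hQ.prob
  have hst : Measurable fun p : ℝ × Config => (p.1, started l p.2) :=
    measurable_fst.prodMk (measurable_add_atom.comp ((measurable_future.comp
      (measurable_const.prodMk measurable_snd)).prodMk measurable_const))
  have hmeas : MeasurableSet
      {p : ℝ × Config | 0 < p.1 ∧ p.1 ≤ t ∧ (started l p.2).Vacant p.1} :=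
    (measurableSet_lt measurable_const measurable_fst).inter
      ((measurableSet_le measurable_fst measurable_const).inter (hst measurableSet_vacant))
  have hev : MeasurableSet {M : Config | (started l M).upCount (Set.Ioc 0 t) = 0} :=
    measurable_upCount_Ioc (hst.snd.comp (measurable_const (a := (0 : ℝ)) |>.prodMk measurable_id))
      measurable_const measurable_const (measurableSet_singleton 0)
  have hτ : Measurable fun a : ℝ => t - a := by fun_prop
  have h := hQ.lintegral_palm hmeas hτ
  have h1 : ∫⁻ M, M.1 {z | (z.1, past z.1 M) ∈
      {p : ℝ × Config | 0 < p.1 ∧ p.1 ≤ t ∧ (started l p.2).Vacant p.1} ∧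
        ((future z.1 M).add z).upCount (Set.Ioc z.1 (z.1 + (t - z.1))) = 0} ∂Q =
      Q {M | (started l M).upCount (Set.Ioc 0 t) = 0}ᶜ := by
    rw [← lintegral_indicator_one hev.compl]
    refine lintegral_congr_ae ?_
    filter_upwards [hQ.ae_simple] with M hs
    exact measure_lastEpoch hs l t
  rw [h1] at h
  have h2 : ∫⁻ a in Set.Ioc 0 t, (Set.Iio a).indicator 1 l * (vacancy Q a * tail Q G (t - a)) =
      ∫⁻ a, Q {M | (a, past a M) ∈
        {p : ℝ × Config | 0 < p.1 ∧ p.1 ≤ t ∧ (started l p.2).Vacant p.1}} * tail Q G (t - a) := by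
    rw [← lintegral_indicator measurableSet_Ioc]
    refine lintegral_congr fun a => ?_
    by_cases ha : a ∈ Set.Ioc 0 t
    · rw [Set.indicator_of_mem ha, ← mul_assoc]
      congr 1
      by_cases hl : l < a
      · rw [Set.indicator_of_mem (by exact hl), Pi.one_apply, one_mul, vacancy]
        congr 1
        ext M
        simp only [Set.mem_ofPred_eq]
        rw [vacant_started_past_iff ha.1, vacant_started_iff ha.1,
          M.measure_eq_zero_iff (measurableSet_window a 0)]
        simp only [Set.mem_ofPred_eq, not_and, not_le]
        exact ⟨fun h => ⟨ha.1, ha.2, hl, h⟩, fun h => h.2.2.2⟩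
      · rw [Set.indicator_of_notMem (by exact hl), zero_mul]
        symm
        convert measure_empty (μ := Q)
        rw [Set.eq_empty_iff_forall_notMem]
        rintro M ⟨-, -, hM⟩
        exact hl ((vacant_started_iff ha.1).1 ((vacant_started_past_iff ha.1).1 hM)).1
    · rw [Set.indicator_of_notMem ha]
      have : {M | (a, past a M) ∈
        {p : ℝ × Config | 0 < p.1 ∧ p.1 ≤ t ∧ (started l p.2).Vacant p.1}} = ∅ := by
        rw [Set.eq_empty_iff_forall_notMem]
        rintro M ⟨h0, ht, -⟩
        exact ha ⟨h0, ht⟩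
      rw [this, measure_empty, zero_mul]
  rw [h2, ← h, prob_add_prob_compl hev]

/-- Averaging over the initial mark turns the indicator of `l < a` into `G (Set.Iio a)`. -/
theorem tail_equation (hQ : IsPoissonLaw Q (intensity f G)) (t : ℝ) :
    tail Q G t + ENNReal.ofReal f * ∫⁻ a in Set.Ioc 0 t,
        G (Set.Iio a) * vacancy Q a * tail Q G (t - a) = 1 := by
  have := hQ.prob
  have hind : Measurable fun p : ℝ × ℝ => (Set.Iio p.2).indicator (1 : ℝ → ℝ≥0∞) p.1 := by
    have : (fun p : ℝ × ℝ => (Set.Iio p.2).indicator (1 : ℝ → ℝ≥0∞) p.1) =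
        {p : ℝ × ℝ | p.1 < p.2}.indicator 1 := by
      ext p
      simp [Set.indicator_apply]
    rw [this]
    exact measurable_one.indicator (measurableSet_lt measurable_fst measurable_snd)
  have hmt : Measurable fun a => vacancy Q a * tail Q G (t - a) :=
    (measurable_vacancy Q).mul
      ((antitone_tail Q G).measurable.comp (measurable_const.sub measurable_id))
  have hjoint : Measurable fun p : ℝ × ℝ =>
      (Set.Iio p.2).indicator (1 : ℝ → ℝ≥0∞) p.1 * (vacancy Q p.2 * tail Q G (t - p.2)) :=
    hind.mul (hmt.comp measurable_snd)
  have h1 : ∫⁻ l, (Q {M | (started l M).upCount (Set.Ioc 0 t) = 0} +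
      ENNReal.ofReal f * ∫⁻ a in Set.Ioc 0 t,
        (Set.Iio a).indicator 1 l * (vacancy Q a * tail Q G (t - a))) ∂G = 1 := by
    rw [lintegral_congr fun l => hQ.started_equation l t]
    simp
  have htm : Measurable fun l => Q {M | (started l M).upCount (Set.Ioc 0 t) = 0} :=
    measurable_tail_mark Q t
  rw [lintegral_add_left htm,
    lintegral_const_mul _ hjoint.lintegral_prod_right',
    lintegral_lintegral_swap hjoint.aemeasurable] at h1
  rw [← h1]
  congr 2
  refine lintegral_congr fun a => ?_
  dsimp only
  rw [lintegral_mul_const _ (measurable_one.indicator measurableSet_Iio),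
    lintegral_indicator_one measurableSet_Iio, mul_assoc]

end IsPoissonLaw

open Config

/-! ### Estimates for the renewal equation -/

/-- The rate at which epochs occur at time `a` after an epoch at time `0`. -/
def epochRate (Q : Measure Config) (f : ℝ) (G : Measure ℝ) (a : ℝ) : ℝ :=
  f * ((G (Set.Iio a)).toReal * (vacancy Q a).toReal)

theorem epochRate_nonneg {Q : Measure Config} {f : ℝ} {G : Measure ℝ} (hf : 0 ≤ f) (a : ℝ) : 0 ≤ epochRate Q f G a := by
  unfold epochRate; positivity

theorem measurable_epochRate {Q : Measure Config} [IsProbabilityMeasure Q] {f : ℝ} {G : Measure ℝ} :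
    Measurable (epochRate Q f G) := by
  have h1 : Monotone fun a => G (Set.Iio a) := fun a b h => measure_mono (Set.Iio_subset_Iio h)
  exact measurable_const.mul (h1.measurable.ennreal_toReal.mul
    (measurable_vacancy Q).ennreal_toReal)

namespace IsPoissonLaw

variable {Q : Measure Config} {f : ℝ} {G : Measure ℝ} [IsProbabilityMeasure G]

theorem intensity_window_ne_top (f : ℝ) (G : Measure ℝ) [IsProbabilityMeasure G] (a : ℝ) :
    intensity f G {z | 0 < z.1 ∧ z.1 < a ∧ a ≤ z.1 + z.2} ≠ ∞ := by
  have h : intensity f G (Prod.fst ⁻¹' Set.Ioo 0 a) ≠ ∞ := by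
    rw [intensity_preimage_fst, Real.volume_Ioo]
    exact ENNReal.mul_ne_top ENNReal.ofReal_ne_top ENNReal.ofReal_ne_top
  exact ne_top_of_le_ne_top h (measure_mono fun z hz => ⟨hz.1, hz.2.1⟩)

theorem vacancy_eq_exp (hQ : IsPoissonLaw Q (intensity f G)) (a : ℝ) : vacancy Q a = ENNReal.ofReal
    (Real.exp (-(intensity f G {z | 0 < z.1 ∧ z.1 < a ∧ a ≤ z.1 + z.2}).toReal)) :=
  hQ.measure_void (measurableSet_window a 0) (intensity_window_ne_top f G a)

/-- An arrival with mark `l` is active at `a` if it starts in `[a - l, a)`. Once `a > d ≥ l` this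
interval lies in positive times for almost every mark, so the mean number of such arrivals is `f`
times the mean mark. -/
theorem vacancy_eq (hQ : IsPoissonLaw Q (intensity f G)) (hf : 0 ≤ f) {d ℓ a : ℝ}
    (hd : G (Set.Icc 0 d)ᶜ = 0) (hℓ0 : 0 ≤ ℓ)
    (hℓ : ∫⁻ l, ENNReal.ofReal l ∂G = ENNReal.ofReal ℓ) (ha : d < a) :
    vacancy Q a = ENNReal.ofReal (Real.exp (-(f * ℓ))) := by
  rw [hQ.vacancy_eq_exp, intensity, Measure.smul_apply,
    Measure.prod_apply_symm (measurableSet_window a 0), smul_eq_mul]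
  have : ∫⁻ l, volume ((fun x : ℝ => (x, l)) ⁻¹' {z : ℝ × ℝ | 0 < z.1 ∧ z.1 < a ∧ a ≤ z.1 + z.2}) ∂G =
      ∫⁻ l, ENNReal.ofReal l ∂G := by
    refine lintegral_congr_ae ?_
    have hd' : ∀ᵐ l ∂G, l ∈ Set.Icc 0 d := hd
    filter_upwards [hd'] with l hl
    have : ((fun x : ℝ => (x, l)) ⁻¹' {z : ℝ × ℝ | 0 < z.1 ∧ z.1 < a ∧ a ≤ z.1 + z.2}) =
        Set.Ico (a - l) a := by
      ext x
      simp only [Set.mem_preimage, Set.mem_ofPred_eq, Set.mem_Ico]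
      constructor
      · rintro ⟨-, h2, h3⟩
        exact ⟨by linarith, h2⟩
      · rintro ⟨h1, h2⟩
        exact ⟨by linarith [hl.2], h2, by linarith⟩
    rw [this, Real.volume_Ico, sub_sub_cancel]
  rw [this, hℓ, ENNReal.toReal_mul, ENNReal.toReal_ofReal hf, ENNReal.toReal_ofReal hℓ0]

/-- Marks below `a/2` have probability at most `1/4`. Arrivals in `(a/2, a)` with mark at least
`a/2` are active at `a`, and their mean number is at least `f · a/2 · 3/4`. -/
theorem vacancy_le (hQ : IsPoissonLaw Q (intensity f G)) (hf : 0 ≤ f) {d a : ℝ}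
    (hG : ∀ b, 0 < b → b ≤ d → G (Set.Iio b) ≤ ENNReal.ofReal ((b / d) ^ 2)) (ha : 0 < a)
    (had : a ≤ d) : vacancy Q a ≤ ENNReal.ofReal (Real.exp (-(3 / 8 * f * a))) := by
  rw [hQ.vacancy_eq_exp]
  refine ENNReal.ofReal_le_ofReal (Real.exp_le_exp.2 (neg_le_neg ?_))
  have hd : 0 < d := ha.trans_le had
  have h1 : ENNReal.ofReal (3 / 4) ≤ G (Set.Ici (a / 2)) := by
    have h2 : G (Set.Iio (a / 2)) ≤ ENNReal.ofReal (1 / 4) := by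
      refine (hG (a / 2) (by linarith) (by linarith)).trans (ENNReal.ofReal_le_ofReal ?_)
      have h3 : a / 2 / d ≤ 1 / 2 := by
        rw [div_le_iff₀ hd]
        linarith
      have h4 : 0 ≤ a / 2 / d := by positivity
      nlinarith
    have h3 : G (Set.Ici (a / 2)) = 1 - G (Set.Iio (a / 2)) := by
      rw [← prob_compl_eq_one_sub measurableSet_Iio, Set.compl_Iio]
    rw [h3]
    refine le_trans ?_ (tsub_le_tsub_left h2 1)
    rw [← ENNReal.ofReal_one, ← ENNReal.ofReal_sub _ (by norm_num)]
    norm_num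
  have h2 : ENNReal.ofReal (3 / 8 * f * a) ≤
      intensity f G {z | 0 < z.1 ∧ z.1 < a ∧ a ≤ z.1 + z.2} := by
    have h3 : intensity f G (Set.Ioo (a / 2) a ×ˢ Set.Ici (a / 2)) ≤
        intensity f G {z | 0 < z.1 ∧ z.1 < a ∧ a ≤ z.1 + z.2} := by
      refine measure_mono ?_
      rintro z ⟨⟨h1, h2⟩, h3⟩
      have h3 : a / 2 ≤ z.2 := h3
      exact ⟨by linarith, h2, by linarith⟩
    refine le_trans ?_ h3
    rw [intensity, Measure.smul_apply, Measure.prod_prod, Real.volume_Ioo, smul_eq_mul]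
    calc ENNReal.ofReal (3 / 8 * f * a)
        = ENNReal.ofReal f * (ENNReal.ofReal (a - a / 2) * ENNReal.ofReal (3 / 4)) := by
          rw [← ENNReal.ofReal_mul (by linarith), ← ENNReal.ofReal_mul hf]
          congr 1
          ring
      _ ≤ _ := by gcongr
  exact (ENNReal.ofReal_le_iff_le_toReal (intensity_window_ne_top f G a)).1 h2

theorem epochRate_le [IsProbabilityMeasure Q] (hf : 0 ≤ f) (a : ℝ) : epochRate Q f G a ≤ f := by
  have h1 : (G (Set.Iio a)).toReal ≤ 1 := measureReal_le_one
  have h2 : (vacancy Q a).toReal ≤ 1 := measureReal_le_one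
  exact mul_le_of_le_one_right hf (mul_le_one₀ h1 ENNReal.toReal_nonneg h2)

theorem epochRate_eq (hQ : IsPoissonLaw Q (intensity f G)) (hf : 0 ≤ f) {d ℓ a : ℝ}
    (hd : G (Set.Icc 0 d)ᶜ = 0) (hℓ0 : 0 ≤ ℓ)
    (hℓ : ∫⁻ l, ENNReal.ofReal l ∂G = ENNReal.ofReal ℓ) (ha : d < a) :
    epochRate Q f G a = f * Real.exp (-(f * ℓ)) := by
  have h1 : G (Set.Iio a) = 1 := by
    rw [prob_compl_eq_zero_iff measurableSet_Icc] at hd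
    exact le_antisymm prob_le_one (hd ▸ measure_mono fun x hx => hx.2.trans_lt ha)
  rw [epochRate, h1, hQ.vacancy_eq hf hd hℓ0 hℓ ha, ENNReal.toReal_ofReal (Real.exp_pos _).le]
  simp

/-- The quadratic factor `(a/d)²` is absorbed by the exponential. With `x = 3fa/8` one has `x²
exp(-x) ≤ 2`, and the constant is `2 · 64/9 < 15`. -/
theorem epochRate_le_div (hQ : IsPoissonLaw Q (intensity f G)) (hf : 0 < f) {d a : ℝ}
    (hG : ∀ b, 0 < b → b ≤ d → G (Set.Iio b) ≤ ENNReal.ofReal ((b / d) ^ 2)) (ha : 0 < a)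
    (had : a ≤ d) : epochRate Q f G a ≤ 15 / (f * d ^ 2) := by
  have hd : 0 < d := ha.trans_le had
  have h1 : (G (Set.Iio a)).toReal ≤ (a / d) ^ 2 :=
    ENNReal.toReal_le_of_le_ofReal (by positivity) (hG a ha had)
  have h2 : (vacancy Q a).toReal ≤ Real.exp (-(3 / 8 * f * a)) :=
    ENNReal.toReal_le_of_le_ofReal (by positivity) (hQ.vacancy_le hf.le hG ha had)
  have h3 : (3 / 8 * f * a) ^ 2 * Real.exp (-(3 / 8 * f * a)) ≤ 2 := by
    have h4 : (3 / 8 * f * a) ^ 2 / 2 ≤ Real.exp (3 / 8 * f * a) := by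
      simpa using Real.pow_div_factorial_le_exp (3 / 8 * f * a) (by positivity) 2
    rw [Real.exp_neg, ← div_eq_mul_inv, div_le_iff₀ (Real.exp_pos _)]
    linarith
  calc epochRate Q f G a ≤ f * ((a / d) ^ 2 * Real.exp (-(3 / 8 * f * a))) := by
        unfold epochRate
        gcongr
    _ = (64 / 9) * ((3 / 8 * f * a) ^ 2 * Real.exp (-(3 / 8 * f * a))) / (f * d ^ 2) := by
        field_simp
        ring
    _ ≤ 15 / (f * d ^ 2) := by
        gcongr
        linarith

theorem tail_toReal_le_one [IsProbabilityMeasure Q] (t : ℝ) :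
    (tail Q G t).toReal ≤ 1 :=
  ENNReal.toReal_le_of_le_ofReal zero_le_one (by simpa using tail_le_one Q G t)

theorem antitone_tail_toReal [IsProbabilityMeasure Q] :
    Antitone fun t => (tail Q G t).toReal := fun s _ h =>
  ENNReal.toReal_mono (ne_top_of_le_ne_top ENNReal.one_ne_top (tail_le_one Q G s))
    (antitone_tail Q G h)

theorem tail_equation_toReal (hQ : IsPoissonLaw Q (intensity f G)) (hf : 0 ≤ f) (t : ℝ) :
    (tail Q G t).toReal +
      ∫ a in Set.Ioc 0 t, epochRate Q f G a * (tail Q G (t - a)).toReal = 1 := by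
  have := hQ.prob
  have h := hQ.tail_equation t
  have hfin : ∀ s, tail Q G s ≠ ∞ := fun s =>
    ne_top_of_le_ne_top ENNReal.one_ne_top (tail_le_one Q G s)
  have hne : ENNReal.ofReal f * ∫⁻ a in Set.Ioc 0 t,
      G (Set.Iio a) * vacancy Q a * tail Q G (t - a) ≠ ∞ :=
    ne_top_of_le_ne_top ENNReal.one_ne_top (h ▸ le_add_self)
  have h' := congrArg ENNReal.toReal h
  rw [ENNReal.toReal_add (hfin t) hne, ENNReal.toReal_one] at h'
  rw [← h']
  congr 1
  rw [ENNReal.toReal_mul, ENNReal.toReal_ofReal hf,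
    ← integral_toReal]
  · rw [← integral_const_mul]
    refine integral_congr_ae (Eventually.of_forall fun a => ?_)
    simp only [epochRate, ENNReal.toReal_mul]
    ring
  · have h1 : Monotone fun a => G (Set.Iio a) := fun a b h => measure_mono (Set.Iio_subset_Iio h)
    exact ((h1.measurable.mul (measurable_vacancy Q)).mul
      ((antitone_tail Q G).measurable.comp (measurable_const.sub measurable_id))).aemeasurable
  · refine Eventually.of_forall fun a => ?_
    exact (ENNReal.mul_ne_top (ENNReal.mul_ne_top (measure_ne_top _ _) (measure_ne_top _ _))
      (hfin _)).lt_top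

/-- Replace the rate in the renewal equation by its eventual constant value. The two agree beyond
`d`; on `(0, d]` they differ by at most `f * exp(-(f * ℓ)) + B`, and `tail` is at most `1`. -/
theorem abs_tail_add_integral_sub_one_le (hQ : IsPoissonLaw Q (intensity f G)) (hf : 0 ≤ f)
    {d ℓ B : ℝ} (hd0 : 0 ≤ d) (hd : G (Set.Icc 0 d)ᶜ = 0) (hℓ0 : 0 ≤ ℓ)
    (hℓ : ∫⁻ l, ENNReal.ofReal l ∂G = ENNReal.ofReal ℓ)
    (hB : ∀ a, 0 < a → a ≤ d → epochRate Q f G a ≤ B) (hB0 : 0 ≤ B) {t : ℝ} (ht : 0 ≤ t) :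
    |(tail Q G t).toReal + f * Real.exp (-(f * ℓ)) * (∫ a in (0 : ℝ)..t, (tail Q G a).toReal) - 1| ≤
      (f * Real.exp (-(f * ℓ)) + B) * d := by
  have := hQ.prob
  set g := f * Real.exp (-(f * ℓ)) with hg
  have hg0 : 0 ≤ g := by positivity
  have hbase := hQ.tail_equation_toReal hf t
  have hmeas : Measurable fun a => (tail Q G (t - a)).toReal :=
    antitone_tail_toReal.measurable.comp (measurable_const.sub measurable_id)
  have hbdd : ∀ a, ‖(tail Q G (t - a)).toReal‖ ≤ 1 := fun a => by
    rw [Real.norm_of_nonneg ENNReal.toReal_nonneg]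
    exact tail_toReal_le_one _
  have hint1 : IntegrableOn (fun a => epochRate Q f G a * (tail Q G (t - a)).toReal)
      (Set.Ioc 0 t) := by
    refine Measure.integrableOn_of_bounded (M := f) (by simp)
      (measurable_epochRate.mul hmeas).aestronglyMeasurable (Eventually.of_forall fun a => ?_)
    rw [norm_mul, Real.norm_of_nonneg (epochRate_nonneg hf a)]
    exact (mul_le_of_le_one_right (epochRate_nonneg hf a) (hbdd a)).trans (epochRate_le hf a)
  have hint2 : IntegrableOn (fun a => g * (tail Q G (t - a)).toReal) (Set.Ioc 0 t) := by
    refine Measure.integrableOn_of_bounded (M := g) (by simp)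
      (measurable_const.mul hmeas).aestronglyMeasurable (Eventually.of_forall fun a => ?_)
    rw [norm_mul, Real.norm_of_nonneg hg0]
    exact mul_le_of_le_one_right hg0 (hbdd a)
  have hI : g * (∫ a in (0 : ℝ)..t, (tail Q G a).toReal) =
      ∫ a in Set.Ioc 0 t, g * (tail Q G (t - a)).toReal := by
    rw [integral_const_mul, ← intervalIntegral.integral_of_le ht]
    congr 1
    have := intervalIntegral.integral_comp_sub_left (fun a => (tail Q G a).toReal) (a := 0)
      (b := t) t
    rw [this]
    simp
  have hdiff : (tail Q G t).toReal + g * (∫ a in (0 : ℝ)..t, (tail Q G a).toReal) - 1 =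
      ∫ a in Set.Ioc 0 t, (g * (tail Q G (t - a)).toReal -
        epochRate Q f G a * (tail Q G (t - a)).toReal) := by
    rw [integral_sub hint2 hint1, hI]
    linarith
  rw [hdiff, ← Real.norm_eq_abs]
  have hgB : 0 ≤ g + B := by positivity
  calc ‖∫ a in Set.Ioc 0 t, (g * (tail Q G (t - a)).toReal -
        epochRate Q f G a * (tail Q G (t - a)).toReal)‖
      ≤ ∫ a in Set.Ioc 0 t, (Set.Ioc 0 d).indicator (fun _ => g + B) a := by
        refine norm_integral_le_of_norm_le
          ((integrable_indicator_iff measurableSet_Ioc).2 ?_) ?_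
        · exact integrableOn_const (by
            exact ne_top_of_le_ne_top measure_Ioc_lt_top.ne (Measure.restrict_apply_le _ _))
        · rw [ae_restrict_iff' measurableSet_Ioc]
          refine Eventually.of_forall fun a ha => ?_
          rw [← sub_mul, norm_mul]
          by_cases had : a ≤ d
          · rw [Set.indicator_of_mem (show a ∈ Set.Ioc 0 d from ⟨ha.1, had⟩)]
            have h1 : ‖g - epochRate Q f G a‖ ≤ g + B := by
              rw [Real.norm_eq_abs, abs_le]
              have := hB a ha.1 had
              have := epochRate_nonneg (Q := Q) (G := G) hf a
              constructor <;> linarith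
            exact (mul_le_of_le_one_right (norm_nonneg _) (hbdd a)).trans h1
          · rw [hQ.epochRate_eq hf hd hℓ0 hℓ (not_le.1 had), Set.indicator_of_notMem
              (fun h => had h.2)]
            simp [hg]
    _ ≤ (g + B) * d := by
        rw [integral_indicator measurableSet_Ioc, Measure.restrict_restrict measurableSet_Ioc,
          setIntegral_const, smul_eq_mul, mul_comm]
        have h1 : volume.real (Set.Ioc 0 d ∩ Set.Ioc 0 t) ≤ volume.real (Set.Ioc 0 d) :=
          measureReal_mono Set.inter_subset_left measure_Ioc_lt_top.ne
        have h2 : volume.real (Set.Ioc 0 d) = d := by simp [Measure.real, hd0]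
        rw [h2] at h1
        gcongr

end IsPoissonLaw

open Config

/-! ### Convergence to the exponential law -/

/-- A Grönwall estimate for the perturbed exponential decay equation. -/
theorem abs_sub_exp_le {F : ℝ → ℝ} {g e : ℝ} (hg : 0 < g) (hF : Antitone F)
    (hFr : ∀ t, ContinuousWithinAt F (Set.Ici t) t)
    (h : ∀ t, 0 ≤ t → |F t + g * (∫ a in (0 : ℝ)..t, F a) - 1| ≤ e) {t : ℝ} (ht : 0 ≤ t) :
    |F t - Real.exp (-(g * t))| ≤ e * Real.exp (g * t) := by
  set D : ℝ → ℝ := fun s => F s - Real.exp (-(g * s)) with hD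
  have hexpc : Continuous fun s : ℝ => Real.exp (-(g * s)) := by fun_prop
  have hFint : ∀ a b, IntervalIntegrable F volume a b := fun a b => hF.intervalIntegrable
  have hDint : ∀ a b, IntervalIntegrable D volume a b := fun a b =>
    (hFint a b).sub (hexpc.intervalIntegrable a b)
  have hDr : ∀ s, ContinuousWithinAt D (Set.Ici s) s := fun s =>
    (hFr s).sub hexpc.continuousWithinAt
  have hexp : ∀ s, g * (∫ a in (0 : ℝ)..s, Real.exp (-(g * a))) = 1 - Real.exp (-(g * s)) := by
    intro s
    have hderiv : ∀ a ∈ Set.uIcc 0 s,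
        HasDerivAt (fun a => -Real.exp (-(g * a))) (g * Real.exp (-(g * a))) a :=
      fun a _ => hasDerivAt_neg_exp_mul_exp
    rw [← intervalIntegral.integral_const_mul,
      intervalIntegral.integral_eq_sub_of_hasDerivAt hderiv
        ((continuous_const.mul hexpc).intervalIntegrable _ _), mul_zero, neg_zero, Real.exp_zero]
    ring
  -- The exponential solves the unperturbed equation exactly, so only the error `e` survives in the
  -- difference.
  have hkey : ∀ s, 0 ≤ s → |D s| ≤ g * |∫ a in (0 : ℝ)..s, D a| + e := by
    intro s hs
    have h1 : ∫ a in (0 : ℝ)..s, D a =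
        (∫ a in (0 : ℝ)..s, F a) - ∫ a in (0 : ℝ)..s, Real.exp (-(g * a)) :=
      intervalIntegral.integral_sub (hFint 0 s) (hexpc.intervalIntegrable 0 s)
    have h2 : D s = (F s + g * (∫ a in (0 : ℝ)..s, F a) - 1) - g * ∫ a in (0 : ℝ)..s, D a := by
      rw [h1, mul_sub, hexp]
      simp only [hD]
      ring
    rw [h2]
    refine (abs_sub _ _).trans ?_
    rw [abs_mul, abs_of_pos hg]
    linarith [h s hs]
  -- Grönwall is applied to the primitive of `D`: `F` is only right-continuous, which is enough for
  -- a right derivative of the primitive.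
  have hgr := norm_le_gronwallBound_of_norm_deriv_right_le (f := fun s => ∫ a in (0 : ℝ)..s, D a)
    (f' := D) (δ := 0) (K := g) (ε := e) (a := 0) (b := t)
    (intervalIntegral.continuous_primitive hDint 0).continuousOn
    (fun s _ => intervalIntegral.integral_hasDerivWithinAt_right (t := Set.Ioi s)
      (hDint 0 s) (hF.measurable.sub hexpc.measurable).stronglyMeasurable.stronglyMeasurableAtFilter
      ((hDr s).mono Set.Ioi_subset_Ici_self))
    (by simp) (fun s hs => hkey s hs.1) t ⟨ht, le_rfl⟩
  simp only [gronwallBound_of_K_ne_0 hg.ne', sub_zero, zero_mul, zero_add, Real.norm_eq_abs] at hgr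
  refine (hkey t ht).trans ?_
  calc g * |∫ a in (0 : ℝ)..t, D a| + e ≤ g * (e / g * (Real.exp (g * t) - 1)) + e := by gcongr
    _ = e * Real.exp (g * t) := by
      field_simp
      ring

/-- At time `x / c` the exponent `g t` converges to `x`, so the factor `exp(g t)` stays bounded and
`e → 0` removes the error. -/
theorem tendsto_tail_div {ι : Type*} {l : Filter ι} {F : ι → ℝ → ℝ} {g c e : ι → ℝ}
    (h : ∀ᶠ i in l, 0 < c i ∧
      ∀ t, 0 ≤ t → |F i t - Real.exp (-(g i * t))| ≤ e i * Real.exp (g i * t))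
    (hgc : Tendsto (fun i => g i / c i) l (𝓝 1)) (he : Tendsto e l (𝓝 0)) {x : ℝ} (hx : 0 ≤ x) :
    Tendsto (fun i => F i (x / c i)) l (𝓝 (Real.exp (-x))) := by
  have h1 : Tendsto (fun i => g i * (x / c i)) l (𝓝 x) := by
    have := hgc.mul_const x
    rw [one_mul] at this
    exact this.congr fun i => by ring
  have h2 : Tendsto (fun i => Real.exp (-(g i * (x / c i)))) l (𝓝 (Real.exp (-x))) :=
    (Real.continuous_exp.tendsto _).comp h1.neg
  have h3 : Tendsto (fun i => e i * Real.exp (g i * (x / c i))) l (𝓝 0) := by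
    have := he.mul ((Real.continuous_exp.tendsto _).comp h1)
    rwa [zero_mul] at this
  have h4 : Tendsto (fun i => F i (x / c i) - Real.exp (-(g i * (x / c i)))) l (𝓝 0) := by
    refine squeeze_zero_norm' ?_ h3
    filter_upwards [h] with i hi
    exact hi.2 _ (div_nonneg hx hi.1.le)
  have := h4.add h2
  rw [zero_add] at this
  exact this.congr fun i => by ring

theorem expMeasure_one_real_Ioi (x : ℝ) :
    (expMeasure 1).real (Set.Ioi x) = if 0 ≤ x then Real.exp (-x) else 1 := by
  rw [← Set.compl_Iic, probReal_compl_eq_one_sub measurableSet_Iic, ← cdf_eq_real,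
    cdf_expMeasure_eq one_pos]
  split_ifs <;> simp

/-- Half-open intervals form a π-system that contains small neighbourhoods of every point, so
convergence of their masses gives weak convergence. These masses are differences of tails, and at
negative levels the tail is eventually `1`. -/
theorem tendstoInDistribution_exp {Ω ι : Type*} [MeasurableSpace Ω] {P : Measure Ω}
    [IsProbabilityMeasure P] {l : Filter ι} [l.IsCountablyGenerated] {X : ι → Ω → ℝ}
    (hX : ∀ i, AEMeasurable (X i) P) (hpos : ∀ᶠ i in l, ∀ᵐ ω ∂P, 0 ≤ X i ω)
    (h : ∀ x, 0 ≤ x → Tendsto (fun i => P.real {ω | x < X i ω}) l (𝓝 (Real.exp (-x)))) :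
    TendstoInDistribution X l id (fun _ => P) (expMeasure 1) := by
  have hIoi : ∀ x, Tendsto (fun i => (P.map (X i)).real (Set.Ioi x)) l
      (𝓝 ((expMeasure 1).real (Set.Ioi x))) := by
    intro x
    have hm : ∀ i, (P.map (X i)).real (Set.Ioi x) = P.real {ω | x < X i ω} := fun i =>
      map_measureReal_apply_of_aemeasurable (hX i) measurableSet_Ioi
    simp only [hm]
    rw [expMeasure_one_real_Ioi]
    split_ifs with hx
    · exact h x hx
    · refine tendsto_const_nhds.congr' ?_
      filter_upwards [hpos] with i hi
      have : {ω | x < X i ω} =ᵐ[P] Set.univ := by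
        filter_upwards [hi] with ω hω
        exact propext ⟨fun _ => trivial, fun _ => (not_le.1 hx).trans_le hω⟩
      rw [measureReal_congr this, probReal_univ]
  refine ⟨hX, aemeasurable_id, ?_⟩
  refine (isPiSystem_Ioc (id : ℝ → ℝ) id).tendsto_probabilityMeasure_of_tendsto_of_mem ?_ ?_ ?_
  · rintro _ ⟨a, b, -, rfl⟩
    exact measurableSet_Ioc
  · intro u hu x hx
    obtain ⟨a, b, hab, hsub⟩ := mem_nhds_iff_exists_Ioo_subset.1 (hu.mem_nhds hx)
    obtain ⟨b', hb1, hb2⟩ := exists_between hab.2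
    exact ⟨Set.Ioc a b', ⟨a, b', hab.1.trans hb1, rfl⟩, Ioc_mem_nhds hab.1 hb1,
      fun y hy => hsub ⟨hy.1, hy.2.trans_lt hb2⟩⟩
  · rintro _ ⟨a, b, hab, rfl⟩
    rw [← NNReal.tendsto_coe]
    have hab : a ≤ b := hab.le
    have hsplit : ∀ (μ : Measure ℝ) [IsProbabilityMeasure μ],
        μ.real (Set.Ioc a b) = μ.real (Set.Ioi a) - μ.real (Set.Ioi b) := by
      intro μ _
      rw [← measureReal_sdiff (Set.Ioi_subset_Ioi hab) measurableSet_Ioi]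
      congr 1
      ext y
      simp
    have := fun i => Measure.isProbabilityMeasure_map (hX i)
    have hlim := (hIoi a).sub (hIoi b)
    rw [← hsplit (expMeasure 1)] at hlim
    have heq : ∀ i, (P.map (X i)).real (Set.Ioi a) - (P.map (X i)).real (Set.Ioi b) =
      (P.map (X i)).real (Set.Ioc a b) := fun i => (hsplit (P.map (X i))).symm
    simp only [heq] at hlim
    simp only [id] at *
    convert hlim using 2
    · rfl
    · change ((expMeasure 1).map id).real _ = _
      rw [Measure.map_id]

namespace IsPoissonLaw

variable {Q : Measure Config} {f : ℝ} {G : Measure ℝ} [IsProbabilityMeasure G]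

theorem abs_tail_sub_exp_le (hQ : IsPoissonLaw Q (intensity f G)) (hf : 0 < f)
    {d ℓ B : ℝ} (hd0 : 0 ≤ d) (hd : G (Set.Icc 0 d)ᶜ = 0) (hℓ0 : 0 ≤ ℓ)
    (hℓ : ∫⁻ l, ENNReal.ofReal l ∂G = ENNReal.ofReal ℓ)
    (hB : ∀ a, 0 < a → a ≤ d → epochRate Q f G a ≤ B) (hB0 : 0 ≤ B) {t : ℝ} (ht : 0 ≤ t) :
    |(tail Q G t).toReal - Real.exp (-(f * Real.exp (-(f * ℓ)) * t))| ≤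
      (f * Real.exp (-(f * ℓ)) + B) * d * Real.exp (f * Real.exp (-(f * ℓ)) * t) := by
  have := hQ.prob
  refine abs_sub_exp_le (F := fun t => (tail Q G t).toReal) (by positivity) antitone_tail_toReal
    (fun t => ?_)
    (fun t ht => hQ.abs_tail_add_integral_sub_one_le hf.le hd0 hd hℓ0 hℓ hB hB0 ht) ht
  have hprob := Measure.isProbabilityMeasure_map (μ := Q) (measurable_upGap 0).aemeasurable
  -- Right continuity of `tail` comes from its identification with the survival function of the
  -- first gap.
  have h1 : (fun t => (tail Q G t).toReal) = fun t => 1 - cdf (Q.map (upGap 0)) t := by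
    ext t
    rw [cdf_eq_real, ← probReal_compl_eq_one_sub measurableSet_Iic, Set.compl_Iic,
      map_measureReal_apply (measurable_upGap 0) measurableSet_Ioi,
      ← hQ.measure_lt_upGap (hQ.ae_infinite_upTimes hf hd0 hd) 0 t]
    rfl
  rw [h1]
  exact continuousWithinAt_const.sub ((cdf (Q.map (upGap 0))).right_continuous t)

end IsPoissonLaw

/-! ### Coverage of the moving user -/

theorem coverageRadius_pos {p w β γ : ℝ} (hp : 0 < p) (hw : 0 < w) (hγ : 0 < γ) :
    0 < coverageRadius p w β γ := Real.rpow_pos_of_pos (by positivity) _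

theorem le_snr_iff {p w β γ : ℝ} (hp : 0 < p) (hw : 0 < w) (hβ : 0 < β) (hγ : 0 < γ)
    (S : Set Plane) (v : ℝ) (u : Plane) (t : ℝ) : ENNReal.ofReal γ ≤ snr p w β S v u t ↔
      nodeDistance S v u t ≤ ENNReal.ofReal (coverageRadius p w β γ) := by
  rw [snr, coverageRadius]
  set L := nodeDistance S v u t
  have hw0 : ENNReal.ofReal w ≠ 0 := by simpa using hw
  have hp0 : ENNReal.ofReal p ≠ 0 := by simpa using hp
  have hwγ : ENNReal.ofReal (w * γ) ≠ 0 := by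
    simpa using mul_pos hw hγ
  have h1 : ENNReal.ofReal ((p / (w * γ)) ^ (1 / β)) =
      (ENNReal.ofReal p / ENNReal.ofReal (w * γ)) ^ (1 / β) := by
    rw [← ENNReal.ofReal_rpow_of_pos (by positivity), ENNReal.ofReal_div_of_pos (by positivity)]
  rw [h1, one_div, ENNReal.le_rpow_inv_iff hβ, ENNReal.le_div_iff_mul_le (.inl hw0)
    (.inl ENNReal.ofReal_ne_top), ENNReal.le_div_iff_mul_le (.inl hwγ)
    (.inl ENNReal.ofReal_ne_top), ← ENNReal.ofReal_mul hγ.le, mul_comm γ w, ENNReal.rpow_neg,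
    ← div_eq_mul_inv]
  generalize L ^ β = x
  -- The degenerate cases are a user located at a node or in its closure (`x = 0`) and the absence
  -- of nodes (`x = ∞`).
  rcases eq_or_ne x 0 with rfl | hx0
  · simp [ENNReal.div_zero hp0]
  rcases eq_or_ne x ∞ with rfl | hxt
  · simp only [ENNReal.div_top, nonpos_iff_eq_zero, hwγ, false_iff, not_le]
    rw [ENNReal.top_mul hwγ]
    exact ENNReal.ofReal_lt_top
  rw [ENNReal.le_div_iff_mul_le (.inl hx0) (.inl hxt), mul_comm]

/-- Local finiteness makes the infimum attained; without it a closed bound on the distance would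
give no node within `r`. -/
theorem infEDist_le_iff {S : Set Plane} (hS : ∀ R : ℝ, (S ∩ Metric.closedBall 0 R).Finite)
    (x : Plane) {r : ℝ} (hr : 0 ≤ r) :
    Metric.infEDist x S ≤ ENNReal.ofReal r ↔ ∃ z ∈ S, dist x z ≤ r := by
  constructor
  · intro h
    by_contra! hfar
    -- The margin `1` leaves room for near-minimisers at distance strictly above `r`; the finite set
    -- `K` contains them all.
    set K := S ∩ Metric.closedBall 0 (‖x‖ + (r + 1)) with hK
    have hmem : ∀ z ∈ S, edist x z < ENNReal.ofReal (r + 1) → z ∈ K := by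
      intro z hz hxz
      rw [edist_dist, ENNReal.ofReal_lt_ofReal_iff (by linarith)] at hxz
      refine ⟨hz, ?_⟩
      rw [mem_closedBall_zero_iff]
      have h1 : ‖z‖ ≤ ‖x‖ + dist z x := norm_le_norm_add_norm_sub' z x |>.trans_eq (by
        rw [dist_eq_norm])
      rw [dist_comm] at h1
      linarith
    have hlt : ENNReal.ofReal r < ENNReal.ofReal (r + 1) :=
      (ENNReal.ofReal_lt_ofReal_iff (by linarith)).2 (by linarith)
    obtain ⟨z, hz, hxz⟩ := Metric.infEDist_lt_iff.1 (h.trans_lt hlt)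
    obtain ⟨z₀, hz₀, hmin⟩ :=
      Set.exists_min_image K (fun z => edist x z) (hS _) ⟨z, hmem z hz hxz⟩
    have h2 : ENNReal.ofReal r < min (edist x z₀) (ENNReal.ofReal (r + 1)) := by
      refine lt_min ?_ hlt
      rw [edist_dist, ENNReal.ofReal_lt_ofReal_iff (hr.trans_lt (hfar z₀ hz₀.1))]
      exact hfar z₀ hz₀.1
    obtain ⟨y, hy, hxy⟩ := Metric.infEDist_lt_iff.1 (h.trans_lt h2)
    exact absurd (hmin y (hmem y hy (hxy.trans_le (min_le_right _ _))))
      (not_le.2 (hxy.trans_le (min_le_left _ _)))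
  · rintro ⟨z, hz, h⟩
    refine (Metric.infEDist_le_edist_of_mem hz).trans ?_
    rw [edist_dist]
    exact ENNReal.ofReal_le_ofReal h

/-! ### The passage of a node through the covered disc -/

/-- The time at which a node comes within distance `r` of a user who moves with speed `v` along the
first vector of the basis `b`, and the time during which it stays there. -/
def chord (b : OrthonormalBasis (Fin 2) ℝ Plane) (r v : ℝ) (z : Plane) : ℝ × ℝ :=
  ((b.repr z 0 - √(r ^ 2 - b.repr z 1 ^ 2)) / v, 2 * √(r ^ 2 - b.repr z 1 ^ 2) / v)

/-- The nodes within distance `r` of the line along the first vector of the basis `b`. -/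
def nearLine (b : OrthonormalBasis (Fin 2) ℝ Plane) (r : ℝ) : Set Plane :=
  {z | b.repr z 1 ∈ Set.Icc (-r) r}

variable {b : OrthonormalBasis (Fin 2) ℝ Plane} {r v : ℝ}

theorem norm_sq_eq_repr (b : OrthonormalBasis (Fin 2) ℝ Plane) (z : Plane) :
    ‖z‖ ^ 2 = b.repr z 0 ^ 2 + b.repr z 1 ^ 2 := by
  rw [← b.repr.norm_map, EuclideanSpace.norm_sq_eq]
  simp

/-- Pythagoras in the basis `b`. The condition `nearLine` must be stated separately, because for
`|y| > r` the real square root is `0` and `chord` would describe a spurious passage. -/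
theorem dist_userPosition_le_iff (hr : 0 ≤ r) (hv : 0 < v) (z : Plane) (t : ℝ) :
    dist (userPosition v (b 0) t) z ≤ r ↔
      z ∈ nearLine b r ∧ (chord b r v z).1 ≤ t ∧ t ≤ (chord b r v z).1 + (chord b r v z).2 := by
  have hrep : ‖z - userPosition v (b 0) t‖ ^ 2 =
      (b.repr z 0 - v * t) ^ 2 + b.repr z 1 ^ 2 := by
    rw [norm_sq_eq_repr b, userPosition]
    simp
  rw [dist_comm, dist_eq_norm, ← sq_le_sq₀ (norm_nonneg _) hr, hrep]
  set x := b.repr z 0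
  set y := b.repr z 1 with hy
  have h1 : (chord b r v z).1 ≤ t ∧ t ≤ (chord b r v z).1 + (chord b r v z).2 ↔
      |x - v * t| ≤ √(r ^ 2 - y ^ 2) := by
    simp only [chord]
    rw [← add_div, div_le_iff₀ hv, le_div_iff₀ hv, abs_le]
    constructor <;> rintro ⟨h1, h2⟩ <;> constructor <;> linarith
  have h2 : z ∈ nearLine b r ↔ y ^ 2 ≤ r ^ 2 := by
    rw [sq_le_sq, abs_of_nonneg hr, abs_le]
    rfl
  rw [h1, h2]
  constructor
  · intro h
    refine ⟨by linarith [sq_nonneg (x - v * t)], Real.abs_le_sqrt (by linarith)⟩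
  · rintro ⟨h3, h4⟩
    have := (Real.le_sqrt (abs_nonneg _) (by linarith)).1 h4
    rw [sq_abs] at this
    linarith

theorem chord_snd_mem (hr : 0 ≤ r) (hv : 0 < v) (z : Plane) :
    (chord b r v z).2 ∈ Set.Icc 0 (2 * r / v) := by
  have h : √(r ^ 2 - b.repr z 1 ^ 2) ≤ r :=
    Real.sqrt_le_iff.2 ⟨hr, by linarith [sq_nonneg (b.repr z 1)]⟩
  refine ⟨by unfold chord; positivity, ?_⟩
  simp only [chord]
  gcongr

theorem finite_chord (hr : 0 ≤ r) (hv : 0 < v) {S : Set Plane}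
    (hS : ∀ R : ℝ, (S ∩ Metric.closedBall 0 R).Finite) (R : ℝ) :
    {i : ↥(S ∩ nearLine b r) | |(chord b r v i).1| ≤ R}.Finite := by
  refine Set.Finite.of_finite_image (f := Subtype.val) ?_ Subtype.val_injective.injOn
  -- A passage that starts within `[-R, R]` has first coordinate at most `v R + r` and second
  -- coordinate at most `r` in absolute value.
  refine (hS (v * R + 2 * r)).subset ?_
  rintro _ ⟨⟨z, hz, hzl⟩, hi, rfl⟩
  refine ⟨hz, ?_⟩
  rw [mem_closedBall_zero_iff]
  have hi : |(b.repr z 0 - √(r ^ 2 - b.repr z 1 ^ 2)) / v| ≤ R := hi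
  rw [abs_div, abs_of_pos hv, div_le_iff₀ hv, abs_le] at hi
  have h0 := Real.sqrt_nonneg (r ^ 2 - b.repr z 1 ^ 2)
  have h1 : √(r ^ 2 - b.repr z 1 ^ 2) ≤ r :=
    Real.sqrt_le_iff.2 ⟨hr, by linarith [sq_nonneg (b.repr z 1)]⟩
  have h2 : |b.repr z 0| ≤ v * R + r := abs_le.2 ⟨by linarith, by linarith⟩
  have h3 : |b.repr z 1| ≤ r := abs_le.2 hzl
  have h4 : ‖z‖ ^ 2 ≤ (|b.repr z 0| + |b.repr z 1|) ^ 2 := by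
    rw [norm_sq_eq_repr b, ← sq_abs (b.repr z 0), ← sq_abs (b.repr z 1)]
    nlinarith [mul_nonneg (abs_nonneg (b.repr z 0)) (abs_nonneg (b.repr z 1))]
  have h5 := abs_le_of_sq_le_sq h4 (by positivity)
  rw [abs_of_nonneg (norm_nonneg z)] at h5
  linarith

/-- The passages of the nodes in `S`, as a configuration of marked times. -/
def passages (b : OrthonormalBasis (Fin 2) ℝ Plane) (hr : 0 ≤ r) (hv : 0 < v) {S : Set Plane}
    (hS : ∀ R : ℝ, (S ∩ Metric.closedBall 0 R).Finite) : Config :=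
  ⟨Measure.sum fun i : ↥(S ∩ nearLine b r) => Measure.dirac (chord b r v i),
    ⟨_, _, rfl, finite_chord hr hv hS⟩⟩

theorem passages_apply (hr : 0 ≤ r) (hv : 0 < v) {S : Set Plane}
    (hS : ∀ R : ℝ, (S ∩ Metric.closedBall 0 R).Finite) {A : Set (ℝ × ℝ)} (hA : MeasurableSet A) :
    (passages b hr hv hS).1 A = ((S ∩ (nearLine b r ∩ chord b r v ⁻¹' A)).encard : ℝ≥0∞) := by
  rw [passages, IsConfig.apply_eq hA, ← Subtype.val_injective.encard_image]
  congr 2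
  ext z
  constructor
  · rintro ⟨⟨z, hz, hl⟩, hi, rfl⟩
    exact ⟨hz, hl, hi⟩
  · rintro ⟨hz, hl, hi⟩
    exact ⟨⟨z, hz, hl⟩, hi, rfl⟩

theorem atoms_passages (hr : 0 ≤ r) (hv : 0 < v) {S : Set Plane}
    (hS : ∀ R : ℝ, (S ∩ Metric.closedBall 0 R).Finite) :
    (passages b hr hv hS).atoms = chord b r v '' (S ∩ nearLine b r) := by
  ext z
  rw [Config.atoms, Set.mem_ofPred_eq, passages_apply hr hv hS (measurableSet_singleton z)]
  simp only [ne_eq, ENat.toENNReal_eq_zero, Set.encard_eq_zero]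
  rw [← ne_eq, ← Set.nonempty_iff_ne_empty]
  constructor
  · rintro ⟨y, hy, hl, hyz⟩
    exact ⟨y, ⟨hy, hl⟩, hyz⟩
  · rintro ⟨y, ⟨hy, hl⟩, hyz⟩
    exact ⟨y, hy, hl, hyz⟩

namespace Config

/-- Some atom is active at time `t`. -/
def Covered (M : Config) (t : ℝ) : Prop := ∃ z ∈ M.atoms, z.1 ≤ t ∧ t ≤ z.1 + z.2

/-- If an atom that started earlier still occupied `t`, times just before `t` would be covered.
Conversely only finitely many atoms matter near a vacant `t`, and those that started earlier end
strictly before it, so a left neighbourhood is free. -/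
theorem upTimes_eq_covered {M : Config} {d : ℝ} (hd : ∀ z ∈ M.atoms, z.2 ∈ Set.Icc 0 d) :
    {t | 0 < t ∧ (∀ᶠ s in 𝓝[<] t, ¬ M.Covered s) ∧ M.Covered t} = M.upTimes := by
  ext t
  refine and_congr_right fun _ => ⟨?_, ?_⟩
  · rintro ⟨hev, z, hz, hzt, htz⟩
    have hkey : ∀ y ∈ M.atoms, y.1 < t → y.1 + y.2 < t := by
      intro y hy hyt
      by_contra! hcon
      have h1 : ∀ᶠ s in 𝓝[<] t, s ∈ Set.Ioo y.1 t := Ioo_mem_nhdsLT hyt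
      obtain ⟨s, hs1, hs2⟩ := (hev.and h1).exists
      exact hs1 ⟨y, hy, hs2.1.le, hs2.2.le.trans hcon⟩
    refine ⟨⟨z, hz, ?_⟩, vacant_iff.2 hkey⟩
    by_contra hne
    exact absurd (hkey z hz (lt_of_le_of_ne hzt hne)) (not_lt.2 htz)
  · rintro ⟨⟨z, hz, rfl⟩, hvac⟩
    rw [vacant_iff] at hvac
    refine ⟨?_, z, hz, le_rfl, by linarith [(hd z hz).1]⟩
    -- An atom that covers some time in `(z.1 - 1, z.1)` has a mark at most `d`, hence starts after
    -- `z.1 - 1 - d`.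
    have hfin := M.finite_atoms (|z.1| + 1 + |d|)
    have h1 : ∀ᶠ s in 𝓝[<] z.1, ∀ y ∈ M.atoms ∩ {y | |y.1| ≤ |z.1| + 1 + |d|},
        y.1 < z.1 → y.1 + y.2 < s := by
      refine (Filter.eventually_all_finite hfin).2 fun y hy => ?_
      by_cases hyz : y.1 < z.1
      · have : ∀ᶠ s in 𝓝[<] z.1, s ∈ Set.Ioo (y.1 + y.2) z.1 := Ioo_mem_nhdsLT (hvac y hy.1 hyz)
        exact this.mono fun s hs _ => hs.1
      · exact Eventually.of_forall fun s h => absurd h hyz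
    have h2 : ∀ᶠ s in 𝓝[<] z.1, s ∈ Set.Ioo (z.1 - 1) z.1 := Ioo_mem_nhdsLT (by linarith)
    filter_upwards [h1, h2] with s hs1 hs2
    rintro ⟨y, hy, hys, hsy⟩
    have hyd := (hd y hy).2
    have hyb : |y.1| ≤ |z.1| + 1 + |d| := by
      rw [abs_le]
      constructor
      · linarith [hs2.1, neg_abs_le z.1, le_abs_self d]
      · linarith [hs2.2, le_abs_self z.1, abs_nonneg d]
    exact absurd (hs1 y ⟨hy, hyb⟩ (hys.trans_lt hs2.2)) (not_lt.2 hsy)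

end Config

theorem upCrossings_eq {p w β γ : ℝ} (hp : 0 < p) (hw : 0 < w) (hβ : 0 < β) (hγ : 0 < γ)
    (hv : 0 < v) {S : Set Plane} (hS : ∀ R : ℝ, (S ∩ Metric.closedBall 0 R).Finite) :
    upCrossings p w β γ S v (b 0) =
      (passages b (coverageRadius_pos (β := β) hp hw hγ).le hv hS).upTimes := by
  set r := coverageRadius p w β γ
  have hr : 0 < r := coverageRadius_pos hp hw hγ
  have hcov : ∀ t, ENNReal.ofReal γ ≤ snr p w β S v (b 0) t ↔
      (passages b hr.le hv hS).Covered t := by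
    intro t
    rw [le_snr_iff hp hw hβ hγ, nodeDistance, infEDist_le_iff hS _ hr.le, Config.Covered,
      atoms_passages]
    constructor
    · rintro ⟨z, hz, hd⟩
      obtain ⟨h1, h2⟩ := (dist_userPosition_le_iff hr.le hv z t).1 hd
      exact ⟨_, ⟨z, ⟨hz, h1⟩, rfl⟩, h2⟩
    · rintro ⟨_, ⟨z, ⟨hz, h1⟩, rfl⟩, h2⟩
      exact ⟨z, hz, (dist_userPosition_le_iff hr.le hv z t).2 ⟨h1, h2⟩⟩
  have hmarks : ∀ z ∈ (passages b hr.le hv hS).atoms, z.2 ∈ Set.Icc 0 (2 * r / v) := by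
    rw [atoms_passages]
    rintro _ ⟨z, -, rfl⟩
    exact chord_snd_mem hr.le hv z
  rw [← Config.upTimes_eq_covered hmarks]
  ext t
  simp only [upCrossings, levelCrossing, hcov, Set.mem_ofPred_eq]
  refine and_congr_right fun _ => and_congr ?_ ?_
  · refine eventually_congr (Eventually.of_forall fun s => ?_)
    split_ifs with h <;> simp [← hcov, h]
  · split_ifs with h <;> simp [← hcov, h]

/-! ### The law of the passages -/

variable {b : OrthonormalBasis (Fin 2) ℝ Plane} {r v : ℝ}

/-- The law of the time that a node near the line spends within distance `r` of the user. -/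
def chordLaw (r v : ℝ) : Measure ℝ :=
  ((ENNReal.ofReal (2 * r))⁻¹ • volume.restrict (Set.Icc (-r) r)).map
    fun y => 2 * √(r ^ 2 - y ^ 2) / v

theorem measurable_chordLength (r v : ℝ) : Measurable fun y : ℝ => 2 * √(r ^ 2 - y ^ 2) / v := by
  fun_prop

theorem isProbabilityMeasure_chordLaw (hr : 0 < r) (v : ℝ) :
    IsProbabilityMeasure (chordLaw r v) := by
  constructor
  rw [chordLaw, Measure.map_apply (measurable_chordLength r v) .univ, Set.preimage_univ,
    Measure.smul_apply, Measure.restrict_apply_univ, Real.volume_Icc, smul_eq_mul,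
    sub_neg_eq_add, ← two_mul]
  exact ENNReal.inv_mul_cancel (by simpa using hr) ENNReal.ofReal_ne_top

theorem lintegral_chordLaw {g : ℝ → ℝ≥0∞} (hg : Measurable g) :
    ∫⁻ l, g l ∂(chordLaw r v) = (ENNReal.ofReal (2 * r))⁻¹ *
      ∫⁻ y in Set.Icc (-r) r, g (2 * √(r ^ 2 - y ^ 2) / v) := by
  rw [chordLaw, lintegral_map hg (measurable_chordLength r v), lintegral_smul_measure, smul_eq_mul]

theorem chordLaw_apply {A : Set ℝ} (hA : MeasurableSet A) :
    chordLaw r v A = (ENNReal.ofReal (2 * r))⁻¹ *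
      volume ((fun y => 2 * √(r ^ 2 - y ^ 2) / v) ⁻¹' A ∩ Set.Icc (-r) r) := by
  rw [chordLaw, Measure.map_apply (measurable_chordLength r v) hA, Measure.smul_apply,
    Measure.restrict_apply (measurable_chordLength r v hA), smul_eq_mul]

theorem chordLaw_compl_Icc (hr : 0 ≤ r) (hv : 0 < v) :
    chordLaw r v (Set.Icc 0 (2 * r / v))ᶜ = 0 := by
  rw [chordLaw_apply measurableSet_Icc.compl]
  have : (fun y => 2 * √(r ^ 2 - y ^ 2) / v) ⁻¹' (Set.Icc 0 (2 * r / v))ᶜ = ∅ := by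
    rw [Set.eq_empty_iff_forall_notMem]
    intro y hy
    refine hy ⟨by positivity, ?_⟩
    have h : √(r ^ 2 - y ^ 2) ≤ r := Real.sqrt_le_iff.2 ⟨hr, by linarith [sq_nonneg y]⟩
    exact div_le_div_of_nonneg_right (by linarith) hv.le
  rw [this]
  simp

/-- A chord shorter than the fraction `θ` of the diameter lies at height at least `r √(1 - θ²) ≥ r
(1 - θ²)`. The offset is then in one of two strips of width `r θ²`, a fraction `θ²` of `[-r, r]`. -/
theorem chordLaw_Iio_le (hr : 0 < r) (hv : 0 < v) {a : ℝ} (ha : 0 < a) (had : a ≤ 2 * r / v) :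
    chordLaw r v (Set.Iio a) ≤ ENNReal.ofReal ((a / (2 * r / v)) ^ 2) := by
  rw [chordLaw_apply measurableSet_Iio]
  set θ := a / (2 * r / v) with hθ
  have hθ0 : 0 < θ := by positivity
  have hθ1 : θ ≤ 1 := by
    rw [hθ, div_le_one (by positivity)]
    exact had
  have ha' : a = θ * (2 * r / v) := by
    rw [hθ]
    field_simp
  set s := r * (1 - θ ^ 2) with hs
  have hs0 : 0 ≤ s := mul_nonneg hr.le (by nlinarith)
  have hsub : (fun y => 2 * √(r ^ 2 - y ^ 2) / v) ⁻¹' Set.Iio a ∩ Set.Icc (-r) r ⊆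
      Set.Icc (-r) (-s) ∪ Set.Icc s r := by
    rintro y ⟨hy, hyr⟩
    have hy : 2 * √(r ^ 2 - y ^ 2) / v < a := hy
    rw [ha', div_lt_iff₀ hv] at hy
    have h1 : √(r ^ 2 - y ^ 2) < θ * r := by
      have : θ * (2 * r / v) * v = 2 * (θ * r) := by field_simp
      linarith
    have h2 : r ^ 2 - y ^ 2 < (θ * r) ^ 2 := (Real.sqrt_lt' (by positivity)).1 h1
    have h3 : s ^ 2 ≤ y ^ 2 := by
      have : s ^ 2 ≤ r ^ 2 * (1 - θ ^ 2) := by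
        rw [hs, mul_pow]
        have : (1 - θ ^ 2) ^ 2 ≤ 1 - θ ^ 2 := by nlinarith [sq_nonneg θ]
        gcongr
      nlinarith
    rcases le_or_gt 0 y with h | h
    · exact Or.inr ⟨by nlinarith [abs_le_of_sq_le_sq' h3 h], hyr.2⟩
    · refine Or.inl ⟨hyr.1, ?_⟩
      have := abs_le_of_sq_le_sq' (by nlinarith : s ^ 2 ≤ (-y) ^ 2) (by linarith)
      linarith [this.2]
  have hvol : volume (Set.Icc (-r) (-s) ∪ Set.Icc s r) ≤ ENNReal.ofReal (2 * r * θ ^ 2) := by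
    refine (measure_union_le _ _).trans ?_
    rw [Real.volume_Icc, Real.volume_Icc]
    have h1 : -s - -r = r * θ ^ 2 := by rw [hs]; ring
    have h2 : r - s = r * θ ^ 2 := by rw [hs]; ring
    rw [h1, h2, ← ENNReal.ofReal_add (by positivity) (by positivity)]
    exact ENNReal.ofReal_le_ofReal (by linarith)
  calc (ENNReal.ofReal (2 * r))⁻¹ *
        volume ((fun y => 2 * √(r ^ 2 - y ^ 2) / v) ⁻¹' Set.Iio a ∩ Set.Icc (-r) r)
      ≤ (ENNReal.ofReal (2 * r))⁻¹ * ENNReal.ofReal (2 * r * θ ^ 2) := by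
        gcongr
        exact (measure_mono hsub).trans hvol
    _ = ENNReal.ofReal (θ ^ 2) := by
        rw [ENNReal.ofReal_mul (p := 2 * r) (by positivity), ← mul_assoc,
          ENNReal.inv_mul_cancel (by simpa using hr) ENNReal.ofReal_ne_top, one_mul]

theorem integral_sqrt_sq_sub_sq (hr : 0 < r) :
    ∫ y in (-r)..r, √(r ^ 2 - y ^ 2) = Real.pi * r ^ 2 / 2 := by
  have h1 : ∀ y : ℝ, √(r ^ 2 - (r * y) ^ 2) = r * √(1 - y ^ 2) := fun y => by
    rw [show r ^ 2 - (r * y) ^ 2 = r ^ 2 * (1 - y ^ 2) by ring, Real.sqrt_mul (sq_nonneg r),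
      Real.sqrt_sq hr.le]
  have h2 := intervalIntegral.mul_integral_comp_mul_left (a := -1) (b := 1)
    (f := fun y => √(r ^ 2 - y ^ 2)) (c := r)
  simp only [h1, mul_neg, mul_one, intervalIntegral.integral_const_mul,
    integral_sqrt_one_sub_sq] at h2
  rw [← h2]
  ring

/-- The mean chord is the area of the disc divided by its width, `πr²/(2r)`; division by `v` turns
it into a time. -/
theorem lintegral_ofReal_chordLaw (hr : 0 < r) (hv : 0 < v) :
    ∫⁻ l, ENNReal.ofReal l ∂(chordLaw r v) = ENNReal.ofReal (Real.pi * r / (2 * v)) := by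
  have hcont : Continuous fun y : ℝ => 2 * √(r ^ 2 - y ^ 2) / v := by fun_prop
  rw [lintegral_chordLaw ENNReal.measurable_ofReal,
    ← ofReal_integral_eq_lintegral_ofReal (hcont.integrableOn_Icc)
      (Eventually.of_forall fun y => by positivity), integral_Icc_eq_integral_Ioc,
    ← intervalIntegral.integral_of_le (by linarith), intervalIntegral.integral_div,
    intervalIntegral.integral_const_mul, integral_sqrt_sq_sub_sq hr,
    ← ENNReal.ofReal_inv_of_pos (by positivity), ← ENNReal.ofReal_mul (by positivity)]
  congr 1
  field_simp

theorem measurePreserving_coordinates (b : OrthonormalBasis (Fin 2) ℝ Plane) :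
    MeasurePreserving (fun z : Plane => (b.repr z 0, b.repr z 1)) volume
      ((volume : Measure ℝ).prod volume) :=
  (volume_preserving_finTwoArrow ℝ).comp
    ((PiLp.volume_preserving_ofLp (Fin 2)).comp b.measurePreserving_repr)

theorem measurable_chord (b : OrthonormalBasis (Fin 2) ℝ Plane) (r v : ℝ) :
    Measurable (chord b r v) := by
  have h : Measurable fun q : ℝ × ℝ =>
      ((q.1 - √(r ^ 2 - q.2 ^ 2)) / v, 2 * √(r ^ 2 - q.2 ^ 2) / v) := by fun_prop
  exact h.comp (measurePreserving_coordinates b).measurable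

theorem measurableSet_nearLine (b : OrthonormalBasis (Fin 2) ℝ Plane) (r : ℝ) :
    MeasurableSet (nearLine b r) :=
  (measurePreserving_coordinates b).measurable.snd measurableSet_Icc

/-- The passages have the intensity of a marked Poisson process of rate `2 lam v r`. -/
theorem volume_nearLine_inter_chord (hr : 0 < r) (hv : 0 < v) {lam : ℝ} (hlam : 0 ≤ lam)
    {A : Set (ℝ × ℝ)} (hA : MeasurableSet A) :
    ENNReal.ofReal lam * volume (nearLine b r ∩ chord b r v ⁻¹' A) =
      intensity (2 * lam * v * r) (chordLaw r v) A := by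
  have := isProbabilityMeasure_chordLaw hr v
  have hκ : Measurable fun q : ℝ × ℝ =>
      ((q.1 - √(r ^ 2 - q.2 ^ 2)) / v, 2 * √(r ^ 2 - q.2 ^ 2) / v) := by fun_prop
  have hB : MeasurableSet {q : ℝ × ℝ | q.2 ∈ Set.Icc (-r) r ∧
      ((q.1 - √(r ^ 2 - q.2 ^ 2)) / v, 2 * √(r ^ 2 - q.2 ^ 2) / v) ∈ A} :=
    (measurable_snd measurableSet_Icc).inter (hκ hA)
  have h1 : volume (nearLine b r ∩ chord b r v ⁻¹' A) = ((volume : Measure ℝ).prod volume)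
      {q : ℝ × ℝ | q.2 ∈ Set.Icc (-r) r ∧
      ((q.1 - √(r ^ 2 - q.2 ^ 2)) / v, 2 * √(r ^ 2 - q.2 ^ 2) / v) ∈ A} := by
    rw [← (measurePreserving_coordinates b).measure_preimage hB.nullMeasurableSet]
    rfl
  have hslice : ∀ y : ℝ, volume ((fun x : ℝ => (x, y)) ⁻¹' {q : ℝ × ℝ | q.2 ∈ Set.Icc (-r) r ∧
      ((q.1 - √(r ^ 2 - q.2 ^ 2)) / v, 2 * √(r ^ 2 - q.2 ^ 2) / v) ∈ A}) =
      (Set.Icc (-r) r).indicator (fun y => ENNReal.ofReal v *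
        volume ((fun a : ℝ => (a, 2 * √(r ^ 2 - y ^ 2) / v)) ⁻¹' A)) y := by
    intro y
    by_cases hy : y ∈ Set.Icc (-r) r
    · rw [Set.indicator_of_mem hy]
      -- At a fixed offset the entry time is an affine function of `x`: the translation preserves
      -- length and the division by `v` contributes the factor `v`.
      have h2 : (fun x : ℝ => (x, y)) ⁻¹' {q : ℝ × ℝ | q.2 ∈ Set.Icc (-r) r ∧
          ((q.1 - √(r ^ 2 - q.2 ^ 2)) / v, 2 * √(r ^ 2 - q.2 ^ 2) / v) ∈ A} =
          (fun x => x + -√(r ^ 2 - y ^ 2)) ⁻¹' ((fun x => x * v⁻¹) ⁻¹'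
            ((fun a : ℝ => (a, 2 * √(r ^ 2 - y ^ 2) / v)) ⁻¹' A)) := by
        ext x
        simp only [Set.mem_preimage, Set.mem_ofPred_eq, hy, true_and, div_eq_mul_inv, sub_eq_add_neg]
      rw [h2, measure_preimage_add_right, Real.volume_preimage_mul_right (inv_ne_zero hv.ne'),
        inv_inv, abs_of_pos hv]
    · rw [Set.indicator_of_notMem hy]
      convert measure_empty (μ := (volume : Measure ℝ))
      rw [Set.eq_empty_iff_forall_notMem]
      exact fun x hx => hy hx.1
  have hmeas : Measurable fun l : ℝ => volume ((fun a : ℝ => (a, l)) ⁻¹' A) :=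
    measurable_measure_prodMk_right hA
  have hmeas' : Measurable fun y : ℝ =>
      volume ((fun a : ℝ => (a, 2 * √(r ^ 2 - y ^ 2) / v)) ⁻¹' A) :=
    hmeas.comp (measurable_chordLength r v)
  rw [h1, Measure.prod_apply_symm hB, lintegral_congr hslice, lintegral_indicator measurableSet_Icc,
    lintegral_const_mul _ hmeas', intensity, Measure.smul_apply,
    Measure.prod_apply_symm hA, lintegral_chordLaw hmeas, smul_eq_mul, ← mul_assoc, ← mul_assoc]
  congr 1
  rw [← ENNReal.ofReal_inv_of_pos (by positivity), ← ENNReal.ofReal_mul hlam,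
    ← ENNReal.ofReal_mul (by positivity)]
  congr 1
  field_simp

section Law

variable {Ω : Type*} [MeasurableSpace Ω] {P : Measure Ω} {lam : ℝ} {Φ : Ω → Set Plane}

/-- The passages of the nodes of a random configuration. -/
def randomPassages (b : OrthonormalBasis (Fin 2) ℝ Plane) (hr : 0 < r) (hv : 0 < v)
    (hΦ : IsPoissonPointProcess Φ lam P) (ω : Ω) : Config :=
  passages b hr.le hv (hΦ.locallyFinite ω)

theorem measurableSet_passage (b : OrthonormalBasis (Fin 2) ℝ Plane) {A : Set (ℝ × ℝ)}
    (hA : MeasurableSet A) : MeasurableSet (nearLine b r ∩ chord b r v ⁻¹' A) :=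
  (measurableSet_nearLine b r).inter (measurable_chord b r v hA)

theorem measurable_randomPassages (hr : 0 < r) (hv : 0 < v)
    (hΦ : IsPoissonPointProcess Φ lam P) : Measurable (randomPassages b hr hv hΦ) := by
  refine Config.measurable_of_coe fun A hA => ?_
  have h : (fun ω => (randomPassages b hr hv hΦ ω).1 A) = fun ω =>
      (((Φ ω ∩ (nearLine b r ∩ chord b r v ⁻¹' A)).encard : ℕ∞) : ℝ≥0∞) := by
    ext ω
    exact passages_apply hr.le hv _ hA
  rw [h]
  exact (Measurable.of_discrete (f := ENat.toENNReal)).comp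
    (hΦ.measurable_count _ (measurableSet_passage b hA))

/-- Mapping principle: a count of passages in `A` is a count of nodes in a Borel set of the plane,
disjoint sets have disjoint preimages, and the areas are given by `volume_nearLine_inter_chord`. -/
theorem isPoissonLaw_randomPassages [IsProbabilityMeasure P] (hlam : 0 < lam) (hr : 0 < r)
    (hv : 0 < v) (hΦ : IsPoissonPointProcess Φ lam P) :
    IsPoissonLaw (P.map (randomPassages b hr hv hΦ))
      (intensity (2 * lam * v * r) (chordLaw r v)) := by
  have := isProbabilityMeasure_chordLaw hr v
  have hN := measurable_randomPassages (b := b) hr hv hΦ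
  have happ : ∀ A, MeasurableSet A → (fun ω => (randomPassages b hr hv hΦ ω).1 A) = fun ω =>
      (((Φ ω ∩ (nearLine b r ∩ chord b r v ⁻¹' A)).encard : ℕ∞) : ℝ≥0∞) := fun A hA => by
    ext ω
    exact passages_apply hr.le hv _ hA
  refine ⟨Measure.isProbabilityMeasure_map hN.aemeasurable, fun j => ?_, fun A hA hfin => ?_,
    fun A hA hd => ?_⟩
  · rw [Config.strip, intensity_preimage_fst, Real.volume_Ico]
    exact ENNReal.mul_ne_top ENNReal.ofReal_ne_top ENNReal.ofReal_ne_top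
  · have hvol := volume_nearLine_inter_chord (b := b) hr hv hlam.le hA
    have hfin' : volume (nearLine b r ∩ chord b r v ⁻¹' A) ≠ ∞ := by
      intro h
      rw [h, ENNReal.mul_top (by simpa using hlam)] at hvol
      exact hfin hvol.symm
    rw [Measure.map_map (Config.measurable_coe hA) hN]
    change P.map (fun ω => (randomPassages b hr hv hΦ ω).1 A) = _
    have h1 := (hΦ.law_count _ (measurableSet_passage b hA) hfin').map_eq
    have h2 : P.map (fun ω => (((Φ ω ∩ (nearLine b r ∩ chord b r v ⁻¹' A)).encard : ℕ∞) : ℝ≥0∞)) =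
        (P.map fun ω => (Φ ω ∩ (nearLine b r ∩ chord b r v ⁻¹' A)).encard).map ENat.toENNReal :=
      (Measure.map_map Measurable.of_discrete
        (hΦ.measurable_count _ (measurableSet_passage b hA))).symm
    rw [happ A hA, h2, h1, Measure.map_map Measurable.of_discrete Measurable.of_discrete,
      poissonCount, ← hvol, ENNReal.toNNReal_mul]
    rfl
  · have h1 := hΦ.indep_count (fun i => nearLine b r ∩ chord b r v ⁻¹' A i)
      (fun i => measurableSet_passage b (hA i)) fun i j hij =>
        ((hd hij).preimage _).mono Set.inter_subset_right Set.inter_subset_right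
    have h2 : iIndepFun (fun i ω => (randomPassages b hr hv hΦ ω).1 (A i)) P := by
      have h3 := h1.comp (fun _ => ENat.toENNReal) fun _ => Measurable.of_discrete
      convert h3 using 2 with i
      exact happ (A i) (hA i)
    rw [iIndepFun_iff_measure_inter_preimage_eq_mul] at h2 ⊢
    intro S B hB
    have h4 := h2 S hB
    have hpre : ∀ i ∈ S, MeasurableSet ((fun M : Config => M.1 (A i)) ⁻¹' B i) := fun i hi =>
      Config.measurable_coe (hA i) (hB i hi)
    rw [Measure.map_apply hN (Finset.measurableSet_biInter S hpre), Set.preimage_iInter₂]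
    refine Eq.trans h4 (Finset.prod_congr rfl fun i hi => ?_)
    rw [Measure.map_apply hN (hpre i hi)]
    rfl

end Law

/-! ### Transfer to the moving user and the two limits -/

open Config

theorem iIndepFun_comp_of_map {Ω Ω' ι : Type*} [MeasurableSpace Ω] [MeasurableSpace Ω']
    {P : Measure Ω} {N : Ω → Ω'} (hN : Measurable N) {X : ι → Ω' → ℝ} (hX : ∀ i, Measurable (X i))
    (h : iIndepFun X (P.map N)) : iIndepFun (fun i ω => X i (N ω)) P := by
  rw [iIndepFun_iff_measure_inter_preimage_eq_mul] at h ⊢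
  intro S B hB
  have h1 := h S hB
  rw [Measure.map_apply hN (Finset.measurableSet_biInter S fun i hi => hX i (hB i hi)),
    Set.preimage_iInter₂] at h1
  refine Eq.trans h1 (Finset.prod_congr rfl fun i hi => ?_)
  rw [Measure.map_apply hN (hX i (hB i hi))]
  rfl

theorem IsPoissonLaw.map_upGap_eq {Q : Measure Config} {f : ℝ} {G : Measure ℝ}
    [IsProbabilityMeasure G] (hQ : IsPoissonLaw Q (intensity f G))
    (hinf : ∀ᵐ M ∂Q, M.upTimes.Infinite) (n : ℕ) : Q.map (upGap n) = Q.map (upGap 0) := by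
  have := hQ.prob
  have hp := fun n => Measure.isProbabilityMeasure_map (μ := Q) (measurable_upGap n).aemeasurable
  refine Measure.ext_of_Iic _ _ fun t => ?_
  rw [← compl_compl (Set.Iic t), Set.compl_Iic, prob_compl_eq_one_sub measurableSet_Ioi,
    prob_compl_eq_one_sub measurableSet_Ioi, Measure.map_apply (measurable_upGap n) measurableSet_Ioi,
    Measure.map_apply (measurable_upGap 0) measurableSet_Ioi]
  have h := fun n => hQ.measure_lt_upGap hinf n t
  exact congrArg _ ((h n).trans (h 0).symm)

section Crossings

variable {Ω : Type*} [MeasurableSpace Ω] {P : Measure Ω} [IsProbabilityMeasure P]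
  {lam v p w β γ : ℝ} {b : OrthonormalBasis (Fin 2) ℝ Plane} {Φ : Ω → Set Plane}

theorem ae_simple_infinite_randomPassages {r : ℝ} (hlam : 0 < lam) (hr : 0 < r) (hv : 0 < v)
    (hΦ : IsPoissonPointProcess Φ lam P) : ∀ᵐ ω ∂P, (randomPassages b hr hv hΦ ω).Simple ∧
      (randomPassages b hr hv hΦ ω).upTimes.Infinite := by
  have := isProbabilityMeasure_chordLaw hr v
  have hQ := isPoissonLaw_randomPassages (b := b) hlam hr hv hΦ
  have hinf := hQ.ae_infinite_upTimes (by positivity) (by positivity)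
    (chordLaw_compl_Icc hr.le hv)
  exact ae_of_ae_map (measurable_randomPassages hr hv hΦ).aemeasurable (hQ.ae_simple.and hinf)

theorem ae_upCrossingTime_eq (hlam : 0 < lam) (hv : 0 < v) (hp : 0 < p) (hw : 0 < w) (hβ : 0 < β)
    (hγ : 0 < γ) (hΦ : IsPoissonPointProcess Φ lam P) :
    ∀ᵐ ω ∂P, ∀ n, upCrossingTime p w β γ (Φ ω) v (b 0) n =
      upEpoch n (randomPassages b (coverageRadius_pos (β := β) hp hw hγ) hv hΦ ω) := by
  filter_upwards [ae_simple_infinite_randomPassages hlam (coverageRadius_pos (β := β) hp hw hγ)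
    hv hΦ (b := b)] with ω hω n
  rw [upEpoch_eq hω.1 hω.2, upCrossingTime,
    upCrossings_eq hp hw hβ hγ hv (hΦ.locallyFinite ω)]
  rfl

theorem ae_strictMono_upCrossingTime (hlam : 0 < lam) (hv : 0 < v) (hp : 0 < p) (hw : 0 < w)
    (hβ : 0 < β) (hγ : 0 < γ) (hΦ : IsPoissonPointProcess Φ lam P) :
    ∀ᵐ ω ∂P, StrictMono (upCrossingTime p w β γ (Φ ω) v (b 0)) ∧
      Set.range (upCrossingTime p w β γ (Φ ω) v (b 0)) = upCrossings p w β γ (Φ ω) v (b 0) := by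
  filter_upwards [ae_simple_infinite_randomPassages hlam (coverageRadius_pos (β := β) hp hw hγ)
    hv hΦ (b := b)] with ω hω
  have h : upCrossings p w β γ (Φ ω) v (b 0) =
      (randomPassages b (coverageRadius_pos (β := β) hp hw hγ) hv hΦ ω).upTimes :=
    upCrossings_eq hp hw hβ hγ hv (hΦ.locallyFinite ω)
  change StrictMono (successive _) ∧ Set.range (successive _) = _
  rw [h]
  exact ⟨strictMono_successive (finite_upTimes _) hω.2, range_successive (finite_upTimes _) hω.2⟩

theorem isRenewalProcess_upCrossingTime (hlam : 0 < lam) (hv : 0 < v) (hp : 0 < p) (hw : 0 < w)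
    (hβ : 0 < β) (hγ : 0 < γ) (hΦ : IsPoissonPointProcess Φ lam P) :
    IsRenewalProcess (fun n ω => upCrossingTime p w β γ (Φ ω) v (b 0) n) P := by
  have hr := coverageRadius_pos (β := β) hp hw hγ
  have := isProbabilityMeasure_chordLaw hr v
  have hQ := isPoissonLaw_randomPassages (b := b) hlam hr hv hΦ
  have hinf := hQ.ae_infinite_upTimes (by positivity) (by positivity)
    (chordLaw_compl_Icc hr.le hv)
  have hN := measurable_randomPassages (b := b) hr hv hΦ
  have heq := ae_upCrossingTime_eq (b := b) hlam hv hp hw hβ hγ hΦ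
  have hmono := ae_strictMono_upCrossingTime (b := b) hlam hv hp hw hβ hγ hΦ
  refine ⟨fun n => ⟨_, (measurable_upEpoch n).comp hN, ?_⟩, ?_, ?_, ?_, fun n => ?_⟩
  · filter_upwards [heq] with ω hω using hω n
  · filter_upwards [hmono] with ω hω
    have h : upCrossingTime p w β γ (Φ ω) v (b 0) 0 ∈ upCrossings p w β γ (Φ ω) v (b 0) :=
      hω.2 ▸ Set.mem_range_self 0
    exact h.1.le
  · filter_upwards [hmono] with ω hω n using hω.1 n.lt_succ_self
  · have hm : ∀ n : ℕ, Measurable fun M : Config =>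
        if n = 0 then upEpoch 0 M else upEpoch n M - upEpoch (n - 1) M := fun n => by
      split_ifs
      · exact measurable_upEpoch 0
      · exact (measurable_upEpoch n).sub (measurable_upEpoch _)
    refine (iIndepFun_comp_of_map hN hm (hQ.iIndepFun_epoch hinf)).congr fun n => ?_
    filter_upwards [heq] with ω hω
    simp only [hω]
  · have hgap : ∀ n, (fun ω => upCrossingTime p w β γ (Φ ω) v (b 0) (n + 1) -
        upCrossingTime p w β γ (Φ ω) v (b 0) n) =ᵐ[P]
          fun ω => upGap n (randomPassages b hr hv hΦ ω) := fun n => by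
      filter_upwards [heq] with ω hω
      rw [hω, hω]
      rfl
    have hmg : ∀ n, Measurable fun ω => upGap n (randomPassages b hr hv hΦ ω) := fun n =>
      (measurable_upGap n).comp hN
    refine ⟨⟨_, hmg n, hgap n⟩, ⟨_, hmg 0, hgap 0⟩, ?_⟩
    rw [Measure.map_congr (hgap n), Measure.map_congr (hgap 0)]
    have hmap : ∀ n, P.map (fun ω => upGap n (randomPassages b hr hv hΦ ω)) =
        (P.map (randomPassages b hr hv hΦ)).map (upGap n) := fun n =>
      (Measure.map_map (measurable_upGap n) hN).symm
    rw [hmap, hmap]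
    exact hQ.map_upGap_eq hinf n

/-- The general estimate with `f ℓ = λπr²`. The minimum keeps both bounds on the early epoch rate:
the first serves for small `r`, the second for large `r`. -/
theorem abs_measure_lt_interArrival_sub_exp_le (hlam : 0 < lam) (hv : 0 < v) (hp : 0 < p)
    (hw : 0 < w) (hβ : 0 < β) (hγ : 0 < γ) (hΦ : IsPoissonPointProcess Φ lam P) (n : ℕ) {r f g : ℝ}
    (hr : r = coverageRadius p w β γ) (hf : f = 2 * lam * v * r)
    (hg : g = f * Real.exp (-(lam * Real.pi * r ^ 2))) {t : ℝ} (ht : 0 ≤ t) :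
    |P.real {ω | t < interArrival p w β γ (Φ ω) v (b 0) n} - Real.exp (-(g * t))| ≤
      (g + min f (15 / (f * (2 * r / v) ^ 2))) * (2 * r / v) * Real.exp (g * t) := by
  have hr0 : 0 < r := hr ▸ coverageRadius_pos (β := β) hp hw hγ
  subst hr
  subst hf
  have := isProbabilityMeasure_chordLaw hr0 v
  have hQ := isPoissonLaw_randomPassages (b := b) hlam hr0 hv hΦ
  have hinf := hQ.ae_infinite_upTimes (by positivity) (by positivity)
    (chordLaw_compl_Icc hr0.le hv)
  have hN := measurable_randomPassages (b := b) hr0 hv hΦ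
  have heq := ae_upCrossingTime_eq (b := b) hlam hv hp hw hβ hγ hΦ
  set r := coverageRadius p w β γ
  have hprob := hQ.prob
  have h1 : P.real {ω | t < interArrival p w β γ (Φ ω) v (b 0) n} =
      (tail (P.map (randomPassages b hr0 hv hΦ)) (chordLaw r v) t).toReal := by
    rw [← hQ.measure_lt_upGap hinf n t, Measure.map_apply hN
      (measurableSet_lt measurable_const (measurable_upGap n))]
    refine congrArg ENNReal.toReal (measure_congr ?_)
    filter_upwards [heq] with ω hω
    refine propext ?_
    change t < interArrival p w β γ (Φ ω) v (b 0) n ↔ t < upGap n (randomPassages b hr0 hv hΦ ω)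
    rw [interArrival, hω, hω]
    rfl
  have hfl : 2 * lam * v * r * (Real.pi * r / (2 * v)) = lam * Real.pi * r ^ 2 := by
    field_simp
  rw [h1, hg, ← hfl]
  refine hQ.abs_tail_sub_exp_le (by positivity) (by positivity) (chordLaw_compl_Icc hr0.le hv)
    (by positivity) (lintegral_ofReal_chordLaw hr0 hv) (fun a ha had => le_min ?_ ?_)
    (by positivity) ht
  · exact IsPoissonLaw.epochRate_le (by positivity) a
  · exact hQ.epochRate_le_div (by positivity) (fun c hc hcd => chordLaw_Iio_le hr0 hv hc hcd) ha had

/-- Convergence in distribution requires measurability at every real `γ`. For `γ ≤ 0` the level is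
always met, so there is no up-crossing, and the infima of empty sets are all `0`. -/
theorem interArrival_of_nonpos (hγ : γ ≤ 0) (S : Set Plane) (u : Plane) (n : ℕ) :
    interArrival p w β γ S v u n = 0 := by
  have h1 : upCrossings p w β γ S v u = ∅ := by
    rw [Set.eq_empty_iff_forall_notMem]
    rintro t ⟨-, h, -⟩
    obtain ⟨s, hs⟩ := h.exists
    simp [levelCrossing, ENNReal.ofReal_of_nonpos hγ] at hs
  have h2 : ∀ n, successive (∅ : Set ℝ) n = 0 := fun n => by
    cases n <;> simp [successive]
  rw [interArrival, upCrossingTime, upCrossingTime, h1, h2, h2, sub_zero]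

theorem aemeasurable_interArrival (hlam : 0 < lam) (hv : 0 < v) (hp : 0 < p) (hw : 0 < w)
    (hβ : 0 < β) (hΦ : IsPoissonPointProcess Φ lam P) (γ : ℝ) (n : ℕ) :
    AEMeasurable (fun ω => interArrival p w β γ (Φ ω) v (b 0) n) P := by
  rcases le_or_gt γ 0 with hγ | hγ
  · simp only [interArrival_of_nonpos hγ]
    exact aemeasurable_const
  · have h := (isRenewalProcess_upCrossingTime (b := b) hlam hv hp hw hβ hγ hΦ).aemeasurable
    exact (h (n + 1)).sub (h n)

theorem tendstoInDistribution_mul_interArrival (hlam : 0 < lam) (hv : 0 < v) (hp : 0 < p)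
    (hw : 0 < w) (hβ : 0 < β) (hΦ : IsPoissonPointProcess Φ lam P) (n : ℕ) {l : Filter ℝ}
    [l.IsCountablyGenerated] {c f g e : ℝ → ℝ} (hl : ∀ᶠ γ in l, 0 < γ) (hc : ∀ γ, 0 < γ → 0 < c γ)
    (hf : f = fun γ => 2 * lam * v * coverageRadius p w β γ)
    (hg : g = fun γ => f γ * Real.exp (-(lam * Real.pi * coverageRadius p w β γ ^ 2)))
    (hgc : Tendsto (fun γ => g γ / c γ) l (𝓝 1))
    (he : ∀ γ, 0 < γ → (g γ + min (f γ) (15 / (f γ * (2 * coverageRadius p w β γ / v) ^ 2))) *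
      (2 * coverageRadius p w β γ / v) ≤ e γ) (he0 : Tendsto e l (𝓝 0)) :
    TendstoInDistribution (fun γ ω => c γ * interArrival p w β γ (Φ ω) v (b 0) n) l id
      (fun _ => P) (expMeasure 1) := by
  refine tendstoInDistribution_exp
    (fun γ => (aemeasurable_interArrival hlam hv hp hw hβ hΦ γ n).const_mul _) ?_ fun x hx => ?_
  · filter_upwards [hl] with γ hγ
    filter_upwards [ae_strictMono_upCrossingTime (b := b) hlam hv hp hw hβ hγ hΦ] with ω hω
    exact mul_nonneg (hc γ hγ).le (sub_nonneg.2 (hω.1 n.lt_succ_self).le)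
  · have h := tendsto_tail_div (F := fun γ t =>
      P.real {ω | t < interArrival p w β γ (Φ ω) v (b 0) n}) (g := g) (c := c) (e := e) (l := l)
      ?_ hgc he0 hx
    · refine h.congr' ?_
      filter_upwards [hl] with γ hγ
      congr 1
      ext ω
      exact div_lt_iff₀' (hc γ hγ)
    · filter_upwards [hl] with γ hγ
      refine ⟨hc γ hγ, fun t ht => ?_⟩
      refine (abs_measure_lt_interArrival_sub_exp_le hlam hv hp hw hβ hγ hΦ n rfl
        (congrFun hf γ) (congrFun hg γ) ht).trans ?_
      exact mul_le_mul_of_nonneg_right (he γ hγ) (Real.exp_pos _).le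

theorem tendsto_coverageRadius_atTop (hw : 0 < w) (hβ : 0 < β) :
    Tendsto (coverageRadius p w β) atTop (𝓝 0) := by
  have h1 : Tendsto (fun γ => p / (w * γ)) atTop (𝓝 0) :=
    tendsto_const_nhds.div_atTop (tendsto_id.const_mul_atTop hw)
  have h2 := h1.rpow_const (p := 1 / β) (.inr (by positivity))
  rwa [Real.zero_rpow (by positivity)] at h2

theorem tendsto_coverageRadius_zero (hp : 0 < p) (hw : 0 < w) (hβ : 0 < β) :
    Tendsto (coverageRadius p w β) (𝓝[>] 0) atTop := by
  have h1 : Tendsto (fun γ : ℝ => p / w * γ⁻¹) (𝓝[>] 0) atTop :=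
    tendsto_inv_nhdsGT_zero.const_mul_atTop (by positivity)
  refine ((tendsto_rpow_atTop (y := 1 / β) (by positivity)).comp h1).congr fun γ => ?_
  rw [Function.comp_apply, coverageRadius, ← div_eq_mul_inv, div_div]

theorem tendstoInDistribution_atTop (hlam : 0 < lam) (hv : 0 < v) (hp : 0 < p) (hw : 0 < w)
    (hβ : 0 < β) (hΦ : IsPoissonPointProcess Φ lam P) (n : ℕ) :
    TendstoInDistribution (fun (γ : ℝ) ω => (2 * lam * v * coverageRadius p w β γ) *
      interArrival p w β γ (Φ ω) v (b 0) n) atTop id (fun _ => P) (expMeasure 1) := by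
  have hr : Tendsto (fun γ => coverageRadius p w β γ) atTop (𝓝 0) :=
    tendsto_coverageRadius_atTop hw hβ
  have hexp : Tendsto (fun γ => Real.exp (-(lam * Real.pi * coverageRadius p w β γ ^ 2)))
      atTop (𝓝 1) := by
    have h : Tendsto (fun γ => -(lam * Real.pi * coverageRadius p w β γ ^ 2)) atTop (𝓝 0) := by
      simpa using ((hr.pow 2).const_mul (lam * Real.pi)).neg
    rw [← Real.exp_zero]
    exact (Real.continuous_exp.tendsto 0).comp h
  refine tendstoInDistribution_mul_interArrival hlam hv hp hw hβ hΦ n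
    (c := fun γ => 2 * lam * v * coverageRadius p w β γ)
    (e := fun γ => 4 * lam * coverageRadius p w β γ ^ 2 *
      (Real.exp (-(lam * Real.pi * coverageRadius p w β γ ^ 2)) + 1))
    (eventually_gt_atTop 0) (fun γ hγ => ?_) rfl rfl ?_ (fun γ hγ => ?_) ?_
  · have := coverageRadius_pos (β := β) hp hw hγ
    positivity
  · refine hexp.congr' ?_
    filter_upwards [eventually_gt_atTop 0] with γ hγ
    have := coverageRadius_pos (β := β) hp hw hγ
    field_simp
  · have hr0 := coverageRadius_pos (β := β) hp hw hγ
    set r := coverageRadius p w β γ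
    -- Small radius: the bound `f` on the rate is enough, because `f d = 4λr²`.
    calc _ ≤ (2 * lam * v * r * Real.exp (-(lam * Real.pi * r ^ 2)) + 2 * lam * v * r) *
          (2 * r / v) := by
          gcongr
          exact min_le_left _ _
      _ = _ := by
          field_simp
          ring
  · simpa using ((hr.pow 2).const_mul (4 * lam)).mul (hexp.add_const 1)

theorem tendstoInDistribution_zero (hlam : 0 < lam) (hv : 0 < v) (hp : 0 < p) (hw : 0 < w)
    (hβ : 0 < β) (hΦ : IsPoissonPointProcess Φ lam P) (n : ℕ) :
    TendstoInDistribution (fun (γ : ℝ) ω => (2 * lam * v * coverageRadius p w β γ *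
        Real.exp (-(lam * Real.pi * coverageRadius p w β γ ^ 2))) *
      interArrival p w β γ (Φ ω) v (b 0) n) (𝓝[>] (0 : ℝ)) id (fun _ => P) (expMeasure 1) := by
  have hr : Tendsto (fun γ => coverageRadius p w β γ) (𝓝[>] 0) atTop :=
    tendsto_coverageRadius_zero hp hw hβ
  have hr2 : Tendsto (fun γ => lam * Real.pi * coverageRadius p w β γ ^ 2) (𝓝[>] 0) atTop :=
    ((tendsto_pow_atTop two_ne_zero).comp hr).const_mul_atTop (by positivity)
  have hr3 : Tendsto (fun γ => 4 * lam * coverageRadius p w β γ ^ 2) (𝓝[>] 0) atTop :=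
    ((tendsto_pow_atTop two_ne_zero).comp hr).const_mul_atTop (by positivity)
  have hexp : Tendsto (fun γ => 4 / Real.pi * ((lam * Real.pi * coverageRadius p w β γ ^ 2) ^ 1 *
      Real.exp (-(lam * Real.pi * coverageRadius p w β γ ^ 2)))) (𝓝[>] 0) (𝓝 0) := by
    have h := (Real.tendsto_pow_mul_exp_neg_atTop_nhds_zero 1).comp hr2
    simpa using h.const_mul (4 / Real.pi)
  refine tendstoInDistribution_mul_interArrival hlam hv hp hw hβ hΦ n
    (e := fun γ => 4 / Real.pi * ((lam * Real.pi * coverageRadius p w β γ ^ 2) ^ 1 *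
      Real.exp (-(lam * Real.pi * coverageRadius p w β γ ^ 2))) +
        15 / (4 * lam * coverageRadius p w β γ ^ 2))
    self_mem_nhdsWithin (fun γ hγ => ?_) rfl rfl ?_ (fun γ hγ => ?_) ?_
  · have := coverageRadius_pos (β := β) hp hw hγ
    positivity
  · refine tendsto_const_nhds.congr' ?_
    filter_upwards [self_mem_nhdsWithin] with γ hγ
    have := coverageRadius_pos (β := β) hp hw hγ
    exact (div_self (by positivity)).symm
  · have hr0 := coverageRadius_pos (β := β) hp hw hγ
    set r := coverageRadius p w β γ
    -- Large radius: `f d` diverges, so the bound `15/(f d²)` is needed, and it contributes `15/(f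
    -- d)`.
    calc _ ≤ (2 * lam * v * r * Real.exp (-(lam * Real.pi * r ^ 2)) +
          15 / (2 * lam * v * r * (2 * r / v) ^ 2)) * (2 * r / v) := by
          gcongr
          exact min_le_right _ _
      _ = _ := by
          field_simp
          ring
  · simpa using hexp.add (hr3.const_div_atTop 15)

theorem exists_orthonormalBasis_eq {u : Plane} (hu : ‖u‖ = 1) :
    ∃ b : OrthonormalBasis (Fin 2) ℝ Plane, b 0 = u := by
  have h : Orthonormal ℝ (({0} : Set (Fin 2)).domRestrict fun _ => u) :=
    ⟨fun _ => hu, fun i j hij => absurd (Subsingleton.elim i j) hij⟩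
  obtain ⟨b, hb⟩ := h.exists_orthonormalBasis_extension_of_card_eq (by simp)
  exact ⟨b, hb 0 rfl⟩

end Crossings

end PoissonCellular

end

theorem mainTheorem3 {Ω : Type*} [MeasurableSpace Ω] (P : Measure Ω) [IsProbabilityMeasure P]
    (lam v p w β : ℝ) (hlam : 0 < lam) (hv : 0 < v) (hp : 0 < p) (hw : 0 < w) (hβ : 2 < β)
    (u : PoissonCellular.Plane) (hu : ‖u‖ = 1)
    (Φ : Ω → Set PoissonCellular.Plane)
    (hΦ : PoissonCellular.IsPoissonPointProcess Φ lam P) :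
    (∀ γ : ℝ, 0 < γ →
      (∀ᵐ ω ∂P, StrictMono (PoissonCellular.upCrossingTime p w β γ (Φ ω) v u) ∧
        Set.range (PoissonCellular.upCrossingTime p w β γ (Φ ω) v u) =
          PoissonCellular.upCrossings p w β γ (Φ ω) v u) ∧
      PoissonCellular.IsRenewalProcess
        (fun n ω => PoissonCellular.upCrossingTime p w β γ (Φ ω) v u n) P) ∧
    (∀ n : ℕ,
      TendstoInDistribution
        (fun (γ : ℝ) ω => (2 * lam * v * PoissonCellular.coverageRadius p w β γ) *
          PoissonCellular.interArrival p w β γ (Φ ω) v u n)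
        atTop id (fun _ => P) (expMeasure 1) ∧
      TendstoInDistribution
        (fun (γ : ℝ) ω => (2 * lam * v * PoissonCellular.coverageRadius p w β γ *
            Real.exp (-(lam * Real.pi * PoissonCellular.coverageRadius p w β γ ^ 2))) *
          PoissonCellular.interArrival p w β γ (Φ ω) v u n)
        (𝓝[>] (0 : ℝ)) id (fun _ => P) (expMeasure 1)) := by
  obtain ⟨b, rfl⟩ := PoissonCellular.exists_orthonormalBasis_eq hu
  have hβ0 : 0 < β := by linarith
  exact ⟨fun γ hγ => ⟨PoissonCellular.ae_strictMono_upCrossingTime hlam hv hp hw hβ0 hγ hΦ,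
    PoissonCellular.isRenewalProcess_upCrossingTime hlam hv hp hw hβ0 hγ hΦ⟩,
    fun n => ⟨PoissonCellular.tendstoInDistribution_atTop hlam hv hp hw hβ0 hΦ n,
      PoissonCellular.tendstoInDistribution_zero hlam hv hp hw hβ0 hΦ n⟩⟩
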